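/- Let $\delta>0$, $\lambda\in\mathbb R$, and let $f_0$ be a probability density on $\mathbb R$ with $\int|v|^{2+\delta}f_0(v)\,dv<\infty$, $\int v f_0(v)\,dv=0$ and $\int v^2f_0(v)\,dv=1$. For $p>q>0$, a weak solution of the Boltzmann equation with mixing parameters $p,q$ and initial density $f_0$ is a family $f(\cdot,t)$, $t>0$, of probability densities on $\mathbb R$ with $\int|v|^{2+\delta}f(v,t)\,dv<\infty$ such that for all $\phi\in C_c^\infty(\mathbb R)$ and $t>0$ $$\frac{d}{dt}\int_{\mathbb R}\phi(v)f(v,t)\,dv=\int_{\mathbb R^2}f(v,t)f(w,t)\bigl(\phi(pv+qw)-\phi(v)\bigr)\,dv\,dw,\qquad \lim_{t\to0^+}\int\phi(v) f(v,t)\,dv=\int\phi(v) f_0(v)\,dv .$$ Put $E(t)=\int v^2f(v,t)\,dv$, $g(v,t)=\sqrt{E(t)}\,f\bigl(v\sqrt{E(t)},t\bigr)$ and $h_q(v,\tau)=g(v,q^{-2}\tau)$. For $s>0$ let $\mathcal F_s$ be the class of functions $\phi:\mathbb R\to\mathbb R$ that are $m$ times continuously differentiable with $\phi^{(m)}$ (globally)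 Hölder continuous of order $\beta$, where $m\ge 0$ is an integer, $0<\beta\le1$ and $m+\beta=s$. (For $s=2+\delta$ with $\delta\le1$ this says that $\phi''$ is $\delta$-Hölder.) Theorem. Let $p_n>q_n>0$ satisfy $q_n\to0$ and $(p_n-1)^2/q_n^2=\lambda^2$ for all $n$, and for each $n$ let $f_n$ be a weak solution of the Boltzmann equation with mixing parameters $p_n,q_n$ and initial density $f_0$, with rescaled density $h_{q_n}$. Then there are a subsequence $(n_j)$ and a family $h(\cdot,\tau)$, $\tau>0$, of probability densities with $\int|v|^{2+\delta}h(v,\tau)\,dv<\infty$ such that for all $\phi\in\mathcal F_{2+\delta}$ and all $\tau>0$ $$\int_{\mathbb R}\phi(v)h_{q_{n_j}}(v,\tau)\,dv\to\int_{\mathbb R}\phi(v)h(v,\tau)\,dv\qquad(j\to\infty).$$ Moreover $h$ is a weak solution of the Fokker–Planck equation $$\partial_\tau h=\tfrac12\Bigl[\partial_v^2\bigl((1+\lambda^2v^2)h\bigr)+(1+\lambda^2)\,\partial_v(vh)\Bigr]$$ with initial density $f_0$, that is, for all $\phi\in\mathcal F_{2+\delta}$ and $\tau>0$ $$\frac{d}{d\tau}\int\phi(v)h(v,\tau)\,dv=\frac12\int(\lambda^2v^2+1)\phi''(v)h(v,\tau)\,dv-\frac{\lambda^2+1}2\int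 v\phi'(v)h(v,\tau)\,dv,$$ and $\int\phi(v)h(v,\tau)\,dv\to\int\phi(v)f_0(v)\,dv$ as $\tau\to0^+$. -/

import Mathlib

open MeasureTheory Filter Topology
open scoped ContDiff

noncomputable section

namespace KineticFP

/-- `f` is a probability density on the real line. -/
def IsProbDensity (f : ℝ → ℝ) : Prop :=
  (∀ᵐ v, 0 ≤ f v) ∧ Integrable f ∧ ∫ v, f v = 1

/-- `f` is a probability density on the real line with finite absolute moment of order `a`. -/
def IsProbDensityWithMoment (a : ℝ) (f : ℝ → ℝ) : Prop :=
  IsProbDensity f ∧ Integrable (fun v => |v| ^ a * f v)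

/-- Normalization of the initial density (which already has unit mass):
mean zero and second moment one. -/
def IsNormalized (f : ℝ → ℝ) : Prop :=
  ∫ v, v * f v = 0 ∧ ∫ v, v ^ 2 * f v = 1

/-- The collision term tested against `φ`, for the rule `v* = p v + q w`:
the integral of `f(v) f(w) (φ(v*) - φ(v))` over the plane. -/
def collision (p q : ℝ) (f φ : ℝ → ℝ) : ℝ :=
  ∫ z : ℝ × ℝ, f z.1 * f z.2 * (φ (p * z.1 + q * z.2) - φ z.1)

/-- Weak solution of the Boltzmann equation with mixing parameters `p, q` and initial density `f₀`,
in the class of probability densities with finite moment of order `a`;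
`f t v` is the density at time `t` and velocity `v`. Test functions are smooth with compact support,
the weakest form of the requirement. -/
structure IsWeakBoltzmannSolution (p q a : ℝ) (f₀ : ℝ → ℝ) (f : ℝ → ℝ → ℝ) : Prop where
  density : ∀ t, 0 < t → IsProbDensityWithMoment a (f t)
  weak_form : ∀ φ : ℝ → ℝ, ContDiff ℝ ∞ φ → HasCompactSupport φ → ∀ t, 0 < t →
    HasDerivAt (fun s => ∫ v, φ v * f s v) (collision p q (f t) φ) t
  initial : ∀ φ : ℝ → ℝ, ContDiff ℝ ∞ φ → HasCompactSupport φ →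
    Tendsto (fun t => ∫ v, φ v * f t v) (𝓝[>] 0) (𝓝 (∫ v, φ v * f₀ v))

/-- The energy `E(t)`, i.e. the second moment of `f(·, t)`. -/
def energy (f : ℝ → ℝ → ℝ) (t : ℝ) : ℝ := ∫ v, v ^ 2 * f t v

/-- The solution scaled by its energy: `g(v, t) = √E(t) f(v √E(t), t)`. -/
def scaled (f : ℝ → ℝ → ℝ) (t v : ℝ) : ℝ :=
  √(energy f t) * f t (v * √(energy f t))

/-- The scaled density in the slow time `τ = q² t`: `h(v, τ) = g(v, τ / q²)`. -/
def slowScaled (q : ℝ) (f : ℝ → ℝ → ℝ) (τ v : ℝ) : ℝ :=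
  scaled f (τ / q ^ 2) v

/-- The class `F_s`: functions whose `m`-th derivative is Hölder continuous of order `β`,
where `m` is an integer, `0 < β ≤ 1` and `m + β = s`. -/
def HolderClass (s : ℝ) : Set (ℝ → ℝ) :=
  {φ | ∃ (m : ℕ) (β : ℝ), 0 < β ∧ β ≤ 1 ∧ (m : ℝ) + β = s ∧ ContDiff ℝ m φ ∧
    ∃ C : ℝ, ∀ v w, |iteratedDeriv m φ v - iteratedDeriv m φ w| ≤ C * |v - w| ^ β}

/-- Weak solution, with initial density `f₀`, of the Fokker-Planck equation
`∂_τ h = ½ (∂_v² ((1 + lam² v²) h) + (1 + lam²) ∂_v (v h))`, in the class of probability densities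
with finite moment of order `s` and with test functions in `F_s` (`s > 2`). -/
structure IsWeakFokkerPlanckSolution (lam s : ℝ) (f₀ : ℝ → ℝ) (h : ℝ → ℝ → ℝ) : Prop where
  density : ∀ τ, 0 < τ → IsProbDensityWithMoment s (h τ)
  weak_form : ∀ φ ∈ HolderClass s, ∀ τ, 0 < τ →
    HasDerivAt (fun r => ∫ v, φ v * h r v)
      (1 / 2 * (∫ v, (lam ^ 2 * v ^ 2 + 1) * iteratedDeriv 2 φ v * h τ v)
        - 1 / 2 * (lam ^ 2 + 1) * ∫ v, deriv φ v * v * h τ v) τ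
  initial : ∀ φ ∈ HolderClass s,
    Tendsto (fun τ => ∫ v, φ v * h τ v) (𝓝[>] 0) (𝓝 (∫ v, φ v * f₀ v))

end KineticFP

end

open MeasureTheory Filter Topology
open scoped ContDiff

/-! The argument runs on measures rather than densities; that the limit has a density is recovered
at the end.

The weak form is given only for smooth compactly supported test functions. The loss term is exactly
`-∫ φ`, so `e^t ∫ φ` is nondecreasing for `φ ≥ 0`. Hence a moment at time `T` controls the moments
at all earlier times. This local bound extends the weak form, by approximation, to every continuous
`φ` of growth `2 + δ` (`IsFlow.hasDerivWithinAt_integral`). Testing with `v` and `v ^ 2` gives mean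
zero and energy `exp((p² + q² - 1) t)`, so the scaling by the energy is an explicit dilation.

In the slow time a first order Taylor expansion of `φ(pv + qw)` at `v` leaves `(p - 1) ∫ v φ'`. The
dilation cancels this term exactly, because `(p² + q² - 1)/2 = (p - 1) + ½(λ² + 1) q²`. What remains
is the drift `-½(λ² + 1) ∫ v φ'` and the second order remainder divided by `q²`. Since mean is zero,
energy is one and `(p - 1)² = λ² q²`, that remainder tends to `½ ∫ (λ² v² + 1) φ''`, whatever the
sign of `p - 1`. The error is `O(q^κ)` for a Hölder modulus of exponent `κ`
(`IsScaledFlow.abs_rate_sub_generator_le`).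

Test functions grow like the highest available moment, so bounded moments do not suffice: the tails
must be small uniformly in `n`. They are propagated by Grönwall's inequality for a twice
differentiable function `kernPrim₂ δ R`, comparable to `v² kern δ R v`, with constants independent
of `R` and `n` (`IsScaledFlow.integral_tail_le`). Tightness, equicontinuity in time and a diagonal
argument give a limit curve of measures. Uniform tails upgrade the convergence to all functions of
growth `2 + δ`, and the integrated equation passes to the limit (`IsScaledSequence.exists_limit`).

Weak limits of densities may be singular. This is excluded by a bound `∫ φ dμ ≤ ε + K ∫ φ` for
cutoffs `φ`. The collision multiplies `K` at rate `p⁻¹ - 1` and the dilation at rate `(p² + q² -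
1)/2`; the sum of these rates is `O(q²)`, so the bound is uniform in the slow time
(`IsFlow.densityBound_scaled`). It survives the limit and forces absolute continuity. -/

namespace KineticFP

/-! ### Weights, growth classes and integrability against product measures. -/

/-- The weight `(1 + |v|)^a` controlling the growth of test functions. -/
noncomputable def weight (a v : ℝ) : ℝ := (1 + |v|) ^ a

lemma one_le_weight {a : ℝ} (ha : 0 ≤ a) (v : ℝ) : 1 ≤ weight a v :=
  Real.one_le_rpow (by linarith [abs_nonneg v]) ha

lemma weight_pos (a v : ℝ) : 0 < weight a v :=
  Real.rpow_pos_of_pos (by positivity) a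

lemma continuous_weight (a : ℝ) : Continuous (weight a) :=
  (continuous_const.add continuous_abs).rpow_const fun v =>
    Or.inl (show 1 + |v| ≠ 0 by positivity)

lemma weight_le_weight {a b : ℝ} (hab : a ≤ b) (v : ℝ) : weight a v ≤ weight b v :=
  Real.rpow_le_rpow_of_exponent_le (by linarith [abs_nonneg v]) hab

lemma weight_mono_abs {a : ℝ} (ha : 0 ≤ a) {v w : ℝ} (h : |v| ≤ |w|) :
    weight a v ≤ weight a w :=
  Real.rpow_le_rpow (by positivity) (by linarith) ha

lemma weight_add_exp (a b v : ℝ) : weight (a + b) v = weight a v * weight b v :=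
  Real.rpow_add (by positivity) a b

lemma weight_one (v : ℝ) : weight 1 v = 1 + |v| := Real.rpow_one _

lemma weight_two (v : ℝ) : weight 2 v = (1 + |v|) ^ 2 := by
  unfold weight; norm_cast

lemma weight_add_le {a : ℝ} (ha : 0 ≤ a) (v w : ℝ) :
    weight a (v + w) ≤ weight a v * weight a w := by
  unfold weight
  rw [← Real.mul_rpow (by positivity) (by positivity)]
  refine Real.rpow_le_rpow (by positivity) ?_ ha
  nlinarith [abs_add_le v w, abs_nonneg v, abs_nonneg w, mul_nonneg (abs_nonneg v) (abs_nonneg w)]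

lemma weight_mul_le {a : ℝ} (ha : 0 ≤ a) (v w : ℝ) :
    weight a (v * w) ≤ weight a v * weight a w := by
  unfold weight
  rw [← Real.mul_rpow (by positivity) (by positivity)]
  refine Real.rpow_le_rpow (by positivity) ?_ ha
  rw [abs_mul]
  nlinarith [abs_nonneg v, abs_nonneg w]

/-- The product form of the bound makes the gain term integrable against `μ ⊗ μ` with only the
moment of order `a` of `μ`. -/
lemma weight_mix_le {a : ℝ} (ha : 0 ≤ a) (p q v w : ℝ) :
    weight a (p * v + q * w) ≤ weight a p * weight a q * (weight a v * weight a w) := by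
  have h1 := weight_add_le ha (p * v) (q * w)
  have h2 := weight_mul_le ha p v
  have h3 := weight_mul_le ha q w
  have := mul_le_mul h2 h3 (weight_pos a _).le
    (mul_nonneg (weight_pos a p).le (weight_pos a v).le)
  nlinarith

/-- `φ` is continuous and bounded by `C (1 + |v|)^a`. -/
def HasGrowth (a C : ℝ) (φ : ℝ → ℝ) : Prop :=
  Continuous φ ∧ ∀ v, |φ v| ≤ C * weight a v

lemma HasGrowth.nonneg {a C : ℝ} {φ : ℝ → ℝ} (h : HasGrowth a C φ) : 0 ≤ C := by
  have h1 := (abs_nonneg _).trans (h.2 0)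
  exact nonneg_of_mul_nonneg_left h1 (weight_pos a 0)

lemma HasGrowth.mono {a b C D : ℝ} {φ : ℝ → ℝ} (h : HasGrowth a C φ) (hab : a ≤ b)
    (hCD : C ≤ D) : HasGrowth b D φ :=
  ⟨h.1, fun v => (h.2 v).trans (mul_le_mul hCD (weight_le_weight hab v) (weight_pos a v).le
    (h.nonneg.trans hCD))⟩

lemma hasGrowth_weight (a : ℝ) : HasGrowth a 1 (weight a) :=
  ⟨continuous_weight a, fun v => by rw [abs_of_pos (weight_pos a v), one_mul]⟩

lemma HasGrowth.mul {a b C D : ℝ} {φ ψ : ℝ → ℝ} (h : HasGrowth a C φ) (h' : HasGrowth b D ψ) :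
    HasGrowth (a + b) (C * D) (fun v => φ v * ψ v) :=
  ⟨h.1.mul h'.1, fun v => by
    rw [abs_mul, weight_add_exp]
    calc |φ v| * |ψ v| ≤ (C * weight a v) * (D * weight b v) :=
          mul_le_mul (h.2 v) (h'.2 v) (abs_nonneg _) ((abs_nonneg _).trans (h.2 v))
      _ = _ := by ring⟩

lemma HasGrowth.add {a C D : ℝ} {φ ψ : ℝ → ℝ} (h : HasGrowth a C φ) (h' : HasGrowth a D ψ) :
    HasGrowth a (C + D) (fun v => φ v + ψ v) :=
  ⟨h.1.add h'.1, fun v => by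
    rw [add_mul]; exact (abs_add_le _ _).trans (add_le_add (h.2 v) (h'.2 v))⟩

lemma HasGrowth.const_mul {a C : ℝ} {φ : ℝ → ℝ} (h : HasGrowth a C φ) (c : ℝ) :
    HasGrowth a (|c| * C) (fun v => c * φ v) :=
  ⟨continuous_const.mul h.1, fun v => by
    rw [abs_mul, mul_assoc]; exact mul_le_mul_of_nonneg_left (h.2 v) (abs_nonneg c)⟩

lemma HasGrowth.comp_mul {a C : ℝ} {φ : ℝ → ℝ} (ha : 0 ≤ a) (h : HasGrowth a C φ) (c : ℝ) :
    HasGrowth a (C * weight a c) (fun v => φ (c * v)) :=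
  ⟨h.1.comp (continuous_const.mul continuous_id), fun v => by
    rw [mul_assoc]
    exact (h.2 _).trans (mul_le_mul_of_nonneg_left (weight_mul_le ha c v) h.nonneg)⟩

lemma hasGrowth_id : HasGrowth 1 1 (fun v : ℝ => v) :=
  ⟨continuous_id, fun v => by rw [weight_one]; linarith⟩

lemma hasGrowth_sq : HasGrowth 2 1 (fun v : ℝ => v ^ 2) :=
  ⟨continuous_id.pow 2, fun v => by
    rw [weight_two, abs_pow, one_mul]
    exact pow_le_pow_left₀ (abs_nonneg v) (by linarith) 2⟩

lemma HasGrowth.of_hasCompactSupport {φ : ℝ → ℝ} (hφ : Continuous φ) (hc : HasCompactSupport φ)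
    {a : ℝ} (ha : 0 ≤ a) : ∃ C, HasGrowth a C φ := by
  obtain ⟨C, hC⟩ := hc.exists_bound_of_continuous hφ
  have hC0 : 0 ≤ C := (norm_nonneg _).trans (hC 0)
  exact ⟨C, hφ, fun v => (hC v).trans (le_mul_of_one_le_right hC0 (one_le_weight ha v))⟩

lemma HasGrowth.integrable {a C : ℝ} {φ : ℝ → ℝ} (h : HasGrowth a C φ) {μ : Measure ℝ}
    (hμ : Integrable (weight a) μ) : Integrable φ μ :=
  (hμ.const_mul C).mono' h.1.aestronglyMeasurable (Eventually.of_forall fun v => h.2 v)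

lemma HasGrowth.abs_integral_le {a C : ℝ} {φ : ℝ → ℝ} (h : HasGrowth a C φ) {μ : Measure ℝ}
    (hμ : Integrable (weight a) μ) : |∫ v, φ v ∂μ| ≤ C * ∫ v, weight a v ∂μ := by
  rw [← integral_const_mul]
  exact norm_integral_le_of_norm_le (f := φ) (hμ.const_mul C) (Eventually.of_forall fun v => h.2 v)

/-- A function on the plane bounded by a multiple of the product weight is integrable against
product measures with finite moments. -/
lemma integrable_prod_of_le_weight {a C : ℝ} {F : ℝ × ℝ → ℝ} (hF : Continuous F)
    (hb : ∀ z, |F z| ≤ C * (weight a z.1 * weight a z.2)) {μ ν : Measure ℝ} [SFinite μ] [SFinite ν]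
    (hμ : Integrable (weight a) μ) (hν : Integrable (weight a) ν) : Integrable F (μ.prod ν) :=
  ((hμ.mul_prod hν).const_mul C).mono' hF.aestronglyMeasurable (Eventually.of_forall fun z => hb z)

lemma abs_integral_prod_le_of_le_weight {a C : ℝ} {F : ℝ × ℝ → ℝ}
    (hb : ∀ z, |F z| ≤ C * (weight a z.1 * weight a z.2)) {μ ν : Measure ℝ} [SFinite μ] [SFinite ν]
    (hμ : Integrable (weight a) μ) (hν : Integrable (weight a) ν) :
    |∫ z, F z ∂(μ.prod ν)| ≤ C * ((∫ v, weight a v ∂μ) * ∫ v, weight a v ∂ν) := by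
  rw [← integral_prod_mul, ← integral_const_mul]
  exact norm_integral_le_of_norm_le (f := F) ((hμ.mul_prod hν).const_mul C)
    (Eventually.of_forall fun z => hb z)

lemma HasGrowth.mix_le {a C : ℝ} (ha : 0 ≤ a) {φ : ℝ → ℝ} (h : HasGrowth a C φ) (p q : ℝ)
    (z : ℝ × ℝ) :
    |φ (p * z.1 + q * z.2)| ≤ C * (weight a p * weight a q) * (weight a z.1 * weight a z.2) := by
  rw [mul_assoc]
  exact (h.2 _).trans (mul_le_mul_of_nonneg_left (weight_mix_le ha p q _ _) h.nonneg)

lemma HasGrowth.integrable_mix {a C : ℝ} (ha : 0 ≤ a) {φ : ℝ → ℝ} (h : HasGrowth a C φ) (p q : ℝ)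
    {μ ν : Measure ℝ} [SFinite μ] [SFinite ν]
    (hμ : Integrable (weight a) μ) (hν : Integrable (weight a) ν) :
    Integrable (fun z : ℝ × ℝ => φ (p * z.1 + q * z.2)) (μ.prod ν) :=
  integrable_prod_of_le_weight (by have := h.1; fun_prop) (h.mix_le ha p q) hμ hν

/-! ### Smooth approximation and the Taylor estimate. -/

/-- Continuous functions are approximated by smooth functions with compact support. -/
lemma exists_smooth_approx {φ : ℝ → ℝ} (hφ : Continuous φ) :
    ∃ g : ℕ → ℝ → ℝ, (∀ n, ContDiff ℝ ∞ (g n)) ∧ (∀ n, HasCompactSupport (g n)) ∧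
      (∀ (n : ℕ) (v : ℝ), |v| ≤ n → |g n v - φ v| ≤ 1 / ((n : ℝ) + 1)) ∧ (∀ n v, |g n v| ≤ |φ v| + 1) ∧
      ((∀ v, 1 ≤ φ v) → ∀ n v, 0 ≤ g n v) := by
  have h1 : ∀ n : ℕ, ∃ g : ℝ → ℝ, ContDiff ℝ ∞ g ∧ (∀ v, |g v - φ v| < 1 / ((n : ℝ) + 1)) := by
    intro n
    obtain ⟨g, hg, hg', -⟩ := hφ.exists_contDiff_approx (⊤ : ℕ∞)
      (ε := fun _ => 1 / ((n : ℝ) + 1)) continuous_const (fun _ => by positivity)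
    exact ⟨g, hg, hg'⟩
  choose g hg hgφ using h1
  let χ : ℕ → ContDiffBump (0 : ℝ) := fun n => ⟨(n : ℝ) + 1, (n : ℝ) + 2, by positivity, by linarith⟩
  have hle : ∀ n : ℕ, 1 / ((n : ℝ) + 1) ≤ 1 := fun n => by
    rw [div_le_one (by positivity)]; linarith [n.cast_nonneg (α := ℝ)]
  refine ⟨fun n v => χ n v * g n v, fun n => ((χ n).contDiff).mul (hg n),
    fun n => (χ n).hasCompactSupport.mul_right, fun n v hv => ?_, fun n v => ?_, fun h n v => ?_⟩
  · have : χ n v = 1 := (χ n).one_of_mem_closedBall (by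
      simp only [Metric.mem_closedBall, dist_zero_right, Real.norm_eq_abs]
      change |v| ≤ (n : ℝ) + 1
      linarith)
    simp only [this, one_mul]
    exact (hgφ n v).le
  · rw [abs_mul, abs_of_nonneg (χ n).nonneg]
    have h2 := (abs_lt.1 (hgφ n v))
    have h3 : |g n v| ≤ |φ v| + 1 := by
      calc |g n v| = |φ v + (g n v - φ v)| := by ring_nf
        _ ≤ |φ v| + |g n v - φ v| := abs_add_le _ _
        _ ≤ _ := by linarith [hgφ n v, hle n]
    exact (mul_le_of_le_one_left (abs_nonneg _) (χ n).le_one).trans h3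
  · have h2 := (abs_lt.1 (hgφ n v))
    exact mul_nonneg (χ n).nonneg (by linarith [h v, hle n])

lemma tendsto_smooth_approx {φ : ℝ → ℝ} {g : ℕ → ℝ → ℝ}
    (hg : ∀ (n : ℕ) (v : ℝ), |v| ≤ n → |g n v - φ v| ≤ 1 / ((n : ℝ) + 1)) (v : ℝ) :
    Tendsto (fun n => g n v) atTop (𝓝 (φ v)) := by
  rw [tendsto_iff_norm_sub_tendsto_zero]
  refine squeeze_zero' (Eventually.of_forall fun _ => norm_nonneg _) ?_
    tendsto_one_div_add_atTop_nhds_zero_nat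
  obtain ⟨N, hN⟩ := exists_nat_ge |v|
  filter_upwards [eventually_ge_atTop N] with n hn
  exact hg n v (hN.trans (by exact_mod_cast hn))

/-- Second order Taylor estimate: the remainder is controlled by the oscillation of the
second derivative. -/
lemma abs_taylor_two_le {φ φ' φ'' : ℝ → ℝ} (h1 : ∀ x, HasDerivAt φ (φ' x) x)
    (h2 : ∀ x, HasDerivAt φ' (φ'' x) x) {v u c M : ℝ}
    (hM : ∀ x, |x - v| ≤ |u| → |φ'' x - c| ≤ M) :
    |φ (v + u) - φ v - φ' v * u - 1 / 2 * c * u ^ 2| ≤ M * u ^ 2 := by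
  have hM0 : 0 ≤ M := (abs_nonneg _).trans (hM v (by simp))
  have hconv : Convex ℝ {x : ℝ | |x - v| ≤ |u|} := by
    have := convex_closedBall v |u|
    simpa [Metric.closedBall, Real.dist_eq] using this
  have hv : v ∈ {x : ℝ | |x - v| ≤ |u|} := by simp
  have key1 : ∀ x ∈ {x : ℝ | |x - v| ≤ |u|}, |φ' x - φ' v - c * (x - v)| ≤ M * |u| := by
    intro x hx
    have := hconv.norm_image_sub_le_of_norm_hasDerivWithin_le (f := fun x => φ' x - c * x)
      (f' := fun x => φ'' x - c) (C := M)
      (fun y _ => (((h2 y).sub ((hasDerivAt_id y).const_mul c)).congr_deriv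
        (by simp)).hasDerivWithinAt)
      (fun y hy => hM y hy) hv hx
    simp only [Real.norm_eq_abs] at this
    calc |φ' x - φ' v - c * (x - v)| = |φ' x - c * x - (φ' v - c * v)| := by ring_nf
      _ ≤ M * |x - v| := this
      _ ≤ M * |u| := mul_le_mul_of_nonneg_left hx hM0
  have := hconv.norm_image_sub_le_of_norm_hasDerivWithin_le
      (f := fun x => φ x - φ' v * x - 1 / 2 * c * (x - v) ^ 2)
      (f' := fun x => φ' x - φ' v - c * (x - v)) (C := M * |u|)
      (fun y _ => by
        have h3 := ((h1 y).sub ((hasDerivAt_id y).const_mul (φ' v))).sub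
          ((((hasDerivAt_id y).sub_const v).pow 2).const_mul (1 / 2 * c))
        refine (h3.congr_deriv ?_).hasDerivWithinAt
        simp; ring)
      key1 hv (show v + u ∈ {x : ℝ | |x - v| ≤ |u|} by simp)
  simp only [Real.norm_eq_abs] at this
  calc |φ (v + u) - φ v - φ' v * u - 1 / 2 * c * u ^ 2|
      = |φ (v + u) - φ' v * (v + u) - 1 / 2 * c * (v + u - v) ^ 2
          - (φ v - φ' v * v - 1 / 2 * c * (v - v) ^ 2)| := by ring_nf
    _ ≤ M * |u| * |v + u - v| := this
    _ = M * u ^ 2 := by rw [add_sub_cancel_left, mul_assoc, ← sq, sq_abs]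

/-! ### Flows of measures: extending the weak form to growing test functions. -/

/-- The gain term of the collision operator tested against `φ`. -/
noncomputable def gain (p q : ℝ) (φ : ℝ → ℝ) (μ : Measure ℝ) : ℝ :=
  ∫ z : ℝ × ℝ, φ (p * z.1 + q * z.2) ∂(μ.prod μ)

/-- A weak solution of the Boltzmann equation as a family of probability measures, extended
to nonpositive times by the initial datum. -/
structure IsFlow (p q a : ℝ) (μ : ℝ → Measure ℝ) : Prop where
  prob : ∀ t, IsProbabilityMeasure (μ t)
  moment : ∀ t, Integrable (weight a) (μ t)
  weak : ∀ φ : ℝ → ℝ, ContDiff ℝ ∞ φ → HasCompactSupport φ → ∀ t, 0 < t →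
    HasDerivAt (fun s => ∫ v, φ v ∂μ s) (gain p q φ (μ t) - ∫ v, φ v ∂μ t) t
  initial : ∀ φ : ℝ → ℝ, ContDiff ℝ ∞ φ → HasCompactSupport φ →
    Tendsto (fun t => ∫ v, φ v ∂μ t) (𝓝[>] 0) (𝓝 (∫ v, φ v ∂μ 0))
  const : ∀ t ≤ 0, μ t = μ 0

/-- Freezing one of the two measures turns the gain into an ordinary integral of an admissible test
function. Time regularity of the quadratic gain thus reduces to that of linear functionals. -/
lemma HasGrowth.average {a C : ℝ} (ha : 0 ≤ a) {φ : ℝ → ℝ} (h : HasGrowth a C φ) (p q : ℝ)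
    {ν : Measure ℝ} (hν : Integrable (weight a) ν) :
    HasGrowth a (C * (weight a p * weight a q) * ∫ w, weight a w ∂ν)
      (fun v => ∫ w, φ (p * v + q * w) ∂ν) := by
  have hb := h.mix_le ha p q
  have hC : 0 ≤ C * (weight a p * weight a q) :=
    mul_nonneg h.nonneg (mul_pos (weight_pos _ _) (weight_pos _ _)).le
  have hc := h.1
  refine ⟨continuous_iff_continuousAt.2 fun v₀ => ?_, fun v => ?_⟩
  · refine continuousAt_of_dominated
      (bound := fun w => C * (weight a p * weight a q) * (weight a (|v₀| + 1) * weight a w))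
      (Eventually.of_forall fun v => ?_) ?_ ((hν.const_mul _).const_mul _)
      (Eventually.of_forall fun w => ?_)
    · exact Continuous.aestronglyMeasurable (by fun_prop)
    · filter_upwards [Metric.ball_mem_nhds v₀ one_pos] with v hv
      refine Eventually.of_forall fun w => ?_
      refine (hb (v, w)).trans (mul_le_mul_of_nonneg_left ?_ hC)
      refine mul_le_mul_of_nonneg_right (weight_mono_abs ha ?_) (weight_pos _ _).le
      rw [Metric.mem_ball, Real.dist_eq] at hv
      rw [abs_of_nonneg (show 0 ≤ |v₀| + 1 by positivity)]
      have := abs_add_le v₀ (v - v₀)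
      simp only [add_sub_cancel] at this
      linarith
    · exact Continuous.continuousAt (by fun_prop)
  · have : |∫ w, φ (p * v + q * w) ∂ν| ≤
        ∫ w, C * (weight a p * weight a q) * (weight a v * weight a w) ∂ν :=
      norm_integral_le_of_norm_le (f := fun w => φ (p * v + q * w)) ((hν.const_mul _).const_mul _)
        (Eventually.of_forall fun w => hb (v, w))
    rw [integral_const_mul, integral_const_mul] at this
    linarith

namespace IsFlow

variable {p q a : ℝ} {μ : ℝ → Measure ℝ}

lemma abs_gain_le (h : IsFlow p q a μ) (ha : 0 ≤ a) {C : ℝ} {φ : ℝ → ℝ} (hφ : HasGrowth a C φ)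
    (t : ℝ) : |gain p q φ (μ t)| ≤
      C * (weight a p * weight a q) * ((∫ v, weight a v ∂μ t) * ∫ v, weight a v ∂μ t) := by
  have := h.prob t
  exact abs_integral_prod_le_of_le_weight (hφ.mix_le ha p q) (h.moment t) (h.moment t)

lemma one_le_moment (h : IsFlow p q a μ) (ha : 0 ≤ a) (t : ℝ) : 1 ≤ ∫ v, weight a v ∂μ t := by
  have := h.prob t
  calc (1 : ℝ) = ∫ _, 1 ∂μ t := by simp
    _ ≤ _ := integral_mono (integrable_const 1) (h.moment t) (one_le_weight ha)

lemma continuous_smooth (h : IsFlow p q a μ) {φ : ℝ → ℝ} (hφ : ContDiff ℝ ∞ φ)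
    (hc : HasCompactSupport φ) : Continuous fun t => ∫ v, φ v ∂μ t := by
  refine continuous_iff_continuousAt.2 fun t => ?_
  rcases lt_trichotomy t 0 with ht | rfl | ht
  · refine (continuousAt_const (y := ∫ v, φ v ∂μ 0)).congr ?_
    filter_upwards [Iio_mem_nhds ht] with s hs
    rw [h.const s (le_of_lt hs)]
  · rw [continuousAt_iff_continuous_left'_right']
    refine ⟨?_, h.initial φ hφ hc⟩
    refine (continuousWithinAt_const (b := ∫ v, φ v ∂μ 0)).congr (fun s hs => ?_) rfl
    rw [h.const s (le_of_lt hs)]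
  · exact (h.weak φ hφ hc t ht).continuousAt

/-- The integrating factor `e^t` removes the loss term, and the gain of a nonnegative function is
nonnegative. -/
lemma exp_integral_le_smooth (h : IsFlow p q a μ) {φ : ℝ → ℝ} (hφ : ContDiff ℝ ∞ φ)
    (hc : HasCompactSupport φ) (hpos : ∀ v, 0 ≤ φ v) {s t : ℝ} (hs : 0 ≤ s) (hst : s ≤ t) :
    Real.exp s * ∫ v, φ v ∂μ s ≤ Real.exp t * ∫ v, φ v ∂μ t := by
  have hd : ∀ r, 0 < r → HasDerivAt (fun r => Real.exp r * ∫ v, φ v ∂μ r)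
      (Real.exp r * gain p q φ (μ r)) r := fun r hr => by
    refine ((Real.hasDerivAt_exp r).mul (h.weak φ hφ hc r hr)).congr_deriv ?_
    ring
  refine monotoneOn_of_deriv_nonneg (convex_Ici 0)
    (Real.continuous_exp.mul (h.continuous_smooth hφ hc)).continuousOn
    (fun r hr => ?_) (fun r hr => ?_) hs (hs.trans hst) hst
  · rw [interior_Ici] at hr
    exact (hd r hr).differentiableAt.differentiableWithinAt
  · rw [interior_Ici] at hr
    have := (hd r hr).deriv
    change 0 ≤ deriv (fun r => Real.exp r * ∫ v, φ v ∂μ r) r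
    rw [this]
    exact mul_nonneg (Real.exp_pos r).le (integral_nonneg fun z => hpos _)

lemma tendsto_integral_approx {μ : Measure ℝ} (ha : 0 ≤ a) (hμ : Integrable (weight a) μ) {C : ℝ}
    {φ : ℝ → ℝ} (hφ : HasGrowth a C φ) {g : ℕ → ℝ → ℝ} (hgc : ∀ n, Continuous (g n))
    (hg : ∀ (n : ℕ) (v : ℝ), |v| ≤ n → |g n v - φ v| ≤ 1 / ((n : ℝ) + 1))
    (hb : ∀ n v, |g n v| ≤ |φ v| + 1) :
    Tendsto (fun n => ∫ v, g n v ∂μ) atTop (𝓝 (∫ v, φ v ∂μ)) := by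
  refine tendsto_integral_of_dominated_convergence (fun v => (C + 1) * weight a v)
    (fun n => (hgc n).aestronglyMeasurable) (hμ.const_mul _)
    (fun n => Eventually.of_forall fun v => ?_)
    (Eventually.of_forall fun v => tendsto_smooth_approx hg v)
  refine (hb n v).trans ?_
  rw [add_mul, one_mul]
  exact add_le_add (hφ.2 v) (one_le_weight ha v)

/-- The later moment controls the earlier one. Finiteness at each single time therefore already
gives local boundedness in time. -/
lemma exp_moment_le (h : IsFlow p q a μ) (ha : 0 ≤ a) {s t : ℝ} (hs : 0 ≤ s) (hst : s ≤ t) :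
    Real.exp s * ∫ v, weight a v ∂μ s ≤ Real.exp t * ∫ v, weight a v ∂μ t := by
  obtain ⟨g, hg, hgc, hgl, hgb, hg0⟩ := exists_smooth_approx (continuous_weight a)
  have key := fun r => (tendsto_integral_approx ha (h.moment r) (hasGrowth_weight a)
    (fun n => (hg n).continuous) hgl hgb).const_mul (Real.exp r)
  exact le_of_tendsto_of_tendsto' (key s) (key t) fun n =>
    h.exp_integral_le_smooth (hg n) (hgc n) (hg0 (one_le_weight ha) n) hs hst

/-- A bound for the moments on `(-∞, T]`. -/
noncomputable def momentBound (a : ℝ) (μ : ℝ → Measure ℝ) (T : ℝ) : ℝ :=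
  Real.exp T * ∫ v, weight a v ∂μ T

lemma moment_le (h : IsFlow p q a μ) (ha : 0 ≤ a) {s T : ℝ} (hT : 0 ≤ T) (hs : s ≤ T) :
    ∫ v, weight a v ∂μ s ≤ momentBound a μ T := by
  have key : ∀ r, 0 ≤ r → r ≤ T → ∫ v, weight a v ∂μ r ≤ momentBound a μ T := fun r hr hrT =>
    (le_mul_of_one_le_left (zero_le_one.trans (h.one_le_moment ha r)) (Real.one_le_exp hr)).trans
      (h.exp_moment_le ha hr hrT)
  rcases le_total s 0 with h0 | h0
  · rw [h.const s h0]; exact key 0 le_rfl hT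
  · exact key s h0 hs

/-- The operator norm bound of the collision operator on `(-∞, T]`. -/
noncomputable def rateBound (p q a : ℝ) (μ : ℝ → Measure ℝ) (T : ℝ) : ℝ :=
  weight a p * weight a q * (momentBound a μ T * momentBound a μ T) + momentBound a μ T

lemma abs_rate_le (h : IsFlow p q a μ) (ha : 0 ≤ a) {C : ℝ} {φ : ℝ → ℝ} (hφ : HasGrowth a C φ)
    {s T : ℝ} (hT : 0 ≤ T) (hs : s ≤ T) :
    |gain p q φ (μ s) - ∫ v, φ v ∂μ s| ≤ C * rateBound p q a μ T := by
  have h1 := h.abs_gain_le ha hφ s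
  have h2 := hφ.abs_integral_le (h.moment s)
  have h3 := h.moment_le ha hT hs
  have h4 := zero_le_one.trans (h.one_le_moment ha s)
  have h5 : 0 ≤ C * (weight a p * weight a q) :=
    mul_nonneg hφ.nonneg (mul_pos (weight_pos _ _) (weight_pos _ _)).le
  have h6 := mul_le_mul_of_nonneg_left (mul_le_mul h3 h3 h4 (h4.trans h3)) h5
  have h7 := mul_le_mul_of_nonneg_left h3 hφ.nonneg
  have h8 := abs_sub (gain p q φ (μ s)) (∫ v, φ v ∂μ s)
  unfold rateBound
  linarith

lemma rateBound_nonneg (h : IsFlow p q a μ) (ha : 0 ≤ a) (T : ℝ) : 0 ≤ rateBound p q a μ T := by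
  have : 0 ≤ momentBound a μ T :=
    mul_nonneg (Real.exp_pos T).le (zero_le_one.trans (h.one_le_moment ha T))
  have h1 := weight_pos a p
  have h2 := weight_pos a q
  unfold rateBound
  positivity

/-- The rate is a derivative in time, and derivatives of real functions are always measurable. -/
lemma aestronglyMeasurable_rate_smooth (h : IsFlow p q a μ) {φ : ℝ → ℝ}
    (hφ : ContDiff ℝ ∞ φ) (hc : HasCompactSupport φ) {s t : ℝ} (hs : 0 ≤ s) (hst : s ≤ t) :
    AEStronglyMeasurable (fun r => gain p q φ (μ r) - ∫ v, φ v ∂μ r)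
      (volume.restrict (Set.uIoc s t)) := by
  refine ((measurable_deriv (fun r => ∫ v, φ v ∂μ r)).aestronglyMeasurable).congr ?_
  rw [Set.uIoc_of_le hst]
  refine (ae_restrict_iff' measurableSet_Ioc).2 (Eventually.of_forall fun r hr => ?_)
  exact (h.weak φ hφ hc r (hs.trans_lt hr.1)).deriv

lemma integral_rate_smooth (h : IsFlow p q a μ) (ha : 0 ≤ a) {φ : ℝ → ℝ} (hφ : ContDiff ℝ ∞ φ)
    (hc : HasCompactSupport φ) {s t : ℝ} (hs : 0 ≤ s) (hst : s ≤ t) :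
    ∫ r in s..t, (gain p q φ (μ r) - ∫ v, φ v ∂μ r) = (∫ v, φ v ∂μ t) - ∫ v, φ v ∂μ s := by
  obtain ⟨C, hC⟩ := HasGrowth.of_hasCompactSupport hφ.continuous hc ha
  refine intervalIntegral.integral_eq_sub_of_hasDerivAt_of_le hst
    (h.continuous_smooth hφ hc).continuousOn
    (fun r hr => h.weak φ hφ hc r (hs.trans_lt hr.1)) ?_
  refine (intervalIntegrable_const (c := C * rateBound p q a μ t)).mono_fun'
    (h.aestronglyMeasurable_rate_smooth hφ hc hs hst) ?_
  rw [Set.uIoc_of_le hst]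
  refine (ae_restrict_iff' measurableSet_Ioc).2 (Eventually.of_forall fun r hr => ?_)
  exact h.abs_rate_le ha hC (hs.trans hst) hr.2

lemma tendsto_gain_approx (h : IsFlow p q a μ) (ha : 0 ≤ a) {C : ℝ}
    {φ : ℝ → ℝ} {g : ℕ → ℝ → ℝ} (hgc : ∀ n, Continuous (g n))
    (hg : ∀ (n : ℕ) (v : ℝ), |v| ≤ n → |g n v - φ v| ≤ 1 / ((n : ℝ) + 1))
    (hgC : ∀ n, HasGrowth a C (g n)) (t : ℝ) :
    Tendsto (fun n => gain p q (g n) (μ t)) atTop (𝓝 (gain p q φ (μ t))) := by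
  have := h.prob t
  refine tendsto_integral_of_dominated_convergence
    (fun z => C * (weight a p * weight a q) * (weight a z.1 * weight a z.2))
    (fun n => ?_) (((h.moment t).mul_prod (h.moment t)).const_mul _)
    (fun n => Eventually.of_forall fun z => (hgC n).mix_le ha p q z)
    (Eventually.of_forall fun z => tendsto_smooth_approx hg _)
  have := hgc n
  exact Continuous.aestronglyMeasurable (by fun_prop)

/-- The integrated weak form for all test functions of admissible growth. -/
lemma integral_rate (h : IsFlow p q a μ) (ha : 0 ≤ a) {C : ℝ} {φ : ℝ → ℝ} (hφ : HasGrowth a C φ)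
    {s t : ℝ} (hs : 0 ≤ s) (hst : s ≤ t) :
    ∫ r in s..t, (gain p q φ (μ r) - ∫ v, φ v ∂μ r) = (∫ v, φ v ∂μ t) - ∫ v, φ v ∂μ s := by
  obtain ⟨g, hg, hgc, hgl, hgb, -⟩ := exists_smooth_approx hφ.1
  have hgC : ∀ n, HasGrowth a (C + 1) (g n) := fun n => ⟨(hg n).continuous, fun v => by
    refine (hgb n v).trans ?_
    rw [add_mul, one_mul]
    exact add_le_add (hφ.2 v) (one_le_weight ha v)⟩
  have hI := fun r => tendsto_integral_approx ha (h.moment r) hφ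
    (fun n => (hg n).continuous) hgl hgb
  have h1 : Tendsto (fun n => ∫ r in s..t, (gain p q (g n) (μ r) - ∫ v, g n v ∂μ r)) atTop
      (𝓝 (∫ r in s..t, (gain p q φ (μ r) - ∫ v, φ v ∂μ r))) := by
    refine intervalIntegral.tendsto_integral_filter_of_dominated_convergence
      (fun _ => (C + 1) * rateBound p q a μ t)
      (Eventually.of_forall fun n => h.aestronglyMeasurable_rate_smooth (hg n) (hgc n) hs hst)
      (Eventually.of_forall fun n => Eventually.of_forall fun r hr => ?_)
      intervalIntegrable_const (Eventually.of_forall fun r hr =>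
        (h.tendsto_gain_approx ha (fun n => (hg n).continuous) hgl hgC r).sub (hI r))
    rw [Set.uIoc_of_le hst] at hr
    exact h.abs_rate_le ha (hgC n) (hs.trans hst) hr.2
  refine tendsto_nhds_unique h1 (((hI t).sub (hI s)).congr fun n => ?_)
  exact (h.integral_rate_smooth ha (hg n) (hgc n) hs hst).symm

lemma abs_integral_sub_le_of_le (h : IsFlow p q a μ) (ha : 0 ≤ a) {C : ℝ} {φ : ℝ → ℝ}
    (hφ : HasGrowth a C φ) {s t T : ℝ} (hs : 0 ≤ s) (hst : s ≤ t) (ht : t ≤ T) :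
    |(∫ v, φ v ∂μ t) - ∫ v, φ v ∂μ s| ≤ C * rateBound p q a μ T * |t - s| := by
  rw [← h.integral_rate ha hφ hs hst]
  refine intervalIntegral.norm_integral_le_of_norm_le_const
    (f := fun r => gain p q φ (μ r) - ∫ v, φ v ∂μ r) fun r hr => ?_
  rw [Set.uIoc_of_le hst] at hr
  exact h.abs_rate_le ha hφ ((hs.trans hst).trans ht) (hr.2.trans ht)

lemma abs_integral_sub_le (h : IsFlow p q a μ) (ha : 0 ≤ a) {C : ℝ} {φ : ℝ → ℝ}
    (hφ : HasGrowth a C φ) {s t T : ℝ} (hs : s ≤ T) (ht : t ≤ T) (hT : 0 ≤ T) :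
    |(∫ v, φ v ∂μ t) - ∫ v, φ v ∂μ s| ≤ C * rateBound p q a μ T * |t - s| := by
  have hmax : ∀ r, μ r = μ (max r 0) := fun r => by
    rcases le_total r 0 with hr | hr
    · rw [max_eq_right hr, h.const r hr]
    · rw [max_eq_left hr]
  have hlip : |max t 0 - max s 0| ≤ |t - s| := abs_max_sub_max_le_abs t s 0
  have hK := mul_nonneg hφ.nonneg (h.rateBound_nonneg ha T)
  refine le_trans ?_ (mul_le_mul_of_nonneg_left hlip hK)
  rw [hmax t, hmax s]
  rcases le_total (max s 0) (max t 0) with hle | hle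
  · exact h.abs_integral_sub_le_of_le ha hφ (le_max_right _ _) hle (max_le ht hT)
  · rw [abs_sub_comm, abs_sub_comm (max t 0)]
    exact h.abs_integral_sub_le_of_le ha hφ (le_max_right _ _) hle (max_le hs hT)

lemma continuous_integral (h : IsFlow p q a μ) (ha : 0 ≤ a) {C : ℝ} {φ : ℝ → ℝ}
    (hφ : HasGrowth a C φ) : Continuous fun t => ∫ v, φ v ∂μ t := by
  refine continuous_iff_continuousAt.2 fun t => ?_
  refine (continuousAt_of_locally_lipschitz (r := 1)
    (K := C * rateBound p q a μ (|t| + 1)) one_pos) fun s hs => ?_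
  simp only [Real.dist_eq] at hs ⊢
  have h1 : s ≤ |t| + 1 := by
    have := (abs_lt.1 hs).2; linarith [le_abs_self t]
  exact h.abs_integral_sub_le ha hφ (by linarith [le_abs_self t]) h1 (by positivity)

lemma continuous_gain (h : IsFlow p q a μ) (ha : 0 ≤ a) {C : ℝ} {φ : ℝ → ℝ}
    (hφ : HasGrowth a C φ) : Continuous fun t => gain p q φ (μ t) := by
  refine continuous_iff_continuousAt.2 fun t => ?_
  set T := |t| + 1
  set B := momentBound a μ T
  set R := rateBound p q a μ T
  have hT : 0 ≤ T := by positivity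
  refine (continuousAt_of_locally_lipschitz (r := 1)
    (K := 2 * (C * (weight a p * weight a q) * B * R)) one_pos) fun s hs => ?_
  simp only [Real.dist_eq] at hs ⊢
  have h1 : s ≤ T := by
    have := (abs_lt.1 hs).2
    change s ≤ |t| + 1
    linarith [le_abs_self t]
  have h2 : t ≤ T := by
    change t ≤ |t| + 1
    linarith [le_abs_self t]
  have := h.prob s
  have := h.prob t
  have hC : 0 ≤ C * (weight a p * weight a q) :=
    mul_nonneg hφ.nonneg (mul_pos (weight_pos _ _) (weight_pos _ _)).le
  have g1 := (hφ.average ha p q (h.moment s)).mono le_rfl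
    (mul_le_mul_of_nonneg_left (h.moment_le ha hT h1) hC)
  have g2 := (hφ.average ha q p (h.moment t)).mono (D := C * (weight a p * weight a q) * B) le_rfl (by
    rw [mul_comm (weight a q)]
    exact mul_le_mul_of_nonneg_left (h.moment_le ha hT h2) hC)
  have e1 := h.abs_integral_sub_le ha g1 h2 h1 hT
  have e2 := h.abs_integral_sub_le ha g2 h2 h1 hT
  -- The product measures at times `s` and `t` are compared through the mixed product of `μ t` and
  -- `μ s`, changing one factor at a time.
  have i1 : gain p q φ (μ s) = ∫ v, ∫ w, φ (p * v + q * w) ∂μ s ∂μ s :=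
    integral_prod _ (hφ.integrable_mix ha p q (h.moment s) (h.moment s))
  have i2 : gain p q φ (μ t) = ∫ w, ∫ v, φ (q * w + p * v) ∂μ t ∂μ t := by
    rw [gain, integral_prod_symm _ (hφ.integrable_mix ha p q (h.moment t) (h.moment t))]
    simp only [add_comm]
  have i3 : ∫ v, ∫ w, φ (p * v + q * w) ∂μ s ∂μ t = ∫ w, ∫ v, φ (q * w + p * v) ∂μ t ∂μ s := by
    rw [integral_integral_swap (hφ.integrable_mix ha p q (h.moment t) (h.moment s))]
    simp only [add_comm]
  rw [i1, i2]
  rw [← i3] at e2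
  have := abs_add_le ((∫ v, ∫ w, φ (p * v + q * w) ∂μ s ∂μ s) - ∫ v, ∫ w, φ (p * v + q * w) ∂μ s ∂μ t)
    ((∫ v, ∫ w, φ (p * v + q * w) ∂μ s ∂μ t) - ∫ w, ∫ v, φ (q * w + p * v) ∂μ t ∂μ t)
  rw [sub_add_sub_cancel] at this
  refine this.trans ?_
  calc _ ≤ _ := add_le_add e1 e2
    _ = 2 * (C * (weight a p * weight a q) * B * R) * |s - t| := by ring

/-- The weak form for all test functions of admissible growth, including the initial time. -/
lemma hasDerivWithinAt_integral (h : IsFlow p q a μ) (ha : 0 ≤ a) {C : ℝ} {φ : ℝ → ℝ}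
    (hφ : HasGrowth a C φ) {t : ℝ} (ht : 0 ≤ t) :
    HasDerivWithinAt (fun s => ∫ v, φ v ∂μ s) (gain p q φ (μ t) - ∫ v, φ v ∂μ t) (Set.Ici 0) t := by
  have hc : Continuous fun r => gain p q φ (μ r) - ∫ v, φ v ∂μ r :=
    (h.continuous_gain ha hφ).sub (h.continuous_integral ha hφ)
  -- The rate is now known to be continuous, so the integrated weak form can be differentiated at
  -- every time, including `0` from the right.
  have h1 := ((hc.integral_hasStrictDerivAt 0 t).hasDerivAt.add_const
    (∫ v, φ v ∂μ 0)).hasDerivWithinAt (s := Set.Ici 0)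
  refine h1.congr (fun s hs => ?_) ?_
  · rw [h.integral_rate ha hφ le_rfl hs]; ring
  · rw [h.integral_rate ha hφ le_rfl ht]; ring

end IsFlow

/-! ### Grönwall, twice differentiable test functions, exact mean and energy. -/

/-- Grönwall's inequality on the half line, in differential form. -/
lemma le_exp_of_deriv_le {y y' : ℝ → ℝ} {c : ℝ}
    (hd : ∀ t, 0 ≤ t → HasDerivWithinAt y (y' t) (Set.Ici 0) t)
    (hle : ∀ t, 0 ≤ t → y' t ≤ c * y t) {t : ℝ} (ht : 0 ≤ t) : y t ≤ y 0 * Real.exp (c * t) := by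
  have hz : ∀ s, 0 ≤ s → HasDerivWithinAt (fun s => Real.exp (-c * s) * y s)
      (Real.exp (-c * s) * (y' s - c * y s)) (Set.Ici 0) s := fun s hs => by
    have h1 : HasDerivAt (fun s => Real.exp (-c * s)) (Real.exp (-c * s) * (-c)) s := by
      simpa using ((hasDerivAt_id s).const_mul (-c)).exp
    exact (h1.hasDerivWithinAt.mul (hd s hs)).congr_deriv (by ring)
  have hanti : AntitoneOn (fun s => Real.exp (-c * s) * y s) (Set.Ici 0) := by
    refine antitoneOn_of_deriv_nonpos (convex_Ici 0) (fun s hs => (hz s hs).continuousWithinAt)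
      (fun s hs => ?_) (fun s hs => ?_) <;> rw [interior_Ici] at hs <;>
      have h2 := (hz s (le_of_lt hs)).hasDerivAt (Ici_mem_nhds hs)
    · exact h2.differentiableAt.differentiableWithinAt
    · rw [h2.deriv]
      exact mul_nonpos_of_nonneg_of_nonpos (Real.exp_pos _).le (by linarith [hle s (le_of_lt hs)])
  have := hanti (Set.mem_Ici.2 le_rfl) (Set.mem_Ici.2 ht) ht
  simp only [mul_zero, Real.exp_zero, one_mul] at this
  calc y t = Real.exp (-c * t) * y t * Real.exp (c * t) := by
        rw [mul_right_comm, ← Real.exp_add]; simp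
    _ ≤ y 0 * Real.exp (c * t) := mul_le_mul_of_nonneg_right this (Real.exp_pos _).le

lemma eq_exp_of_deriv_eq {y : ℝ → ℝ} {c : ℝ}
    (hd : ∀ t, 0 ≤ t → HasDerivWithinAt y (c * y t) (Set.Ici 0) t) {t : ℝ} (ht : 0 ≤ t) :
    y t = y 0 * Real.exp (c * t) := by
  refine le_antisymm (le_exp_of_deriv_le hd (fun _ _ => le_rfl) ht) ?_
  have := le_exp_of_deriv_le (y := fun t => - y t) (y' := fun t => -(c * y t)) (c := c)
    (fun t ht => (hd t ht).neg) (fun t _ => by linarith) ht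
  linarith

lemma HasGrowth.of_deriv {b C : ℝ} (hb : 0 ≤ b) {φ φ' : ℝ → ℝ} (hd : ∀ x, HasDerivAt φ (φ' x) x)
    (h : ∀ v, |φ' v| ≤ C * weight b v) : HasGrowth (1 + b) (|φ 0| + C) φ := by
  have hC : 0 ≤ C := nonneg_of_mul_nonneg_left ((abs_nonneg _).trans (h 0)) (weight_pos b 0)
  refine ⟨continuous_iff_continuousAt.2 fun x => (hd x).continuousAt, fun v => ?_⟩
  have hconv : Convex ℝ {x : ℝ | |x| ≤ |v|} := by
    have := convex_closedBall (0 : ℝ) |v|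
    simpa [Metric.closedBall, Real.dist_eq] using this
  have h1 := hconv.norm_image_sub_le_of_norm_hasDerivWithin_le (f := φ) (f' := φ')
    (C := C * weight b v) (fun y _ => (hd y).hasDerivWithinAt)
    (fun y hy => (h y).trans (mul_le_mul_of_nonneg_left (weight_mono_abs hb hy) hC))
    (show (0 : ℝ) ∈ {x : ℝ | |x| ≤ |v|} by simp) (show v ∈ {x : ℝ | |x| ≤ |v|} by simp)
  simp only [Real.norm_eq_abs, sub_zero] at h1
  have h2 : |φ v| ≤ |φ 0| + |φ v - φ 0| := by
    have := abs_add_le (φ 0) (φ v - φ 0)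
    simpa using this
  rw [weight_add_exp, weight_one]
  have h3 := one_le_weight hb v
  have h4 := abs_nonneg v
  have h5 := abs_nonneg (φ 0)
  have h6 : |φ 0| ≤ |φ 0| * ((1 + |v|) * weight b v) :=
    le_mul_of_one_le_right h5 (one_le_mul_of_one_le_of_one_le (by linarith) h3)
  have h7 : 0 ≤ C * weight b v := by positivity
  nlinarith

/-- `φ` is twice differentiable with derivatives `φ'`, `φ''`, and `φ''` is continuous of
growth `δ`. -/
structure IsC2 (δ C : ℝ) (φ φ' φ'' : ℝ → ℝ) : Prop where
  hasDerivAt : ∀ x, HasDerivAt φ (φ' x) x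
  hasDerivAt' : ∀ x, HasDerivAt φ' (φ'' x) x
  growth : HasGrowth δ C φ''

namespace IsC2

variable {δ C : ℝ} {φ φ' φ'' : ℝ → ℝ}

lemma growth_deriv (h : IsC2 δ C φ φ' φ'') (hδ : 0 ≤ δ) : HasGrowth (1 + δ) (|φ' 0| + C) φ' :=
  HasGrowth.of_deriv hδ h.hasDerivAt' h.growth.2

lemma growth_self (h : IsC2 δ C φ φ' φ'') (hδ : 0 ≤ δ) :
    HasGrowth (2 + δ) (|φ 0| + (|φ' 0| + C)) φ := by
  have := HasGrowth.of_deriv (by positivity) h.hasDerivAt (h.growth_deriv hδ).2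
  rwa [← add_assoc, one_add_one_eq_two] at this

lemma growth_id_mul (h : IsC2 δ C φ φ' φ'') (hδ : 0 ≤ δ) :
    HasGrowth (2 + δ) (|φ' 0| + C) (fun v => v * φ' v) := by
  have := hasGrowth_id.mul (h.growth_deriv hδ)
  rwa [← add_assoc, one_add_one_eq_two, one_mul] at this

lemma growth_sq_mul (h : IsC2 δ C φ φ' φ'') :
    HasGrowth (2 + δ) C (fun v => v ^ 2 * φ'' v) := by
  simpa using hasGrowth_sq.mul h.growth

end IsC2

section ProductIntegrals

variable {μ : Measure ℝ} [IsProbabilityMeasure μ]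

lemma gain_id (h1 : Integrable (fun v : ℝ => v) μ) (p q : ℝ) :
    gain p q (fun v => v) μ = (p + q) * ∫ v, v ∂μ := by
  unfold gain
  rw [integral_add ((h1.comp_fst μ).const_mul p) ((h1.comp_snd μ).const_mul q),
    integral_const_mul, integral_const_mul, integral_fun_fst (fun v : ℝ => v),
    integral_fun_snd (fun v : ℝ => v)]
  simp; ring

lemma gain_sq (h1 : Integrable (fun v : ℝ => v) μ) (h2 : Integrable (fun v : ℝ => v ^ 2) μ)
    (hm : ∫ v, v ∂μ = 0) (p q : ℝ) :
    gain p q (fun v => v ^ 2) μ = (p ^ 2 + q ^ 2) * ∫ v, v ^ 2 ∂μ := by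
  unfold gain
  have e : ∀ z : ℝ × ℝ, (p * z.1 + q * z.2) ^ 2 =
      p ^ 2 * z.1 ^ 2 + q ^ 2 * z.2 ^ 2 + 2 * p * q * (z.1 * z.2) := fun z => by ring
  simp only [e]
  have i1 : Integrable (fun z : ℝ × ℝ => p ^ 2 * z.1 ^ 2) (μ.prod μ) :=
    (h2.comp_fst μ).const_mul _
  have i2 : Integrable (fun z : ℝ × ℝ => q ^ 2 * z.2 ^ 2) (μ.prod μ) :=
    (h2.comp_snd μ).const_mul _
  have i3 : Integrable (fun z : ℝ × ℝ => 2 * p * q * (z.1 * z.2)) (μ.prod μ) :=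
    (h1.mul_prod h1).const_mul _
  have i12 : Integrable (fun z : ℝ × ℝ => p ^ 2 * z.1 ^ 2 + q ^ 2 * z.2 ^ 2) (μ.prod μ) :=
    i1.add i2
  rw [integral_add i12 i3, integral_add i1 i2, integral_const_mul, integral_const_mul,
    integral_const_mul, integral_fun_fst (fun v : ℝ => v ^ 2),
    integral_fun_snd (fun v : ℝ => v ^ 2), integral_prod_mul (fun v : ℝ => v) (fun v : ℝ => v), hm]
  simp; ring

end ProductIntegrals

namespace IsFlow

variable {p q a : ℝ} {μ : ℝ → Measure ℝ}

lemma mean_eq_zero (h : IsFlow p q a μ) (ha : 1 ≤ a) (h0 : ∫ v, v ∂μ 0 = 0) {t : ℝ} (ht : 0 ≤ t) :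
    ∫ v, v ∂μ t = 0 := by
  have hg := hasGrowth_id.mono ha le_rfl
  have := eq_exp_of_deriv_eq (y := fun t => ∫ v, v ∂μ t) (c := p + q - 1) (fun s hs => by
    have := h.prob s
    refine (h.hasDerivWithinAt_integral (by linarith) hg hs).congr_deriv ?_
    rw [gain_id (hg.integrable (h.moment s))]; ring) ht
  simpa [h0] using this

/-- The cross term `2pq vw` vanishes because the mean stays zero, so the energy solves a closed
linear equation. -/
lemma energy_eq_exp (h : IsFlow p q a μ) (ha : 2 ≤ a) (h0 : ∫ v, v ∂μ 0 = 0)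
    (h1 : ∫ v, v ^ 2 ∂μ 0 = 1) {t : ℝ} (ht : 0 ≤ t) :
    ∫ v, v ^ 2 ∂μ t = Real.exp ((p ^ 2 + q ^ 2 - 1) * t) := by
  have hg := hasGrowth_id.mono (show 1 ≤ a by linarith) le_rfl
  have hg2 := hasGrowth_sq.mono ha le_rfl
  have := eq_exp_of_deriv_eq (y := fun t => ∫ v, v ^ 2 ∂μ t) (c := p ^ 2 + q ^ 2 - 1)
    (fun s hs => by
      have := h.prob s
      refine (h.hasDerivWithinAt_integral (by linarith) hg2 hs).congr_deriv ?_
      rw [gain_sq (hg.integrable (h.moment s)) (hg2.integrable (h.moment s))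
        (h.mean_eq_zero (by linarith) h0 hs)]; ring) ht
  simpa [h1] using this

end IsFlow

/-! ### Scaling by the energy and passing to the slow time. -/

lemma gain_map_mul {μ : Measure ℝ} [SFinite μ] {φ : ℝ → ℝ} (hφ : Continuous φ) (p q c : ℝ) :
    gain p q φ (μ.map (fun v => c * v)) = gain p q (fun v => φ (c * v)) μ := by
  unfold gain
  have hm : Measurable fun v : ℝ => c * v := measurable_const_mul c
  rw [Measure.map_prod_map _ _ hm hm, integral_map (hm.prodMap hm).aemeasurable
    (Continuous.aestronglyMeasurable (by fun_prop))]
  refine integral_congr_ae (Eventually.of_forall fun z => ?_)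
  simp only [Prod.map]
  ring_nf

lemma integral_map_mul {μ : Measure ℝ} {φ : ℝ → ℝ} (hφ : Continuous φ) (c : ℝ) :
    ∫ v, φ v ∂(μ.map (fun v => c * v)) = ∫ v, φ (c * v) ∂μ :=
  integral_map (measurable_const_mul c).aemeasurable hφ.aestronglyMeasurable

lemma integrable_weight_map_mul {a : ℝ} (ha : 0 ≤ a) {μ : Measure ℝ}
    (hμ : Integrable (weight a) μ) (c : ℝ) :
    Integrable (weight a) (μ.map (fun v => c * v)) := by
  rw [integrable_map_measure (continuous_weight a).aestronglyMeasurable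
    (measurable_const_mul c).aemeasurable]
  exact ((hasGrowth_weight a).comp_mul ha c).integrable hμ

/-- If `m` is continuous at `t`, then `(s - t) m(s)` has derivative `m(t)` at `t`. -/
lemma hasDerivAt_sub_mul {m : ℝ → ℝ} {t : ℝ} (hm : ContinuousAt m t) :
    HasDerivAt (fun s => (s - t) * m s) (m t) t := by
  rw [hasDerivAt_iff_tendsto_slope]
  refine (hm.tendsto.mono_left nhdsWithin_le_nhds).congr' ?_
  filter_upwards [self_mem_nhdsWithin] with s hs
  have : s - t ≠ 0 := sub_ne_zero.2 hs
  simp only [slope, vsub_eq_sub, sub_self, zero_mul, sub_zero, smul_eq_mul]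
  field_simp

lemma hasDerivAt_zero_of_sq_bound {f : ℝ → ℝ} {t K : ℝ}
    (h : ∀ s, |s - t| ≤ 1 → |f s| ≤ K * (s - t) ^ 2) : HasDerivAt f 0 t := by
  have : f =O[𝓝 t] fun s => ‖s - t‖ ^ 2 := by
    refine Asymptotics.IsBigO.of_bound K ?_
    filter_upwards [Metric.closedBall_mem_nhds t one_pos] with s hs
    rw [Metric.mem_closedBall, Real.dist_eq] at hs
    simpa using h s hs
  exact (this.hasFDerivAt (by norm_num)).hasDerivAt

namespace IsFlow

variable {p q δ : ℝ} {μ : ℝ → Measure ℝ}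

/-- The weak form for the scaled solution: the test function moves with the exponential scaling. -/
lemma hasDerivWithinAt_scaled (h : IsFlow p q (2 + δ) μ) (hδ : 0 ≤ δ) {C : ℝ} {φ φ' φ'' : ℝ → ℝ}
    (hφ : IsC2 δ C φ φ' φ'') (α : ℝ) {t : ℝ} (ht : 0 ≤ t) :
    HasDerivWithinAt (fun s => ∫ v, φ (Real.exp (-α * s) * v) ∂μ s)
      (gain p q (fun v => φ (Real.exp (-α * t) * v)) (μ t) - ∫ v, φ (Real.exp (-α * t) * v) ∂μ t
        - α * ∫ v, (Real.exp (-α * t) * v) * φ' (Real.exp (-α * t) * v) ∂μ t) (Set.Ici 0) t := by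
  have ha : 0 ≤ 2 + δ := by linarith
  set T := |t| + 1
  have hT : 0 ≤ T := by positivity
  have hg := fun s => (hφ.growth_self hδ).comp_mul ha (Real.exp (-α * s))
  have hg1 := (hφ.growth_id_mul hδ).comp_mul ha (Real.exp (-α * t))
  set D : ℝ → ℝ := fun v => (Real.exp (-α * t) * v) * φ' (Real.exp (-α * t) * v)
  have hgG := (hφ.growth_sq_mul.add (hφ.growth_id_mul hδ)).const_mul (α ^ 2)
  set K := |α ^ 2| * (C + (|φ' 0| + C)) * weight (2 + δ) (Real.exp (|α| * T))
  -- Taylor expansion in time at fixed `v`: the second time derivative of `φ(e^{-αr} v)` involves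
  -- only `x² φ''(x)` and `x φ'(x)`, both of growth `2 + δ`.
  have pt : ∀ s, |s - t| ≤ 1 → ∀ v, |φ (Real.exp (-α * s) * v) - φ (Real.exp (-α * t) * v)
      - (s - t) * (-α * D v)| ≤ K * (s - t) ^ 2 * weight (2 + δ) v := by
    intro s hs v
    have e : ∀ r, HasDerivAt (fun r => Real.exp (-α * r) * v) (-α * (Real.exp (-α * r) * v)) r :=
      fun r => by
        have := (((hasDerivAt_id r).const_mul (-α)).exp).mul_const v
        simp only [id, mul_one] at this
        exact this.congr_deriv (by ring)
    have d1 : ∀ r, HasDerivAt (fun r => φ (Real.exp (-α * r) * v))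
        (φ' (Real.exp (-α * r) * v) * (-α * (Real.exp (-α * r) * v))) r := fun r =>
      (hφ.hasDerivAt _).comp r (e r)
    have d2 : ∀ r, HasDerivAt (fun r => φ' (Real.exp (-α * r) * v) * (-α * (Real.exp (-α * r) * v)))
        (α ^ 2 * ((Real.exp (-α * r) * v) ^ 2 * φ'' (Real.exp (-α * r) * v) +
          (Real.exp (-α * r) * v) * φ' (Real.exp (-α * r) * v))) r := fun r => by
      have := ((hφ.hasDerivAt' _).comp r (e r)).mul ((e r).const_mul (-α))
      refine this.congr_deriv ?_
      simp only [Function.comp]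
      ring
    have := abs_taylor_two_le d1 d2 (v := t) (u := s - t) (c := 0)
      (M := K * weight (2 + δ) v) (fun r hr => by
        rw [sub_zero]
        refine (hgG.2 (Real.exp (-α * r) * v)).trans ?_
        change _ ≤ |α ^ 2| * (C + (|φ' 0| + C)) * weight (2 + δ) (Real.exp (|α| * T)) * _
        rw [mul_assoc _ (weight (2 + δ) (Real.exp (|α| * T)))]
        refine mul_le_mul_of_nonneg_left ?_ hgG.nonneg
        refine (weight_mul_le ha _ _).trans
          (mul_le_mul_of_nonneg_right (weight_mono_abs ha ?_) (weight_pos _ _).le)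
        rw [Real.abs_exp, Real.abs_exp, Real.exp_le_exp]
        have h1 : |r| ≤ T := by
          have := abs_add_le t (r - t)
          rw [add_sub_cancel] at this
          exact this.trans (add_le_add le_rfl (hr.trans hs))
        calc -α * r ≤ |-α * r| := le_abs_self _
          _ = |α| * |r| := by rw [abs_mul, abs_neg]
          _ ≤ |α| * T := mul_le_mul_of_nonneg_left h1 (abs_nonneg _))
    rw [add_sub_cancel] at this
    calc _ = |φ (Real.exp (-α * s) * v) - φ (Real.exp (-α * t) * v) -
          φ' (Real.exp (-α * t) * v) * (-α * (Real.exp (-α * t) * v)) * (s - t) -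
          1 / 2 * 0 * (s - t) ^ 2| := by
            congr 1; simp only [D]; ring
      _ ≤ K * weight (2 + δ) v * (s - t) ^ 2 := this
      _ = _ := by ring
  -- Test function and measure both move. The remainder, integrated against `μ s`, is still
  -- quadratic in `s - t` since moments are locally bounded.
  have hR : HasDerivAt (fun s => ∫ v, (φ (Real.exp (-α * s) * v) - φ (Real.exp (-α * t) * v)
      - (s - t) * (-α * D v)) ∂μ s) 0 t := by
    refine hasDerivAt_zero_of_sq_bound (K := K * momentBound (2 + δ) μ T) fun s hs => ?_
    have hsT : s ≤ T := by
      have := (abs_le.1 hs).2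
      change s ≤ |t| + 1
      linarith [le_abs_self t]
    have : |∫ v, (φ (Real.exp (-α * s) * v) - φ (Real.exp (-α * t) * v)
        - (s - t) * (-α * D v)) ∂μ s| ≤ ∫ v, K * (s - t) ^ 2 * weight (2 + δ) v ∂μ s :=
      norm_integral_le_of_norm_le (f := fun v => φ (Real.exp (-α * s) * v)
        - φ (Real.exp (-α * t) * v) - (s - t) * (-α * D v)) ((h.moment s).const_mul _)
        (Eventually.of_forall (pt s hs))
    refine this.trans ?_
    rw [integral_const_mul]
    have hK : 0 ≤ K := mul_nonneg hgG.nonneg (weight_pos _ _).le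
    calc _ ≤ K * (s - t) ^ 2 * momentBound (2 + δ) μ T :=
          mul_le_mul_of_nonneg_left (h.moment_le ha hT hsT) (by positivity)
      _ = _ := by ring
  -- The linear term carries the factor `s - t`, so mere continuity of `s ↦ ∫ D dμ s` suffices.
  have hm := hasDerivAt_sub_mul (m := fun s => -α * ∫ v, D v ∂μ s) (t := t)
    ((continuous_const.mul (h.continuous_integral ha hg1)).continuousAt)
  have hA := h.hasDerivWithinAt_integral ha (hg t) ht
  refine ((hA.add hm.hasDerivWithinAt).add hR.hasDerivWithinAt).congr_of_eventuallyEq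
    ?_ ?_ |>.congr_deriv (by simp only [D]; ring)
  · refine Eventually.of_forall fun s => ?_
    have i1 := (hg s).integrable (h.moment s)
    have i2 := (hg t).integrable (h.moment s)
    have i3 : Integrable (fun v => (s - t) * (-α * D v)) (μ s) :=
      ((hg1.integrable (h.moment s)).const_mul _).const_mul _
    simp only [Pi.add_apply]
    have i12 : Integrable (fun v => φ (Real.exp (-α * s) * v) - φ (Real.exp (-α * t) * v)) (μ s) :=
      i1.sub i2
    rw [MeasureTheory.integral_sub i12 i3, MeasureTheory.integral_sub i1 i2, integral_const_mul,
      integral_const_mul]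
    ring
  · simp [D]

end IsFlow

/-- First order Taylor remainder of `φ` at a collision. -/
def rem (p q : ℝ) (φ φ' : ℝ → ℝ) (z : ℝ × ℝ) : ℝ :=
  φ (p * z.1 + q * z.2) - φ z.1 - φ' z.1 * ((p - 1) * z.1 + q * z.2)

/-- A solution of the Boltzmann equation scaled by its energy, in the slow time variable. -/
structure IsScaledFlow (p q lam δ : ℝ) (ρ : ℝ → Measure ℝ) : Prop where
  prob : ∀ τ, IsProbabilityMeasure (ρ τ)
  moment : ∀ τ, Integrable (weight (2 + δ)) (ρ τ)
  mean : ∀ τ, 0 ≤ τ → ∫ v, v ∂ρ τ = 0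
  energy : ∀ τ, 0 ≤ τ → ∫ v, v ^ 2 ∂ρ τ = 1
  deriv : ∀ (C : ℝ) (φ φ' φ'' : ℝ → ℝ), IsC2 δ C φ φ' φ'' → ∀ τ, 0 ≤ τ →
    HasDerivWithinAt (fun s => ∫ v, φ v ∂ρ s)
      ((q ^ 2)⁻¹ * (∫ z, rem p q φ φ' z ∂((ρ τ).prod (ρ τ)))
        - 1 / 2 * (lam ^ 2 + 1) * ∫ v, v * φ' v ∂ρ τ) (Set.Ici 0) τ

/-- The scaled family of measures. -/
noncomputable def scaledMeasure (p q : ℝ) (μ : ℝ → Measure ℝ) (τ : ℝ) : Measure ℝ :=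
  (μ (τ / q ^ 2)).map (fun v => Real.exp (-((p ^ 2 + q ^ 2 - 1) / 2) * (τ / q ^ 2)) * v)

/-- Mean zero removes the first order term `q φ'(v) w`. The surviving term `(p - 1) ∫ v φ'` is of
order `q`, too large after division by `q²`; it is the one that the energy scaling cancels. -/
lemma integrable_rem {p q δ C : ℝ} (hδ : 0 ≤ δ) {φ φ' φ'' : ℝ → ℝ} (hφ : IsC2 δ C φ φ' φ'')
    {ρ : Measure ℝ} [IsProbabilityMeasure ρ] (hρ : Integrable (weight (2 + δ)) ρ) :
    Integrable (rem p q φ φ') (ρ.prod ρ) ∧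
      ((∫ v, v ∂ρ = 0) → gain p q φ ρ - ∫ v, φ v ∂ρ =
        (∫ z, rem p q φ φ' z ∂(ρ.prod ρ)) + (p - 1) * ∫ v, v * φ' v ∂ρ) := by
  have ha : 0 ≤ 2 + δ := by linarith
  have i1 := (hφ.growth_self hδ).integrable_mix ha p q hρ hρ
  have i2 := ((hφ.growth_self hδ).integrable hρ).comp_fst ρ
  have j3 := (hφ.growth_id_mul hδ).integrable hρ
  have i3 : Integrable (fun z : ℝ × ℝ => (p - 1) * (z.1 * φ' z.1)) (ρ.prod ρ) :=
    (j3.comp_fst ρ).const_mul (p - 1)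
  have j4 := ((hφ.growth_deriv hδ).mono (show 1 + δ ≤ 2 + δ by linarith) le_rfl).integrable hρ
  have j5 := (hasGrowth_id.mono (show 1 ≤ 2 + δ by linarith) le_rfl).integrable hρ
  have i4 : Integrable (fun z : ℝ × ℝ => q * (φ' z.1 * z.2)) (ρ.prod ρ) :=
    (j4.mul_prod j5).const_mul q
  have e : rem p q φ φ' = fun z => φ (p * z.1 + q * z.2) - φ z.1
      - ((p - 1) * (z.1 * φ' z.1) + q * (φ' z.1 * z.2)) := by
    funext z; unfold rem; ring
  refine ⟨?_, fun hm => ?_⟩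
  · rw [e]
    exact (i1.sub i2).sub (i3.add i4)
  · have i12 : Integrable (fun z : ℝ × ℝ => φ (p * z.1 + q * z.2) - φ z.1) (ρ.prod ρ) := i1.sub i2
    have i34 : Integrable (fun z : ℝ × ℝ => (p - 1) * (z.1 * φ' z.1) + q * (φ' z.1 * z.2))
      (ρ.prod ρ) := i3.add i4
    rw [e, integral_sub i12 i34, integral_sub i1 i2, integral_add i3 i4,
      integral_const_mul, integral_const_mul, integral_fun_fst φ,
      integral_fun_fst (fun v => v * φ' v), integral_prod_mul φ' (fun v => v), hm]
    simp [gain]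

lemma IsFlow.isScaledFlow {p q lam δ : ℝ} {μ : ℝ → Measure ℝ} (h : IsFlow p q (2 + δ) μ)
    (hδ : 0 ≤ δ) (hq : 0 < q) (hp : (p - 1) ^ 2 = lam ^ 2 * q ^ 2) (h0 : ∫ v, v ∂μ 0 = 0)
    (h1 : ∫ v, v ^ 2 ∂μ 0 = 1) : IsScaledFlow p q lam δ (scaledMeasure p q μ) := by
  have ha : 0 ≤ 2 + δ := by linarith
  have hprob : ∀ τ, IsProbabilityMeasure (scaledMeasure p q μ τ) := fun τ => by
    have := h.prob (τ / q ^ 2)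
    exact Measure.isProbabilityMeasure_map (measurable_const_mul _).aemeasurable
  have hmom : ∀ τ, Integrable (weight (2 + δ)) (scaledMeasure p q μ τ) := fun τ =>
    integrable_weight_map_mul ha (h.moment _) _
  have hmean : ∀ τ, 0 ≤ τ → ∫ v, v ∂scaledMeasure p q μ τ = 0 := fun τ hτ => by
    unfold scaledMeasure
    rw [integral_map_mul continuous_id', integral_const_mul,
      h.mean_eq_zero (by linarith) h0 (by positivity), mul_zero]
  refine ⟨hprob, hmom, hmean, fun τ hτ => ?_, fun C φ φ' φ'' hφ τ hτ => ?_⟩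
  · unfold scaledMeasure
    rw [integral_map_mul (continuous_pow 2)]
    simp only [mul_pow]
    rw [integral_const_mul, h.energy_eq_exp (by linarith) h0 h1 (by positivity), ← Real.exp_nat_mul,
      ← Real.exp_add, Real.exp_eq_one_iff]
    push_cast
    ring
  · have hτ' : 0 ≤ τ / q ^ 2 := by positivity
    have hφc := (hφ.growth_self hδ).1
    have hφc' := (hφ.growth_id_mul hδ).1
    have hd := h.hasDerivWithinAt_scaled hδ hφ ((p ^ 2 + q ^ 2 - 1) / 2) hτ'
    have hl : HasDerivWithinAt (fun s : ℝ => s / q ^ 2) ((q ^ 2)⁻¹) (Set.Ici 0) τ := by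
      simpa using ((hasDerivAt_id τ).div_const (q ^ 2)).hasDerivWithinAt (s := Set.Ici 0)
    have hcomp := HasDerivWithinAt.scomp τ hd hl
      (fun s hs => div_nonneg hs (by positivity))
    have hτp := hprob τ
    have hμp := h.prob (τ / q ^ 2)
    have e1 : (fun s => ∫ v, φ v ∂scaledMeasure p q μ s) =
        (fun s => ∫ v, φ (Real.exp (-((p ^ 2 + q ^ 2 - 1) / 2) * s) * v) ∂μ s) ∘
          (fun s => s / q ^ 2) := by
      funext s
      exact integral_map_mul hφc _
    rw [e1]
    refine hcomp.congr_deriv ?_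
    rw [← gain_map_mul hφc, ← integral_map_mul hφc, ← integral_map_mul hφc']
    change (q ^ 2)⁻¹ • (gain p q φ (scaledMeasure p q μ τ) - ∫ v, φ v ∂scaledMeasure p q μ τ
      - (p ^ 2 + q ^ 2 - 1) / 2 * ∫ v, v * φ' v ∂scaledMeasure p q μ τ) = _
    rw [(integrable_rem hδ hφ (hmom τ)).2 (hmean τ hτ), smul_eq_mul]
    -- The part `p - 1` cancels the first order drift; the rest, divided by `q²`, is the
    -- Fokker–Planck drift.
    have : (p ^ 2 + q ^ 2 - 1) / 2 = (p - 1) + 1 / 2 * (lam ^ 2 + 1) * q ^ 2 := by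
      linarith
    rw [this]
    field_simp
    ring

/-! ### Tail functions and uniform propagation of tails. -/

/-- The function `|x|^δ min(1, |x|/R)`. -/
noncomputable def kern (δ R x : ℝ) : ℝ := |x| ^ δ * min 1 (|x| / R)

section Kern

variable {δ R : ℝ}

lemma continuous_kern (hδ : 0 ≤ δ) : Continuous (kern δ R) :=
  (continuous_abs.rpow_const fun _ => Or.inr hδ).mul
    (continuous_const.min (continuous_abs.div_const R))

lemma kern_nonneg (hR : 0 < R) (x : ℝ) : 0 ≤ kern δ R x := by
  unfold kern; positivity

lemma kern_abs (x : ℝ) : kern δ R |x| = kern δ R x := by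
  unfold kern; rw [abs_abs]

lemma kern_neg (x : ℝ) : kern δ R (-x) = kern δ R x := by
  unfold kern; rw [abs_neg]

lemma kern_mono (hδ : 0 ≤ δ) (hR : 0 < R) {x y : ℝ} (h : |x| ≤ |y|) : kern δ R x ≤ kern δ R y := by
  unfold kern
  have : |x| / R ≤ |y| / R := by gcongr
  gcongr

/-- A doubling property uniform in `R`, which is why the cutoff is the ramp `min(1, |x|/R)` and not
a sharp one. -/
lemma kern_mul_le {c : ℝ} (hc : 1 ≤ c) (x : ℝ) :
    kern δ R (c * x) ≤ c ^ (δ + 1) * kern δ R x := by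
  have hc0 : 0 < c := by linarith
  unfold kern
  rw [abs_mul, abs_of_pos hc0, Real.mul_rpow hc0.le (abs_nonneg x), Real.rpow_add hc0, Real.rpow_one]
  have h1 : min 1 (c * |x| / R) ≤ c * min 1 (|x| / R) := by
    rcases le_total 1 (|x| / R) with h | h
    · rw [min_eq_left h, mul_one]
      exact (min_le_left _ _).trans hc
    · rw [min_eq_right h, mul_div_assoc]
      exact min_le_right _ _
  calc c ^ δ * |x| ^ δ * min 1 (c * |x| / R) ≤ c ^ δ * |x| ^ δ * (c * min 1 (|x| / R)) := by gcongr
    _ = _ := by ring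

lemma kern_le (x : ℝ) : kern δ R x ≤ |x| ^ δ :=
  mul_le_of_le_one_right (Real.rpow_nonneg (abs_nonneg x) δ) (min_le_left _ _)

lemma kern_eq (hR : 0 < R) {x : ℝ} (hx : R ≤ |x|) : kern δ R x = |x| ^ δ := by
  unfold kern
  rw [min_eq_left, mul_one]
  rwa [one_le_div hR]

lemma hasGrowth_kern (hδ : 0 ≤ δ) (hR : 0 < R) : HasGrowth δ 1 (kern δ R) :=
  ⟨continuous_kern hδ, fun x => by
    rw [abs_of_nonneg (kern_nonneg hR x), one_mul]
    exact (kern_le x).trans (Real.rpow_le_rpow (abs_nonneg x) (by linarith) hδ)⟩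

lemma tendsto_kern (x : ℝ) : Tendsto (fun R => kern δ R x) atTop (𝓝 0) := by
  have h1 : Tendsto (fun R : ℝ => |x| / R) atTop (𝓝 0) := tendsto_const_nhds.div_atTop tendsto_id
  have h2 : Tendsto (fun R : ℝ => min 1 (|x| / R)) atTop (𝓝 (min 1 0)) :=
    tendsto_const_nhds.min h1
  simpa [kern] using h2.const_mul (|x| ^ δ)

/-- The first primitive of `kern`. -/
noncomputable def kernPrim (δ R x : ℝ) : ℝ := ∫ y in (0 : ℝ)..x, kern δ R y

/-- The second primitive of `kern`. -/
noncomputable def kernPrim₂ (δ R x : ℝ) : ℝ := ∫ y in (0 : ℝ)..x, kernPrim δ R y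

lemma isC2_kernPrim₂ (hδ : 0 ≤ δ) (hR : 0 < R) :
    IsC2 δ 1 (kernPrim₂ δ R) (kernPrim δ R) (kern δ R) := by
  have h1 : ∀ x, HasDerivAt (kernPrim δ R) (kern δ R x) x := fun x =>
    ((continuous_kern hδ).integral_hasStrictDerivAt 0 x).hasDerivAt
  have h2 : Continuous (kernPrim δ R) := continuous_iff_continuousAt.2 fun x => (h1 x).continuousAt
  exact ⟨fun x => (h2.integral_hasStrictDerivAt 0 x).hasDerivAt, h1, hasGrowth_kern hδ hR⟩

/-- Discard the first half of the interval and use monotonicity on the second. -/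
lemma half_mul_le_integral {g : ℝ → ℝ} (hg : Continuous g) (h0 : ∀ x, 0 ≤ x → 0 ≤ g x)
    (hm : MonotoneOn g (Set.Ici 0)) {x : ℝ} (hx : 0 ≤ x) :
    x / 2 * g (x / 2) ≤ ∫ y in (0 : ℝ)..x, g y := by
  have hi := fun a b => hg.intervalIntegrable (μ := volume) a b
  rw [← intervalIntegral.integral_add_adjacent_intervals (hi 0 (x / 2)) (hi (x / 2) x)]
  have h1 : 0 ≤ ∫ y in (0 : ℝ)..(x / 2), g y :=
    intervalIntegral.integral_nonneg (by linarith) fun y hy => h0 y hy.1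
  have h2 : ∫ y in (x / 2)..x, g (x / 2) ≤ ∫ y in (x / 2)..x, g y :=
    intervalIntegral.integral_mono_on (by linarith) intervalIntegrable_const (hi _ _) fun y hy =>
      hm (Set.mem_Ici.2 (by linarith)) (Set.mem_Ici.2 (by linarith [hy.1])) hy.1
  rw [intervalIntegral.integral_const, smul_eq_mul] at h2
  linarith

lemma kernPrim_nonneg (hR : 0 < R) {x : ℝ} (hx : 0 ≤ x) : 0 ≤ kernPrim δ R x :=
  intervalIntegral.integral_nonneg hx fun _ _ => kern_nonneg hR _

lemma kernPrim_neg (x : ℝ) : kernPrim δ R (-x) = -kernPrim δ R x := by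
  unfold kernPrim
  have := intervalIntegral.integral_comp_neg (a := 0) (b := x) (kern δ R)
  simp only [kern_neg, neg_zero] at this
  rw [this, intervalIntegral.integral_symm]

lemma kernPrim₂_neg (x : ℝ) : kernPrim₂ δ R (-x) = kernPrim₂ δ R x := by
  unfold kernPrim₂
  have := intervalIntegral.integral_comp_neg (a := 0) (b := x) (kernPrim δ R)
  simp only [kernPrim_neg, neg_zero, intervalIntegral.integral_neg] at this
  rw [intervalIntegral.integral_symm, ← this, neg_neg]

lemma mul_kernPrim_nonneg (hR : 0 < R) (x : ℝ) : 0 ≤ x * kernPrim δ R x := by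
  rcases le_total 0 x with hx | hx
  · exact mul_nonneg hx (kernPrim_nonneg hR hx)
  · have := kernPrim_nonneg (δ := δ) hR (neg_nonneg.2 hx)
    rw [kernPrim_neg] at this
    nlinarith

lemma kernPrim₂_le (hδ : 0 ≤ δ) (hR : 0 < R) (x : ℝ) :
    |kernPrim₂ δ R x| ≤ x ^ 2 * kern δ R x := by
  have h := isC2_kernPrim₂ hδ hR
  have := abs_taylor_two_le h.hasDerivAt h.hasDerivAt' (v := 0) (u := x) (c := 0)
    (M := kern δ R x) (fun y hy => by
      rw [sub_zero] at hy ⊢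
      rw [abs_of_nonneg (kern_nonneg hR y)]
      exact kern_mono hδ hR hy)
  simpa [kernPrim₂, kernPrim, mul_comm] using this

/-- Halving the interval for each of the two primitives gives `x/2 · x/4 · kern(x/4)`, whence the
`8`; doubling from `x/4` to `x` costs `4^(δ+1)`. Together with `kernPrim₂_le`, this makes
`kernPrim₂` comparable to `x² kern` independently of `R`. -/
lemma sq_mul_kern_le (hδ : 0 ≤ δ) (hR : 0 < R) (x : ℝ) :
    x ^ 2 * kern δ R x ≤ 8 * 4 ^ (δ + 1) * kernPrim₂ δ R x := by
  have h := isC2_kernPrim₂ hδ hR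
  have hc' : Continuous (kernPrim δ R) :=
    continuous_iff_continuousAt.2 fun x => (h.hasDerivAt' x).continuousAt
  have hmono : Monotone (kernPrim δ R) :=
    monotone_of_hasDerivAt_nonneg h.hasDerivAt' fun x => kern_nonneg hR x
  have key : ∀ x, 0 ≤ x → x ^ 2 * kern δ R x ≤ 8 * 4 ^ (δ + 1) * kernPrim₂ δ R x := by
    intro x hx
    have h1 : x / 2 * kernPrim δ R (x / 2) ≤ kernPrim₂ δ R x :=
      half_mul_le_integral hc' (fun y hy => kernPrim_nonneg hR hy) (hmono.monotoneOn _) hx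
    have h2 : x / 2 / 2 * kern δ R (x / 2 / 2) ≤ kernPrim δ R (x / 2) :=
      half_mul_le_integral (continuous_kern hδ) (fun y _ => kern_nonneg hR y)
        (fun a ha b hb hab => kern_mono hδ hR (by
          rwa [abs_of_nonneg ha, abs_of_nonneg hb])) (by linarith)
    have h3 : kern δ R x ≤ 4 ^ (δ + 1) * kern δ R (x / 2 / 2) := by
      have := kern_mul_le (δ := δ) (R := R) (show (1 : ℝ) ≤ 4 by norm_num) (x / 2 / 2)
      rwa [show 4 * (x / 2 / 2) = x by ring] at this
    have h4 : x / 2 * (x / 2 / 2 * kern δ R (x / 2 / 2)) ≤ kernPrim₂ δ R x :=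
      (mul_le_mul_of_nonneg_left h2 (by linarith)).trans h1
    have h5 : (0 : ℝ) < 4 ^ (δ + 1) := Real.rpow_pos_of_pos (by norm_num) _
    calc x ^ 2 * kern δ R x ≤ x ^ 2 * (4 ^ (δ + 1) * kern δ R (x / 2 / 2)) := by gcongr
      _ = 8 * 4 ^ (δ + 1) * (x / 2 * (x / 2 / 2 * kern δ R (x / 2 / 2))) := by ring
      _ ≤ _ := by gcongr
  rcases le_total 0 x with hx | hx
  · exact key x hx
  · have := key (-x) (neg_nonneg.2 hx)
    rwa [kern_neg, kernPrim₂_neg, neg_sq] at this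

end Kern

/-- A bound for the displacement of a velocity in a collision. -/
lemma abs_displacement_le {p q lam : ℝ} (hq : 0 < q) (hp : (p - 1) ^ 2 = lam ^ 2 * q ^ 2)
    (v w : ℝ) : |(p - 1) * v + q * w| ≤ q * ((1 + |lam|) * (|v| + |w|)) := by
  have h1 : |p - 1| = |lam| * q := by
    rw [← abs_of_pos hq, ← abs_mul, ← sq_eq_sq_iff_abs_eq_abs, hp]; ring
  refine (abs_add_le _ _).trans ?_
  rw [abs_mul, abs_mul, h1, abs_of_pos hq]
  nlinarith [mul_nonneg hq.le (abs_nonneg v), mul_nonneg hq.le (abs_nonneg w),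
    mul_nonneg (mul_nonneg hq.le (abs_nonneg w)) (abs_nonneg lam)]

/-- All velocities between `v` and `v + u` are at most a multiple of `max |v| |w|`. Monotonicity and
doubling of `kern` then bound the remainder by `kernPrim₂` itself, which closes the Grönwall
estimate uniformly in `R`. -/
lemma abs_rem_kernPrim₂_le {p q lam δ R : ℝ} (hδ : 0 ≤ δ) (hR : 0 < R) (hq : 0 < q) (hq1 : q ≤ 1)
    (hp : (p - 1) ^ 2 = lam ^ 2 * q ^ 2) (z : ℝ × ℝ) :
    |rem p q (kernPrim₂ δ R) (kernPrim δ R) z| ≤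
      q ^ 2 * ((2 * (2 + |lam|)) ^ (δ + 3) * (8 * 4 ^ (δ + 1)) *
        (kernPrim₂ δ R z.1 + kernPrim₂ δ R z.2)) := by
  obtain ⟨v, w⟩ := z
  have h := isC2_kernPrim₂ hδ hR
  -- Here `u` is the displacement and `c` is chosen so that `|v| + |u| ≤ (3 + 2|λ|) m ≤ c m`.
  set u := (p - 1) * v + q * w with hu
  set m := max |v| |w| with hm
  set c := 2 * (2 + |lam|) with hc
  have hl := abs_nonneg lam
  have hv := abs_nonneg v
  have hw := abs_nonneg w
  have hm0 : 0 ≤ m := le_max_of_le_left hv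
  have hvm : |v| ≤ m := le_max_left _ _
  have hwm : |w| ≤ m := le_max_right _ _
  have hc1 : 1 ≤ c := by linarith
  have hcm : 0 ≤ c * m := by positivity
  have hu1 : |u| ≤ q * ((1 + |lam|) * (|v| + |w|)) := abs_displacement_le hq hp v w
  have hs : (1 + |lam|) * (|v| + |w|) ≤ (1 + |lam|) * (2 * m) := by gcongr; linarith
  have hu2 : |u| ≤ (1 + |lam|) * (2 * m) :=
    hu1.trans ((mul_le_of_le_one_left (by positivity) hq1).trans hs)
  have hu3 : |u| ≤ q * (c * m) := hu1.trans
    (mul_le_mul_of_nonneg_left (hs.trans (by rw [hc]; nlinarith)) hq.le)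
  have htay := abs_taylor_two_le h.hasDerivAt h.hasDerivAt' (v := v) (u := u) (c := 0)
    (M := kern δ R (c * m)) (fun x hx => by
      rw [sub_zero, abs_of_nonneg (kern_nonneg hR x)]
      refine kern_mono hδ hR ?_
      rw [abs_of_nonneg hcm]
      have := abs_add_le v (x - v)
      rw [add_sub_cancel] at this
      calc |x| ≤ m + (1 + |lam|) * (2 * m) := by linarith
        _ ≤ c * m := by rw [hc]; nlinarith)
  have e : rem p q (kernPrim₂ δ R) (kernPrim δ R) (v, w) =
      kernPrim₂ δ R (v + u) - kernPrim₂ δ R v - kernPrim δ R v * u - 1 / 2 * 0 * u ^ 2 := by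
    simp only [rem]
    rw [show p * v + q * w = v + u by rw [hu]; ring]
    ring
  rw [e]
  refine htay.trans ?_
  have hu4 : u ^ 2 ≤ (q * (c * m)) ^ 2 := by
    rw [← sq_abs u]; exact pow_le_pow_left₀ (abs_nonneg u) hu3 2
  have hk : kern δ R m * m ^ 2 ≤ 8 * 4 ^ (δ + 1) * (kernPrim₂ δ R v + kernPrim₂ δ R w) := by
    have h1 := sq_mul_kern_le hδ hR v
    have h2 := sq_mul_kern_le hδ hR w
    have h3 : 0 ≤ v ^ 2 * kern δ R v := mul_nonneg (sq_nonneg v) (kern_nonneg hR v)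
    have h4 : 0 ≤ w ^ 2 * kern δ R w := mul_nonneg (sq_nonneg w) (kern_nonneg hR w)
    rw [mul_add]
    rcases max_choice |v| |w| with hh | hh <;> rw [← hm] at hh <;> rw [hh, kern_abs, sq_abs] <;>
      linarith
  have hcp : c ^ (δ + 3) = c ^ (δ + 1) * c ^ 2 := by
    rw [show δ + 3 = δ + 1 + (2 : ℕ) by push_cast; ring, Real.rpow_add (by linarith),
      Real.rpow_natCast]
  calc kern δ R (c * m) * u ^ 2 ≤ (c ^ (δ + 1) * kern δ R m) * (q * (c * m)) ^ 2 :=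
        mul_le_mul (kern_mul_le hc1 m) hu4 (sq_nonneg u)
          (mul_nonneg (by positivity) (kern_nonneg hR m))
    _ = q ^ 2 * (c ^ (δ + 3) * (kern δ R m * m ^ 2)) := by rw [hcp]; ring
    _ ≤ q ^ 2 * (c ^ (δ + 3) * (8 * 4 ^ (δ + 1) * (kernPrim₂ δ R v + kernPrim₂ δ R w))) := by
        gcongr
    _ = _ := by ring

/-- Growth constant for the tails of the scaled solutions. -/
noncomputable def tailConst (lam δ : ℝ) : ℝ :=
  2 * ((2 * (2 + |lam|)) ^ (δ + 3) * (8 * 4 ^ (δ + 1)))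

lemma tailConst_nonneg (lam δ : ℝ) : 0 ≤ tailConst lam δ := by
  unfold tailConst
  have := abs_nonneg lam
  positivity

namespace IsScaledFlow

variable {p q lam δ : ℝ} {ρ : ℝ → Measure ℝ}

/-- The drift has a favourable sign, as `v kernPrim(v) ≥ 0`, and is dropped. The collision bound is
symmetric in `v` and `w`, whence the factor `2` in `tailConst`. -/
lemma integral_kernPrim₂_le (h : IsScaledFlow p q lam δ ρ) (hδ : 0 ≤ δ) (hq : 0 < q) (hq1 : q ≤ 1)
    (hp : (p - 1) ^ 2 = lam ^ 2 * q ^ 2) {R : ℝ} (hR : 0 < R) {τ : ℝ} (hτ : 0 ≤ τ) :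
    ∫ v, kernPrim₂ δ R v ∂ρ τ ≤ (∫ v, kernPrim₂ δ R v ∂ρ 0) * Real.exp (tailConst lam δ * τ) := by
  have hC := isC2_kernPrim₂ hδ hR
  refine le_exp_of_deriv_le (fun s hs => h.deriv _ _ _ _ hC s hs) (fun s hs => ?_) hτ
  have := h.prob s
  have i1 := (hC.growth_self hδ).integrable (h.moment s)
  have hrem := (integrable_rem (p := p) (q := q) hδ hC (h.moment s)).1
  set A := (2 * (2 + |lam|)) ^ (δ + 3) * (8 * (4 : ℝ) ^ (δ + 1)) with hA
  have h1 : ∫ z, rem p q (kernPrim₂ δ R) (kernPrim δ R) z ∂((ρ s).prod (ρ s)) ≤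
      ∫ z : ℝ × ℝ, q ^ 2 * (A * (kernPrim₂ δ R z.1 + kernPrim₂ δ R z.2)) ∂((ρ s).prod (ρ s)) :=
    integral_mono hrem ((((i1.comp_fst _).add (i1.comp_snd _)).const_mul _).const_mul _)
      fun z => (le_abs_self _).trans (abs_rem_kernPrim₂_le hδ hR hq hq1 hp z)
  rw [integral_const_mul, integral_const_mul, integral_add (i1.comp_fst _) (i1.comp_snd _),
    integral_fun_fst (kernPrim₂ δ R), integral_fun_snd (kernPrim₂ δ R)] at h1
  simp only [probReal_univ, one_smul] at h1
  have h2 : 0 ≤ ∫ v, v * kernPrim δ R v ∂ρ s := integral_nonneg fun v => mul_kernPrim_nonneg hR v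
  have h3 : (q ^ 2)⁻¹ * ∫ z, rem p q (kernPrim₂ δ R) (kernPrim δ R) z ∂((ρ s).prod (ρ s)) ≤
      (q ^ 2)⁻¹ * (q ^ 2 * (A * ((∫ v, kernPrim₂ δ R v ∂ρ s) + ∫ v, kernPrim₂ δ R v ∂ρ s))) := by
    gcongr
  rw [inv_mul_cancel_left₀ (by positivity)] at h3
  have h4 : 0 ≤ 1 / 2 * (lam ^ 2 + 1) * ∫ v, v * kernPrim δ R v ∂ρ s := by positivity
  have h5 : tailConst lam δ = 2 * A := rfl
  rw [h5]
  linarith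

/-- Propagation of the tails of the scaled solutions, uniformly in the mixing parameters. -/
lemma integral_tail_le (h : IsScaledFlow p q lam δ ρ) (hδ : 0 ≤ δ) (hq : 0 < q) (hq1 : q ≤ 1)
    (hp : (p - 1) ^ 2 = lam ^ 2 * q ^ 2) {R : ℝ} (hR : 0 < R) {τ : ℝ} (hτ : 0 ≤ τ) :
    ∫ v, v ^ 2 * kern δ R v ∂ρ τ ≤ 8 * 4 ^ (δ + 1) * Real.exp (tailConst lam δ * τ) *
      ∫ v, v ^ 2 * kern δ R v ∂ρ 0 := by
  have hC := isC2_kernPrim₂ hδ hR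
  have i1 := fun s => (hC.growth_self hδ).integrable (h.moment s)
  have i2 := fun s => hC.growth_sq_mul.integrable (h.moment s)
  have h1 : ∫ v, v ^ 2 * kern δ R v ∂ρ τ ≤ ∫ v, 8 * 4 ^ (δ + 1) * kernPrim₂ δ R v ∂ρ τ :=
    integral_mono (i2 τ) ((i1 τ).const_mul _) fun v => sq_mul_kern_le hδ hR v
  rw [integral_const_mul] at h1
  have h2 : ∫ v, kernPrim₂ δ R v ∂ρ 0 ≤ ∫ v, v ^ 2 * kern δ R v ∂ρ 0 :=
    integral_mono (i1 0) (i2 0) fun v => (le_abs_self _).trans (kernPrim₂_le hδ hR v)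
  refine h1.trans ?_
  rw [mul_assoc (8 * 4 ^ (δ + 1))]
  refine mul_le_mul_of_nonneg_left ((h.integral_kernPrim₂_le hδ hq hq1 hp hR hτ).trans ?_)
    (by positivity)
  rw [mul_comm]
  gcongr

end IsScaledFlow

/-- The tails of a measure with finite moment vanish. -/
lemma tendsto_integral_tail {δ : ℝ} (hδ : 0 ≤ δ) {ρ : Measure ℝ}
    (hρ : Integrable (weight (2 + δ)) ρ) :
    Tendsto (fun R => ∫ v, v ^ 2 * kern δ R v ∂ρ) atTop (𝓝 0) := by
  have : Tendsto (fun R => ∫ v, v ^ 2 * kern δ R v ∂ρ) atTop (𝓝 (∫ _, (0 : ℝ) ∂ρ)) := by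
    refine tendsto_integral_filter_of_dominated_convergence (weight (2 + δ)) ?_ ?_ hρ ?_
    · exact Eventually.of_forall fun R =>
        ((continuous_pow 2).mul (continuous_kern hδ)).aestronglyMeasurable
    · filter_upwards [eventually_gt_atTop 0] with R hR
      refine Eventually.of_forall fun v => ?_
      have := (isC2_kernPrim₂ hδ hR).growth_sq_mul.2 v
      rwa [one_mul] at this
    · refine Eventually.of_forall fun v => ?_
      simpa using (tendsto_kern (δ := δ) v).const_mul (v ^ 2)
  simpa using this

/-! ### Hölder classes, the generator and consistency of the scaled collision operator. -/

lemma hasDerivAt_iteratedDeriv {φ : ℝ → ℝ} {m j : ℕ} (h : ContDiff ℝ m φ) (hj : j < m) (x : ℝ) :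
    HasDerivAt (iteratedDeriv j φ) (iteratedDeriv (j + 1) φ x) x := by
  rw [iteratedDeriv_succ]
  exact (h.differentiable_iteratedDeriv j (by exact_mod_cast hj) x).hasDerivAt

lemma growth_iteratedDeriv {φ : ℝ → ℝ} {m : ℕ} {β C : ℝ} (hβ : 0 ≤ β) (h : ContDiff ℝ m φ)
    (hC : ∀ v w, |iteratedDeriv m φ v - iteratedDeriv m φ w| ≤ C * |v - w| ^ β) (k : ℕ)
    (hk : k ≤ m) : ∃ D, HasGrowth (β + k) D (iteratedDeriv (m - k) φ) := by
  induction k with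
  | zero =>
    have hC0 : 0 ≤ C := by simpa using (abs_nonneg _).trans (hC 1 0)
    refine ⟨|iteratedDeriv m φ 0| + C, h.continuous_iteratedDeriv m le_rfl, fun v => ?_⟩
    simp only [Nat.sub_zero, Nat.cast_zero, add_zero]
    have h1 := hC v 0
    rw [sub_zero] at h1
    have h2 : |v| ^ β ≤ weight β v := Real.rpow_le_rpow (abs_nonneg v) (by linarith) hβ
    have h3 := abs_add_le (iteratedDeriv m φ 0) (iteratedDeriv m φ v - iteratedDeriv m φ 0)
    rw [add_sub_cancel] at h3
    have h4 := le_mul_of_one_le_right (abs_nonneg (iteratedDeriv m φ 0)) (one_le_weight hβ v)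
    have h5 := mul_le_mul_of_nonneg_left h2 hC0
    rw [add_mul]
    linarith
  | succ k ih =>
    obtain ⟨D, hD⟩ := ih (by omega)
    refine ⟨_, (HasGrowth.of_deriv (b := β + k) (by positivity)
      (hasDerivAt_iteratedDeriv (j := m - (k + 1)) h (by omega)) (C := D) ?_).mono
        (by push_cast; linarith) le_rfl⟩
    rw [show m - (k + 1) + 1 = m - k by omega]
    exact hD.2

/-- A modulus of continuity of the second derivative, Hölder continuous with polynomial weight. -/
def HolderMod (δ κ C : ℝ) (φ'' : ℝ → ℝ) : Prop :=
  ∀ x y, |φ'' (x + y) - φ'' x| ≤ C * |y| ^ κ * weight (δ - κ) (|x| + |y|)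

/-- If `m = 2` the modulus is the Hölder condition itself, with `κ = δ`. If `m ≥ 3` the mean value
inequality applies to the third derivative, of growth `δ - 1`, with `κ = 1`. -/
lemma exists_isC2_of_mem_holderClass {δ : ℝ} (hδ : 0 < δ) {φ : ℝ → ℝ}
    (hφ : φ ∈ HolderClass (2 + δ)) :
    ∃ C κ, 0 < κ ∧ κ ≤ δ ∧ IsC2 δ C φ (deriv φ) (iteratedDeriv 2 φ) ∧
      HolderMod δ κ C (iteratedDeriv 2 φ) := by
  obtain ⟨m, β, hβ, hβ1, hs, hd, C, hC⟩ := hφ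
  -- Since `β ≤ 1`, the order satisfies `m = 2 + δ - β ≥ 1 + δ > 1`.
  have hm : 2 ≤ m := by
    have : (1 : ℝ) < m := by linarith
    exact_mod_cast this
  have hC0 : 0 ≤ C := by simpa using (abs_nonneg _).trans (hC 1 0)
  obtain ⟨D, hD⟩ := growth_iteratedDeriv hβ.le hd hC (m - 2) (by omega)
  rw [show m - (m - 2) = 2 by omega, Nat.cast_sub hm,
    show β + ((m : ℝ) - (2 : ℕ)) = δ by push_cast; linarith] at hD
  have h1 : ∀ x, HasDerivAt φ (deriv φ x) x := fun x => by
    have := hasDerivAt_iteratedDeriv (j := 0) hd (by omega) x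
    simpa [iteratedDeriv_one] using this
  have h2 : ∀ x, HasDerivAt (deriv φ) (iteratedDeriv 2 φ x) x := fun x => by
    have := hasDerivAt_iteratedDeriv (j := 1) hd (by omega) x
    rwa [iteratedDeriv_one] at this
  have h3 : ∀ E, D ≤ E → IsC2 δ E φ (deriv φ) (iteratedDeriv 2 φ) := fun E hE =>
    ⟨h1, h2, hD.mono le_rfl hE⟩
  rcases hm.eq_or_lt with rfl | hm3
  · have hβδ : β = δ := by push_cast at hs; linarith
    refine ⟨max D C, δ, hδ, le_rfl, h3 _ (le_max_left _ _), fun x y => ?_⟩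
    have := hC (x + y) x
    rw [add_sub_cancel_left, hβδ] at this
    simp only [sub_self, weight, Real.rpow_zero, mul_one]
    exact this.trans (mul_le_mul_of_nonneg_right (le_max_right _ _) (by positivity))
  · obtain ⟨F, hF⟩ := growth_iteratedDeriv hβ.le hd hC (m - 3) (by omega)
    have hm3' : (3 : ℝ) ≤ m := by exact_mod_cast hm3
    rw [show m - (m - 3) = 3 by omega, Nat.cast_sub hm3,
      show β + ((m : ℝ) - (3 : ℕ)) = δ - 1 by push_cast; linarith] at hF
    refine ⟨max D F, 1, one_pos, by linarith, h3 _ (le_max_left _ _), fun x y => ?_⟩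
    have hconv : Convex ℝ {z : ℝ | |z - x| ≤ |y|} := by
      have := convex_closedBall x |y|
      simpa [Metric.closedBall, Real.dist_eq] using this
    have := hconv.norm_image_sub_le_of_norm_hasDerivWithin_le (f := iteratedDeriv 2 φ)
      (f' := iteratedDeriv 3 φ) (C := max D F * weight (δ - 1) (|x| + |y|))
      (fun z _ => (hasDerivAt_iteratedDeriv hd hm3 z).hasDerivWithinAt)
      (fun z hz => (hF.2 z).trans (mul_le_mul (le_max_right _ _)
        (weight_mono_abs (by linarith) ?_) (weight_pos _ _).le
          (hF.nonneg.trans (le_max_right _ _))))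
      (show x ∈ {z : ℝ | |z - x| ≤ |y|} by simp) (show x + y ∈ {z : ℝ | |z - x| ≤ |y|} by simp)
    · rw [Real.norm_eq_abs, Real.norm_eq_abs, add_sub_cancel_left] at this
      rw [Real.rpow_one]
      linarith
    · have h4 := abs_add_le x (z - x)
      rw [add_sub_cancel] at h4
      rw [abs_of_nonneg (show 0 ≤ |x| + |y| by positivity)]
      exact h4.trans (add_le_add le_rfl hz)

lemma exists_isC2_of_smooth {δ : ℝ} (hδ : 0 ≤ δ) {φ : ℝ → ℝ} (hφ : ContDiff ℝ ∞ φ)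
    (hc : HasCompactSupport φ) : ∃ C, IsC2 δ C φ (deriv φ) (deriv (deriv φ)) := by
  have h1 : ContDiff ℝ 2 φ := contDiff_infty.1 hφ 2
  have h2 : ContDiff ℝ 1 (deriv φ) := ((contDiff_succ_iff_deriv (n := 1)).1 h1).2.2
  obtain ⟨C, hC⟩ := HasGrowth.of_hasCompactSupport (h2.continuous_deriv le_rfl) hc.deriv.deriv hδ
  exact ⟨C, fun x => (h1.differentiable (by norm_num) x).hasDerivAt,
    fun x => (h2.differentiable (by norm_num) x).hasDerivAt, hC⟩

/-- The generator of the Fokker-Planck equation acting on a test function. -/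
noncomputable def generator (lam : ℝ) (φ' φ'' : ℝ → ℝ) (v : ℝ) : ℝ :=
  1 / 2 * ((lam ^ 2 * v ^ 2 + 1) * φ'' v) - 1 / 2 * (lam ^ 2 + 1) * (v * φ' v)

lemma IsC2.growth_diffusion {δ C : ℝ} {φ φ' φ'' : ℝ → ℝ} (h : IsC2 δ C φ φ' φ'') (lam : ℝ) :
    HasGrowth (2 + δ) (|lam ^ 2| * C + C) (fun v => (lam ^ 2 * v ^ 2 + 1) * φ'' v) := by
  have := (h.growth_sq_mul.const_mul (lam ^ 2)).add
    (h.growth.mono (show δ ≤ 2 + δ by linarith) le_rfl)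
  convert this using 2
  ring

lemma IsC2.growth_generator {δ C : ℝ} {φ φ' φ'' : ℝ → ℝ} (h : IsC2 δ C φ φ' φ'') (hδ : 0 ≤ δ)
    (lam : ℝ) : ∃ D, HasGrowth (2 + δ) D (generator lam φ' φ'') := by
  have := ((h.growth_diffusion lam).const_mul (1 / 2)).add
    ((h.growth_id_mul hδ).const_mul (-(1 / 2 * (lam ^ 2 + 1))))
  have e : generator lam φ' φ'' = fun v => 1 / 2 * ((lam ^ 2 * v ^ 2 + 1) * φ'' v) +
      -(1 / 2 * (lam ^ 2 + 1)) * (v * φ' v) := by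
    funext v; unfold generator; ring
  rw [e]
  exact ⟨_, this⟩

lemma add_abs_le_mul (v w : ℝ) : |v| + |w| ≤ (1 + |v|) * (1 + |w|) := by
  nlinarith [abs_nonneg v, abs_nonneg w, mul_nonneg (abs_nonneg v) (abs_nonneg w)]

lemma weight_mul_add_abs_le {b c : ℝ} (hb : 0 ≤ b) (v w : ℝ) :
    weight b (c * (|v| + |w|)) ≤ weight b c * (weight b v * weight b w) := by
  refine (weight_mul_le hb _ _).trans (mul_le_mul_of_nonneg_left ?_ (weight_pos _ _).le)
  have := weight_add_le hb |v| |w|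
  simpa [weight] using this

/-- Taylor remainder of a collision, given a power type bound on the oscillation of the second
derivative. -/
lemma abs_rem_sub_le {p q lam δ κ C : ℝ} (hκ : 0 ≤ κ) (hκδ : κ ≤ δ) (hC : 0 ≤ C) (hq : 0 < q)
    (hq1 : q ≤ 1) (hp : (p - 1) ^ 2 = lam ^ 2 * q ^ 2) {φ φ' φ'' : ℝ → ℝ}
    (h1 : ∀ x, HasDerivAt φ (φ' x) x) (h2 : ∀ x, HasDerivAt φ' (φ'' x) x) (z : ℝ × ℝ) (c : ℝ)
    (hM : ∀ y, |φ'' (z.1 + y) - c| ≤ C * |y| ^ κ * weight (δ - κ) (|z.1| + |y|)) :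
    |rem p q φ φ' z - 1 / 2 * c * ((p - 1) * z.1 + q * z.2) ^ 2| ≤
      C * (1 + |lam|) ^ (2 + κ) * weight (δ - κ) (2 + |lam|) * q ^ (2 + κ) *
        (weight (2 + δ) z.1 * weight (2 + δ) z.2) := by
  obtain ⟨v, w⟩ := z
  simp only at hM ⊢
  set u := (p - 1) * v + q * w with hu
  have hl := abs_nonneg lam
  have hv := abs_nonneg v
  have hw := abs_nonneg w
  have hu1 : |u| ≤ q * ((1 + |lam|) * (|v| + |w|)) := abs_displacement_le hq hp v w
  have hu2 : |u| ≤ (1 + |lam|) * (|v| + |w|) :=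
    hu1.trans (mul_le_of_le_one_left (by positivity) hq1)
  have hvu : |v| + |u| ≤ (2 + |lam|) * (|v| + |w|) := by nlinarith
  have hδκ : 0 ≤ δ - κ := by linarith
  have hW : weight (δ - κ) (|v| + |u|) ≤
      weight (δ - κ) (2 + |lam|) * (weight (δ - κ) v * weight (δ - κ) w) := by
    refine le_trans (weight_mono_abs hδκ ?_) (weight_mul_add_abs_le hδκ v w)
    rwa [abs_of_nonneg (by positivity : 0 ≤ |v| + |u|),
      abs_of_nonneg (by positivity : 0 ≤ (2 + |lam|) * (|v| + |w|))]
  have htay := abs_taylor_two_le h1 h2 (v := v) (u := u) (c := c)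
    (M := C * |u| ^ κ * weight (δ - κ) (|v| + |u|)) (fun x hx => by
      have := hM (x - v)
      rw [add_sub_cancel] at this
      refine this.trans ?_
      have e1 : |x - v| ^ κ ≤ |u| ^ κ := Real.rpow_le_rpow (abs_nonneg _) hx hκ
      have e2 : weight (δ - κ) (|v| + |x - v|) ≤ weight (δ - κ) (|v| + |u|) :=
        weight_mono_abs hδκ (by
          rw [abs_of_nonneg (by positivity : 0 ≤ |v| + |x - v|),
            abs_of_nonneg (by positivity : 0 ≤ |v| + |u|)]
          linarith)
      have := weight_pos (δ - κ) (|v| + |x - v|)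
      gcongr)
  have e : rem p q φ φ' (v, w) = φ (v + u) - φ v - φ' v * u := by
    simp only [rem]
    rw [show p * v + q * w = v + u by rw [hu]; ring]
  rw [e]
  refine htay.trans ?_
  have hpow : |u| ^ κ * u ^ 2 ≤
      q ^ (2 + κ) * ((1 + |lam|) ^ (2 + κ) * (weight (2 + κ) v * weight (2 + κ) w)) := by
    have e1 : |u| ^ κ * u ^ 2 = |u| ^ (2 + κ) := by
      rw [add_comm, Real.rpow_add_of_nonneg (abs_nonneg u) hκ (by norm_num), Real.rpow_two, sq_abs]
    rw [e1]
    unfold weight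
    rw [← Real.mul_rpow (by positivity) (by positivity),
      ← Real.mul_rpow (by positivity) (by positivity), ← Real.mul_rpow (by positivity) (by positivity)]
    refine Real.rpow_le_rpow (abs_nonneg u) (hu1.trans ?_) (by linarith)
    have := add_abs_le_mul v w
    gcongr
  -- The factor `|u|^(2+κ)` uses `2 + κ` powers of the weight and the modulus the other `δ - κ`,
  -- exactly exhausting the available moment.
  have es : ∀ x, weight (2 + δ) x = weight (2 + κ) x * weight (δ - κ) x := fun x => by
    rw [← weight_add_exp]; congr 1; ring
  have hpos : 0 ≤ |u| ^ κ * u ^ 2 := by positivity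
  rw [es v, es w]
  calc C * |u| ^ κ * weight (δ - κ) (|v| + |u|) * u ^ 2
      = C * ((|u| ^ κ * u ^ 2) * weight (δ - κ) (|v| + |u|)) := by ring
    _ ≤ C * ((q ^ (2 + κ) * ((1 + |lam|) ^ (2 + κ) * (weight (2 + κ) v * weight (2 + κ) w))) *
        (weight (δ - κ) (2 + |lam|) * (weight (δ - κ) v * weight (δ - κ) w))) :=
        mul_le_mul_of_nonneg_left (mul_le_mul hpow hW (weight_pos _ _).le (hpos.trans hpow)) hC
    _ = _ := by ring

namespace IsScaledFlow

variable {p q lam δ : ℝ} {ρ : ℝ → Measure ℝ}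

/-- Consistency: the scaled collision operator agrees with the generator up to `O(q^κ)`. -/
lemma abs_rate_sub_generator_le (h : IsScaledFlow p q lam δ ρ) {κ C : ℝ} (hκ : 0 < κ)
    (hκδ : κ ≤ δ) (hq : 0 < q) (hq1 : q ≤ 1) (hp : (p - 1) ^ 2 = lam ^ 2 * q ^ 2)
    {φ φ' φ'' : ℝ → ℝ} (hφ : IsC2 δ C φ φ' φ'') (hm : HolderMod δ κ C φ'') {τ : ℝ} (hτ : 0 ≤ τ) :
    |(q ^ 2)⁻¹ * (∫ z, rem p q φ φ' z ∂((ρ τ).prod (ρ τ)))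
        - 1 / 2 * (lam ^ 2 + 1) * (∫ v, v * φ' v ∂ρ τ) - ∫ v, generator lam φ' φ'' v ∂ρ τ| ≤
      C * (1 + |lam|) ^ (2 + κ) * weight (δ - κ) (2 + |lam|) * q ^ κ *
        ((∫ v, weight (2 + δ) v ∂ρ τ) * ∫ v, weight (2 + δ) v ∂ρ τ) := by
  have hδ : 0 ≤ δ := hκ.le.trans hκδ
  have := h.prob τ
  have hmom := h.moment τ
  have i1 : Integrable (fun v => v ^ 2 * φ'' v) (ρ τ) := hφ.growth_sq_mul.integrable hmom
  have i2 : Integrable (fun v => v * φ'' v) (ρ τ) :=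
    ((hasGrowth_id.mul hφ.growth).mono (show 1 + δ ≤ 2 + δ by linarith) le_rfl).integrable hmom
  have i3 : Integrable φ'' (ρ τ) :=
    (hφ.growth.mono (show δ ≤ 2 + δ by linarith) le_rfl).integrable hmom
  have j1 : Integrable (fun v : ℝ => v) (ρ τ) :=
    (hasGrowth_id.mono (show 1 ≤ 2 + δ by linarith) le_rfl).integrable hmom
  have j2 : Integrable (fun v : ℝ => v ^ 2) (ρ τ) :=
    (hasGrowth_sq.mono (show 2 ≤ 2 + δ by linarith) le_rfl).integrable hmom
  have k1 : Integrable (fun z : ℝ × ℝ => 1 / 2 * (p - 1) ^ 2 * (z.1 ^ 2 * φ'' z.1))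
    ((ρ τ).prod (ρ τ)) := (i1.comp_fst _).const_mul _
  have k2 : Integrable (fun z : ℝ × ℝ => (p - 1) * q * ((z.1 * φ'' z.1) * z.2))
    ((ρ τ).prod (ρ τ)) := (i2.mul_prod j1).const_mul _
  have k3 : Integrable (fun z : ℝ × ℝ => 1 / 2 * q ^ 2 * (φ'' z.1 * z.2 ^ 2))
    ((ρ τ).prod (ρ τ)) := (i3.mul_prod j2).const_mul _
  have k12 : Integrable (fun z : ℝ × ℝ => 1 / 2 * (p - 1) ^ 2 * (z.1 ^ 2 * φ'' z.1) +
      (p - 1) * q * ((z.1 * φ'' z.1) * z.2)) ((ρ τ).prod (ρ τ)) := k1.add k2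
  have e0 : (fun z : ℝ × ℝ => 1 / 2 * φ'' z.1 * ((p - 1) * z.1 + q * z.2) ^ 2) =
      fun z => 1 / 2 * (p - 1) ^ 2 * (z.1 ^ 2 * φ'' z.1) +
        (p - 1) * q * ((z.1 * φ'' z.1) * z.2) + 1 / 2 * q ^ 2 * (φ'' z.1 * z.2 ^ 2) := by
    funext z; ring
  -- Mean zero kills the cross term and with it the sign of `p - 1`; unit energy and `(p - 1)² = λ²
  -- q²` produce the diffusion coefficient.
  have e1 : ∫ z : ℝ × ℝ, 1 / 2 * φ'' z.1 * ((p - 1) * z.1 + q * z.2) ^ 2 ∂((ρ τ).prod (ρ τ)) =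
      q ^ 2 * (1 / 2 * ∫ v, (lam ^ 2 * v ^ 2 + 1) * φ'' v ∂ρ τ) := by
    rw [e0, integral_add k12 k3, integral_add k1 k2, integral_const_mul, integral_const_mul,
      integral_const_mul, integral_fun_fst (fun v => v ^ 2 * φ'' v),
      integral_prod_mul (fun v => v * φ'' v) (fun v => v),
      integral_prod_mul φ'' (fun v => v ^ 2), h.mean τ hτ, h.energy τ hτ, hp]
    have : ∫ v, (lam ^ 2 * v ^ 2 + 1) * φ'' v ∂ρ τ =
        lam ^ 2 * (∫ v, v ^ 2 * φ'' v ∂ρ τ) + ∫ v, φ'' v ∂ρ τ := by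
      rw [← integral_const_mul, ← integral_add (i1.const_mul _) i3]
      refine integral_congr_ae (Eventually.of_forall fun v => ?_)
      simp only; ring
    rw [this]
    simp only [probReal_univ, one_smul]
    ring
  have ik : Integrable (fun z : ℝ × ℝ => 1 / 2 * φ'' z.1 * ((p - 1) * z.1 + q * z.2) ^ 2)
      ((ρ τ).prod (ρ τ)) := by
    rw [e0]; exact k12.add k3
  have irem := (integrable_rem (p := p) (q := q) hδ hφ hmom).1
  have e2 : ∫ v, generator lam φ' φ'' v ∂ρ τ =
      1 / 2 * (∫ v, (lam ^ 2 * v ^ 2 + 1) * φ'' v ∂ρ τ)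
        - 1 / 2 * (lam ^ 2 + 1) * ∫ v, v * φ' v ∂ρ τ := by
    unfold generator
    rw [integral_sub (((hφ.growth_diffusion lam).integrable hmom).const_mul _)
      (((hφ.growth_id_mul hδ).integrable hmom).const_mul _), integral_const_mul, integral_const_mul]
  have e3 : (q ^ 2)⁻¹ * (∫ z, rem p q φ φ' z ∂((ρ τ).prod (ρ τ)))
        - 1 / 2 * (lam ^ 2 + 1) * (∫ v, v * φ' v ∂ρ τ) - ∫ v, generator lam φ' φ'' v ∂ρ τ =
      (q ^ 2)⁻¹ * ∫ z, (rem p q φ φ' z - 1 / 2 * φ'' z.1 * ((p - 1) * z.1 + q * z.2) ^ 2)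
        ∂((ρ τ).prod (ρ τ)) := by
    rw [integral_sub irem ik, e1, e2]
    field_simp
    ring
  rw [e3, abs_mul, abs_of_pos (by positivity : 0 < (q ^ 2)⁻¹)]
  have := abs_integral_prod_le_of_le_weight
    (fun z => abs_rem_sub_le hκ.le hκδ hφ.growth.nonneg hq hq1 hp hφ.hasDerivAt hφ.hasDerivAt' z
      (φ'' z.1) (hm z.1)) hmom hmom
  refine (mul_le_mul_of_nonneg_left this (by positivity)).trans (le_of_eq ?_)
  rw [show (2 : ℝ) + κ = κ + (2 : ℕ) by push_cast; ring, Real.rpow_add hq, Real.rpow_natCast]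
  field_simp

/-- The scaled collision operator is bounded uniformly in the mixing parameters. -/
lemma abs_rate_le (h : IsScaledFlow p q lam δ ρ) {C : ℝ} (hδ : 0 ≤ δ) (hq : 0 < q) (hq1 : q ≤ 1)
    (hp : (p - 1) ^ 2 = lam ^ 2 * q ^ 2) {φ φ' φ'' : ℝ → ℝ} (hφ : IsC2 δ C φ φ' φ'') {τ B : ℝ}
    (hB : ∫ v, weight (2 + δ) v ∂ρ τ ≤ B) :
    |(q ^ 2)⁻¹ * (∫ z, rem p q φ φ' z ∂((ρ τ).prod (ρ τ)))
        - 1 / 2 * (lam ^ 2 + 1) * (∫ v, v * φ' v ∂ρ τ)| ≤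
      C * (1 + |lam|) ^ (2 : ℝ) * weight δ (2 + |lam|) * (B * B) +
        1 / 2 * (lam ^ 2 + 1) * ((|φ' 0| + C) * B) := by
  have := h.prob τ
  have hmom := h.moment τ
  have hC := hφ.growth.nonneg
  have hM0 : 0 ≤ ∫ v, weight (2 + δ) v ∂ρ τ := integral_nonneg fun v => (weight_pos _ v).le
  have hB0 := hM0.trans hB
  have hM : ∀ z : ℝ × ℝ, |rem p q φ φ' z| ≤
      C * (1 + |lam|) ^ (2 : ℝ) * weight δ (2 + |lam|) * q ^ (2 : ℝ) *
        (weight (2 + δ) z.1 * weight (2 + δ) z.2) := fun z => by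
    -- With `κ = 0` and `c = 0` the growth of `φ''` serves as the modulus, so no Hölder condition is
    -- needed.
    have := abs_rem_sub_le (κ := 0) le_rfl hδ hC hq hq1 hp hφ.hasDerivAt hφ.hasDerivAt' z 0
      (fun y => by
        rw [sub_zero, sub_zero, Real.rpow_zero, mul_one]
        refine (hφ.growth.2 _).trans (mul_le_mul_of_nonneg_left (weight_mono_abs hδ ?_) hC)
        rw [abs_of_nonneg (by positivity : 0 ≤ |z.1| + |y|)]
        exact abs_add_le _ _)
    simpa using this
  have h1 := abs_integral_prod_le_of_le_weight hM hmom hmom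
  have h2 := (hφ.growth_id_mul hδ).abs_integral_le hmom
  have h3 : |(q ^ 2)⁻¹ * (∫ z, rem p q φ φ' z ∂((ρ τ).prod (ρ τ)))| ≤
      C * (1 + |lam|) ^ (2 : ℝ) * weight δ (2 + |lam|) * (B * B) := by
    rw [abs_mul, abs_of_pos (by positivity : 0 < (q ^ 2)⁻¹)]
    refine (mul_le_mul_of_nonneg_left h1 (by positivity)).trans ?_
    rw [Real.rpow_two q]
    have hw := weight_pos δ (2 + |lam|)
    calc _ = C * (1 + |lam|) ^ (2 : ℝ) * weight δ (2 + |lam|) *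
          ((∫ v, weight (2 + δ) v ∂ρ τ) * ∫ v, weight (2 + δ) v ∂ρ τ) := by field_simp
      _ ≤ _ := by gcongr
  have h4 : |1 / 2 * (lam ^ 2 + 1) * (∫ v, v * φ' v ∂ρ τ)| ≤
      1 / 2 * (lam ^ 2 + 1) * ((|φ' 0| + C) * B) := by
    rw [abs_mul, abs_of_pos (by positivity : 0 < 1 / 2 * (lam ^ 2 + 1))]
    refine mul_le_mul_of_nonneg_left (h2.trans ?_) (by positivity)
    gcongr
  exact (abs_sub _ _).trans (add_le_add h3 h4)

end IsScaledFlow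

/-! ### From smooth test functions to the full growth class. -/

lemma weight_le_tail {δ n : ℝ} (hδ : 0 ≤ δ) (hn : 1 ≤ n) {v : ℝ} (hv : n ≤ |v|) :
    weight (2 + δ) v ≤ 2 ^ (2 + δ) * (v ^ 2 * kern δ n v) := by
  have hv0 : 0 < |v| := by linarith
  rw [kern_eq (by linarith) hv, ← sq_abs v, ← Real.rpow_two |v|, ← Real.rpow_add hv0,
    ← Real.mul_rpow (by norm_num) hv0.le]
  exact Real.rpow_le_rpow (by positivity) (by linarith) (by linarith)

/-- Turns the tail estimate at `R = 1` into a moment bound uniform in the mixing parameters. -/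
lemma weight_le_one_add_tail {δ : ℝ} (hδ : 0 ≤ δ) (v : ℝ) :
    weight (2 + δ) v ≤ 2 ^ (2 + δ) * (1 + v ^ 2 * kern δ 1 v) := by
  have h0 : 0 ≤ v ^ 2 * kern δ 1 v := mul_nonneg (sq_nonneg v) (kern_nonneg one_pos v)
  have h2 : (0 : ℝ) ≤ 2 ^ (2 + δ) := by positivity
  rcases le_total 1 |v| with hv | hv
  · exact (weight_le_tail hδ le_rfl hv).trans (mul_le_mul_of_nonneg_left (by linarith) h2)
  · have : weight (2 + δ) v ≤ 2 ^ (2 + δ) :=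
      Real.rpow_le_rpow (by positivity) (by linarith) (by linarith)
    exact this.trans (le_mul_of_one_le_right h2 (by linarith))

/-- Integrals of the approximations converge at a rate controlled by the tails. -/
lemma abs_integral_sub_approx_le {δ C : ℝ} (hδ : 0 ≤ δ) {φ : ℝ → ℝ} (hφ : HasGrowth (2 + δ) C φ)
    {g : ℝ → ℝ} (hgc : Continuous g) {n : ℕ} (hn : 1 ≤ n)
    (hg : ∀ v : ℝ, |v| ≤ n → |g v - φ v| ≤ 1 / ((n : ℝ) + 1)) (hb : ∀ v, |g v| ≤ |φ v| + 1)
    {ν : Measure ℝ} [IsProbabilityMeasure ν] (hν : Integrable (weight (2 + δ)) ν) :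
    |(∫ v, φ v ∂ν) - ∫ v, g v ∂ν| ≤
      1 / ((n : ℝ) + 1) + (2 * C + 1) * 2 ^ (2 + δ) * ∫ v, v ^ 2 * kern δ n v ∂ν := by
  have hn' : (1 : ℝ) ≤ n := by exact_mod_cast hn
  have hn0 : (0 : ℝ) < n := by linarith
  have hgg : HasGrowth (2 + δ) (C + 1) g := ⟨hgc, fun v => by
    refine (hb v).trans ?_
    rw [add_mul, one_mul]
    exact add_le_add (hφ.2 v) (one_le_weight (by linarith) v)⟩
  have i3 : Integrable (fun v => v ^ 2 * kern δ n v) ν :=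
    (isC2_kernPrim₂ hδ hn0).growth_sq_mul.integrable hν
  have hpt : ∀ v, |φ v - g v| ≤
      1 / ((n : ℝ) + 1) + (2 * C + 1) * 2 ^ (2 + δ) * (v ^ 2 * kern δ n v) := fun v => by
    have hC := hφ.nonneg
    have h0 : 0 ≤ v ^ 2 * kern δ n v := mul_nonneg (sq_nonneg v) (kern_nonneg hn0 v)
    rcases le_total |v| n with hv | hv
    · rw [abs_sub_comm]
      exact (hg v hv).trans (le_add_of_nonneg_right (by positivity))
    · have h1 := weight_le_tail hδ hn' hv
      have h2 : |φ v - g v| ≤ (2 * C + 1) * weight (2 + δ) v := by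
        have := abs_sub (φ v) (g v)
        have h3 := hφ.2 v
        have h4 := hgg.2 v
        linarith
      refine (h2.trans (mul_le_mul_of_nonneg_left h1 (by linarith))).trans ?_
      rw [← mul_assoc]
      exact le_add_of_nonneg_left (by positivity)
  rw [← integral_sub (hφ.integrable hν) (hgg.integrable hν)]
  have := norm_integral_le_of_norm_le (f := fun v => φ v - g v)
    ((integrable_const (1 / ((n : ℝ) + 1))).add (i3.const_mul ((2 * C + 1) * 2 ^ (2 + δ))))
    (Eventually.of_forall hpt)
  refine this.trans (le_of_eq ?_)
  simp only [Pi.add_apply]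
  rw [integral_add (integrable_const _) (i3.const_mul _), integral_const_mul]
  simp

section Extension

variable {ι : Type*} {l : Filter ι} {ν : ι → Measure ℝ} {ν' : Measure ℝ} {δ : ℝ}

/-- Convergence against smooth test functions and uniformly small tails imply convergence against
all test functions of admissible growth. -/
lemma tendsto_integral_of_tail (hδ : 0 ≤ δ) (hν : ∀ i, IsProbabilityMeasure (ν i))
    (hνm : ∀ i, Integrable (weight (2 + δ)) (ν i)) [IsProbabilityMeasure ν']
    (hν'm : Integrable (weight (2 + δ)) ν')
    (hsm : ∀ φ : ℝ → ℝ, ContDiff ℝ ∞ φ → HasCompactSupport φ →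
      Tendsto (fun i => ∫ v, φ v ∂ν i) l (𝓝 (∫ v, φ v ∂ν')))
    {t : ℝ → ℝ} (ht : Tendsto t atTop (𝓝 0))
    (htail : ∀ R, 0 < R → ∀ᶠ i in l, ∫ v, v ^ 2 * kern δ R v ∂ν i ≤ t R)
    {C : ℝ} {φ : ℝ → ℝ} (hφ : HasGrowth (2 + δ) C φ) :
    Tendsto (fun i => ∫ v, φ v ∂ν i) l (𝓝 (∫ v, φ v ∂ν')) := by
  obtain ⟨g, hg, hgc, hgl, hgb, -⟩ := exists_smooth_approx hφ.1
  set D := (2 * C + 1) * (2 : ℝ) ^ (2 + δ) with hD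
  have hD0 : 0 ≤ D := by have := hφ.nonneg; positivity
  have lim : ∀ s : ℝ → ℝ, Tendsto s atTop (𝓝 0) →
      Tendsto (fun n : ℕ => 1 / ((n : ℝ) + 1) + D * s n) atTop (𝓝 0) := fun s hs => by
    simpa using tendsto_one_div_add_atTop_nhds_zero_nat.add
      ((hs.comp tendsto_natCast_atTop_atTop).const_mul D)
  rw [Metric.tendsto_nhds]
  intro ε hε
  -- The truncation index depends only on the common tail bound and on the limit, not on `i`.
  obtain ⟨n, h1, h2, hn⟩ := (((lim t ht).eventually_lt_const (show 0 < ε / 3 by linarith)).and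
    (((lim _ (tendsto_integral_tail hδ hν'm)).eventually_lt_const (show 0 < ε / 3 by linarith)).and
      (eventually_ge_atTop 1))).exists
  have hn' : (0 : ℝ) < n := by exact_mod_cast hn
  filter_upwards [htail n hn', (Metric.tendsto_nhds.1 (hsm (g n) (hg n) (hgc n))) (ε / 3)
    (by linarith)] with i hi1 hi2
  have := hν i
  have e1 := abs_integral_sub_approx_le hδ hφ (hg n).continuous hn (hgl n) (hgb n) (hνm i)
  have e2 := abs_integral_sub_approx_le hδ hφ (hg n).continuous hn (hgl n) (hgb n) hν'm
  rw [Real.dist_eq] at hi2 ⊢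
  have e3 := mul_le_mul_of_nonneg_left hi1 hD0
  rw [abs_sub_comm] at e2
  have e4 := abs_add_three ((∫ v, φ v ∂ν i) - ∫ v, g n v ∂ν i)
    ((∫ v, g n v ∂ν i) - ∫ v, g n v ∂ν') ((∫ v, g n v ∂ν') - ∫ v, φ v ∂ν')
  rw [show (∫ v, φ v ∂ν i) - (∫ v, g n v ∂ν i) + ((∫ v, g n v ∂ν i) - ∫ v, g n v ∂ν') +
    ((∫ v, g n v ∂ν') - ∫ v, φ v ∂ν') = (∫ v, φ v ∂ν i) - ∫ v, φ v ∂ν' by ring] at e4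
  linarith

/-- Fatou's lemma along smooth approximations of the weight; each of them is at most `weight + 1`,
hence the bound `B + 1`. -/
lemma integrable_weight_of_tendsto [NeBot l] {a : ℝ} (ha : 0 ≤ a)
    (hν : ∀ i, IsProbabilityMeasure (ν i))
    (hνm : ∀ i, Integrable (weight a) (ν i)) {B : ℝ} (hB : ∀ i, ∫ v, weight a v ∂ν i ≤ B)
    [IsProbabilityMeasure ν']
    (hsm : ∀ φ : ℝ → ℝ, ContDiff ℝ ∞ φ → HasCompactSupport φ →
      Tendsto (fun i => ∫ v, φ v ∂ν i) l (𝓝 (∫ v, φ v ∂ν'))) :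
    Integrable (weight a) ν' := by
  obtain ⟨g, hg, hgc, hgl, hgb, hg0⟩ := exists_smooth_approx (continuous_weight a)
  have hg0 := hg0 (one_le_weight ha)
  have hgi : ∀ (n : ℕ) (m : Measure ℝ) [IsProbabilityMeasure m], Integrable (g n) m :=
    fun n m _ => (hg n).continuous.integrable_of_hasCompactSupport (hgc n)
  have h1 : ∀ n, ∫ v, g n v ∂ν' ≤ B + 1 := fun n => by
    refine le_of_tendsto' (hsm (g n) (hg n) (hgc n)) fun i => ?_
    have := hν i
    have h2 : ∫ v, g n v ∂ν i ≤ ∫ v, (weight a v + 1) ∂ν i :=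
      integral_mono (hgi n _) ((hνm i).add (integrable_const 1)) fun v => by
        have := hgb n v
        rw [abs_of_pos (weight_pos a v)] at this
        exact (le_abs_self _).trans this
    rw [integral_add (hνm i) (integrable_const 1)] at h2
    simp only [integral_const, probReal_univ, smul_eq_mul, mul_one] at h2
    linarith [hB i]
  refine ⟨(continuous_weight a).aestronglyMeasurable, ?_⟩
  rw [hasFiniteIntegral_iff_ofReal (Eventually.of_forall fun v => (weight_pos a v).le)]
  have h2 : ∀ v, ENNReal.ofReal (weight a v) =
      liminf (fun n => ENNReal.ofReal (g n v)) atTop := fun v =>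
    ((ENNReal.continuous_ofReal.tendsto _).comp (tendsto_smooth_approx hgl v)).liminf_eq.symm
  simp only [h2]
  refine (lintegral_liminf_le fun n => (hg n).continuous.measurable.ennreal_ofReal).trans_lt ?_
  refine lt_of_le_of_lt ?_ (ENNReal.ofReal_lt_top (r := B + 1))
  refine liminf_le_of_le ⟨0, Eventually.of_forall fun _ => bot_le⟩ fun b hb => ?_
  obtain ⟨n, hn⟩ := hb.exists
  refine hn.trans ?_
  rw [← ofReal_integral_eq_lintegral_ofReal (hgi n ν') (Eventually.of_forall (hg0 n))]
  exact ENNReal.ofReal_le_ofReal (h1 n)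

end Extension

/-! ### Compactness of curves of probability measures. -/

/-- Probability measures with second moment at most `B` form a relatively compact set. -/
lemma isCompact_closure_second_moment (B : ℝ) :
    IsCompact (closure {P : ProbabilityMeasure ℝ | Integrable (fun v : ℝ => v ^ 2) (P : Measure ℝ) ∧
      ∫ v, v ^ 2 ∂(P : Measure ℝ) ≤ B}) := by
  refine isCompact_closure_of_isTightMeasureSet ?_
  rw [isTightMeasureSet_iff_exists_isCompact_measure_compl_le]
  intro ε hε
  obtain ⟨r, hr0, hr⟩ : ∃ r : ℝ, 0 < r ∧ ENNReal.ofReal r ≤ ε := by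
    obtain ⟨x, hx0, hx⟩ := ENNReal.lt_iff_exists_real_btwn.1 hε
    exact ⟨x, ENNReal.ofReal_pos.1 hx.1, hx.2.le⟩
  refine ⟨Metric.closedBall 0 (√(|B| / r)), isCompact_closedBall _ _, ?_⟩
  rintro _ ⟨P, ⟨hPi, hPB⟩, rfl⟩
  refine le_trans ?_ hr
  rw [← ENNReal.ofReal_toReal (measure_ne_top (P : Measure ℝ) _)]
  refine ENNReal.ofReal_le_ofReal ?_
  -- For `B = 0` the radius is zero and Chebyshev says nothing, but then `v = 0` almost surely.
  rcases eq_or_ne B 0 with rfl | hB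
  · have h0 : (fun v : ℝ => v ^ 2) =ᵐ[(P : Measure ℝ)] 0 :=
      (integral_eq_zero_iff_of_nonneg (fun v => sq_nonneg v) hPi).1
        (le_antisymm hPB (integral_nonneg fun v => sq_nonneg v))
    have : (P : Measure ℝ) (Metric.closedBall 0 (√(|0| / r)))ᶜ = 0 := by
      refine measure_mono_null (fun v hv => ?_) h0
      simpa using hv
    rw [this]; simpa using hr0.le
  · have hB' : 0 < |B| / r := by positivity
    have := mul_meas_ge_le_integral_of_nonneg
      (Eventually.of_forall fun v : ℝ => sq_nonneg v) hPi (|B| / r)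
    have h2 : (P : Measure ℝ).real (Metric.closedBall 0 (√(|B| / r)))ᶜ ≤
        (P : Measure ℝ).real {v | |B| / r ≤ v ^ 2} := measureReal_mono fun v hv => by
      simp only [Set.mem_compl_iff, Metric.mem_closedBall, dist_zero_right, Real.norm_eq_abs,
        not_le] at hv
      rw [Set.mem_ofPred_eq, ← sq_abs v]
      exact (Real.sqrt_le_left (abs_nonneg v)).1 hv.le
    have h3 := mul_le_mul_of_nonneg_left h2 hB'.le
    have h4 : |B| / r * (P : Measure ℝ).real (Metric.closedBall 0 (√(|B| / r)))ᶜ ≤ |B| :=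
      h3.trans (this.trans (hPB.trans (le_abs_self B)))
    rw [div_mul_eq_mul_div, div_le_iff₀ hr0] at h4
    exact le_of_mul_le_mul_left h4 (by positivity)

/-- A diagonal compactness principle for sequences of curves of probability measures which are
equi-Lipschitz against smooth test functions. -/
lemma exists_subseq_tendsto {K : Set (ProbabilityMeasure ℝ)} (hK : IsCompact K)
    (P : ℕ → ℝ → ProbabilityMeasure ℝ) (hP : ∀ n t, P n t ∈ K)
    (hlip : ∀ φ : ℝ → ℝ, ContDiff ℝ ∞ φ → HasCompactSupport φ → ∀ T : ℝ, ∃ L : ℝ, ∀ n s t,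
      |s| ≤ T → |t| ≤ T →
        |(∫ v, φ v ∂(P n t : Measure ℝ)) - ∫ v, φ v ∂(P n s : Measure ℝ)| ≤ L * |t - s|) :
    ∃ (k : ℕ → ℕ) (Q : ℝ → ProbabilityMeasure ℝ), StrictMono k ∧
      ∀ (t : ℝ) (φ : ℝ → ℝ), ContDiff ℝ ∞ φ → HasCompactSupport φ →
        Tendsto (fun j => ∫ v, φ v ∂(P (k j) t : Measure ℝ)) atTop
          (𝓝 (∫ v, φ v ∂(Q t : Measure ℝ))) := by
  have hbdd : ∀ φ : ℝ → ℝ, ContDiff ℝ ∞ φ → HasCompactSupport φ → ∀ {u : ℕ → ProbabilityMeasure ℝ}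
      {m : ProbabilityMeasure ℝ}, Tendsto u atTop (𝓝 m) →
      Tendsto (fun j => ∫ v, φ v ∂(u j : Measure ℝ)) atTop (𝓝 (∫ v, φ v ∂(m : Measure ℝ))) := by
    intro φ hφ hc u m hu
    obtain ⟨C, hC⟩ := hc.exists_bound_of_continuous hφ.continuous
    exact (ProbabilityMeasure.tendsto_iff_forall_integral_tendsto.1 hu)
      (BoundedContinuousFunction.ofNormedAddCommGroup φ hφ.continuous C hC)
  -- The countable product over rational times is compact and metrizable, so one subsequence serves
  -- all rational times.
  obtain ⟨a, -, k, hk, hka⟩ := (isCompact_univ_pi fun _ : ℚ => hK).tendsto_subseq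
    (x := fun n (r : ℚ) => P n r) (fun n r _ => hP n r)
  rw [tendsto_pi_nhds] at hka
  have hcauchy : ∀ (t : ℝ) (φ : ℝ → ℝ), ContDiff ℝ ∞ φ → HasCompactSupport φ →
      ∃ y, Tendsto (fun j => ∫ v, φ v ∂(P (k j) t : Measure ℝ)) atTop (𝓝 y) := by
    intro t φ hφ hc
    refine cauchySeq_tendsto_of_complete (Metric.cauchySeq_iff'.2 fun ε hε => ?_)
    obtain ⟨L, hL⟩ := hlip φ hφ hc (|t| + 1)
    -- The rational `r` makes each of the two Lipschitz errors at most `ε / 4`; the Cauchy property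
    -- at `r` contributes a third `ε / 4`.
    obtain ⟨r, hr⟩ := Metric.denseRange_iff.1 (Rat.denseRange_cast (𝕜 := ℝ)) t
      (min 1 (ε / (4 * (|L| + 1)))) (by positivity)
    rw [Real.dist_eq] at hr
    have hr1 : |t - (r : ℝ)| < 1 := hr.trans_le (min_le_left _ _)
    have hr2 : |L| * |t - (r : ℝ)| ≤ ε / 4 := by
      have h5 := (lt_div_iff₀ (by positivity)).1 (hr.trans_le (min_le_right _ _))
      nlinarith [abs_nonneg (t - (r : ℝ)), abs_nonneg L]
    have hrT : |(r : ℝ)| ≤ |t| + 1 := by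
      have := abs_sub_abs_le_abs_sub (r : ℝ) t
      rw [abs_sub_comm] at this
      linarith
    have hclose : ∀ n, |(∫ v, φ v ∂(P n t : Measure ℝ)) - ∫ v, φ v ∂(P n r : Measure ℝ)| ≤ ε / 4 :=
      fun n => (hL n r t hrT (by linarith)).trans
        ((mul_le_mul_of_nonneg_right (le_abs_self L) (abs_nonneg _)).trans hr2)
    obtain ⟨N, hN⟩ := Metric.cauchySeq_iff'.1 (hbdd φ hφ hc (hka r)).cauchySeq (ε / 4)
      (by positivity)
    refine ⟨N, fun n hn => ?_⟩
    have h1 := hN n hn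
    simp only [Function.comp, Real.dist_eq] at h1 ⊢
    have h2 := hclose (k n)
    have h3 := hclose (k N)
    rw [abs_lt] at h1 ⊢
    rw [abs_le] at h2 h3
    constructor <;> linarith
  have hQ : ∀ t : ℝ, ∃ m : ProbabilityMeasure ℝ, ∀ φ : ℝ → ℝ, ContDiff ℝ ∞ φ →
      HasCompactSupport φ → Tendsto (fun j => ∫ v, φ v ∂(P (k j) t : Measure ℝ)) atTop
          (𝓝 (∫ v, φ v ∂(m : Measure ℝ))) := by
    intro t
    -- This further subsequence depends on `t` but only serves to name the limit: by `hcauchy` the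
    -- integrals along `k` already converge.
    obtain ⟨m, -, i, hi, him⟩ := hK.tendsto_subseq (x := fun j => P (k j) t) (fun j => hP _ _)
    refine ⟨m, fun φ hφ hc => ?_⟩
    obtain ⟨y, hy⟩ := hcauchy t φ hφ hc
    have := tendsto_nhds_unique (hy.comp hi.tendsto_atTop) (hbdd φ hφ hc him)
    rwa [← this]
  choose Q hQ using hQ
  exact ⟨k, Q, hk, hQ⟩

/-! ### The limit of scaled flows and its equation. -/

/-- A sequence of scaled flows with vanishing mixing parameter and common initial datum. -/
structure IsScaledSequence (lam δ : ℝ) (μ₀ : Measure ℝ) (p q : ℕ → ℝ) (ρ : ℕ → ℝ → Measure ℝ) :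
    Prop where
  flow : ∀ n, IsScaledFlow (p n) (q n) lam δ (ρ n)
  pos : ∀ n, 0 < q n
  le_one : ∀ n, q n ≤ 1
  mix : ∀ n, (p n - 1) ^ 2 = lam ^ 2 * q n ^ 2
  tendsto : Tendsto q atTop (𝓝 0)
  initial : ∀ n, ρ n 0 = μ₀

/-- A bound for the tails up to time `T`. -/
noncomputable def tailBound (lam δ : ℝ) (μ₀ : Measure ℝ) (T R : ℝ) : ℝ :=
  8 * 4 ^ (δ + 1) * Real.exp (tailConst lam δ * T) * ∫ v, v ^ 2 * kern δ R v ∂μ₀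

lemma tendsto_tailBound {lam δ : ℝ} (hδ : 0 ≤ δ) {μ₀ : Measure ℝ}
    (hμ : Integrable (weight (2 + δ)) μ₀) (T : ℝ) :
    Tendsto (tailBound lam δ μ₀ T) atTop (𝓝 0) := by
  have := (tendsto_integral_tail hδ hμ).const_mul
    (8 * 4 ^ (δ + 1) * Real.exp (tailConst lam δ * T))
  rwa [mul_zero] at this

namespace IsScaledSequence

variable {lam δ : ℝ} {μ₀ : Measure ℝ} {p q : ℕ → ℝ} {ρ : ℕ → ℝ → Measure ℝ}

lemma integrable_initial (h : IsScaledSequence lam δ μ₀ p q ρ) :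
    Integrable (weight (2 + δ)) μ₀ := by
  rw [← h.initial 0]; exact (h.flow 0).moment 0

lemma tail_le (h : IsScaledSequence lam δ μ₀ p q ρ) (hδ : 0 ≤ δ) (n : ℕ) {τ T R : ℝ} (hR : 0 < R)
    (hτ : 0 ≤ τ) (hT : τ ≤ T) :
    ∫ v, v ^ 2 * kern δ R v ∂ρ n τ ≤ tailBound lam δ μ₀ T R := by
  refine ((h.flow n).integral_tail_le hδ (h.pos n) (h.le_one n) (h.mix n) hR hτ).trans ?_
  rw [h.initial n]
  have := tailConst_nonneg lam δ
  have h0 : 0 ≤ ∫ v, v ^ 2 * kern δ R v ∂μ₀ :=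
    integral_nonneg fun v => mul_nonneg (sq_nonneg v) (kern_nonneg hR v)
  unfold tailBound
  gcongr

lemma exists_moment_le (h : IsScaledSequence lam δ μ₀ p q ρ) (hδ : 0 ≤ δ) (T : ℝ) :
    ∃ B, ∀ n τ, 0 ≤ τ → τ ≤ T → ∫ v, weight (2 + δ) v ∂ρ n τ ≤ B := by
  refine ⟨2 ^ (2 + δ) * (1 + tailBound lam δ μ₀ T 1), fun n τ hτ hT => ?_⟩
  have := (h.flow n).prob τ
  have i2 := (isC2_kernPrim₂ hδ one_pos).growth_sq_mul.integrable ((h.flow n).moment τ)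
  have h1 := integral_mono ((h.flow n).moment τ)
    (((integrable_const (1 : ℝ)).add i2).const_mul (2 ^ (2 + δ))) (weight_le_one_add_tail hδ)
  refine h1.trans ?_
  rw [integral_const_mul, Pi.add_def, integral_add (integrable_const _) i2]
  have h2 := h.tail_le hδ n one_pos hτ hT
  simp only [integral_const, probReal_univ, smul_eq_mul, mul_one]
  gcongr

/-- The curves are reflected to `|τ|` because `exists_subseq_tendsto` works on the whole line;
reflection preserves the Lipschitz constant. -/
lemma exists_lipschitz (h : IsScaledSequence lam δ μ₀ p q ρ) (hδ : 0 ≤ δ) {C : ℝ}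
    {φ φ' φ'' : ℝ → ℝ} (hφ : IsC2 δ C φ φ' φ'') (T : ℝ) :
    ∃ L : ℝ, 0 ≤ L ∧ ∀ n s t, |s| ≤ T → |t| ≤ T →
      |(∫ v, φ v ∂ρ n |t|) - (∫ v, φ v ∂ρ n |s|)| ≤ L * |t - s| := by
  obtain ⟨B, hB⟩ := h.exists_moment_le hδ T
  set L := C * (1 + |lam|) ^ (2 : ℝ) * weight δ (2 + |lam|) * (B * B) +
    1 / 2 * (lam ^ 2 + 1) * ((|φ' 0| + C) * B)
  refine ⟨|L|, abs_nonneg L, fun n s t hs ht => ?_⟩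
  have := (convex_Icc (0 : ℝ) T).norm_image_sub_le_of_norm_hasDerivWithin_le
    (f := fun τ => ∫ v, φ v ∂ρ n τ) (C := |L|)
    (fun τ hτ => ((h.flow n).deriv _ _ _ _ hφ τ hτ.1).mono Set.Icc_subset_Ici_self)
    (fun τ hτ => ((h.flow n).abs_rate_le hδ (h.pos n) (h.le_one n) (h.mix n) hφ
      (hB n τ hτ.1 hτ.2)).trans (le_abs_self L)) (x := |s|) (y := |t|)
      ⟨abs_nonneg s, hs⟩ ⟨abs_nonneg t, ht⟩
  exact this.trans (mul_le_mul_of_nonneg_left (abs_abs_sub_abs_le t s) (abs_nonneg L))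

/-- The integrated weak form for the scaled flows, with rate converging to the generator. -/
lemma exists_rate (h : IsScaledSequence lam δ μ₀ p q ρ) (hδ : 0 ≤ δ) {κ C : ℝ} (hκ : 0 < κ)
    (hκδ : κ ≤ δ) {φ φ' φ'' : ℝ → ℝ} (hφ : IsC2 δ C φ φ' φ'') (hm : HolderMod δ κ C φ'')
    (T : ℝ) (hT : 0 ≤ T) :
    ∃ (r : ℕ → ℝ → ℝ) (L : ℝ), (∀ n, ∀ s ∈ Set.Ioc 0 T, |r n s| ≤ L) ∧
      (∀ n, AEStronglyMeasurable (r n) (volume.restrict (Set.uIoc 0 T))) ∧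
      (∀ n, ∫ s in (0 : ℝ)..T, r n s = (∫ v, φ v ∂ρ n T) - ∫ v, φ v ∂μ₀) ∧
      (∀ s ∈ Set.Ioc 0 T,
        Tendsto (fun n => r n s - ∫ v, generator lam φ' φ'' v ∂ρ n s) atTop (𝓝 0)) := by
  obtain ⟨B, hB⟩ := h.exists_moment_le hδ T
  set L := C * (1 + |lam|) ^ (2 : ℝ) * weight δ (2 + |lam|) * (B * B) +
    1 / 2 * (lam ^ 2 + 1) * ((|φ' 0| + C) * B)
  set r : ℕ → ℝ → ℝ := fun n τ =>
    (q n ^ 2)⁻¹ * (∫ z, rem (p n) (q n) φ φ' z ∂((ρ n τ).prod (ρ n τ)))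
        - 1 / 2 * (lam ^ 2 + 1) * ∫ v, v * φ' v ∂ρ n τ
  have hd : ∀ n τ, 0 ≤ τ → HasDerivWithinAt (fun s => ∫ v, φ v ∂ρ n s) (r n τ) (Set.Ici 0) τ :=
    fun n τ hτ => (h.flow n).deriv _ _ _ _ hφ τ hτ
  have hd' : ∀ n τ, 0 < τ → HasDerivAt (fun s => ∫ v, φ v ∂ρ n s) (r n τ) τ :=
    fun n τ hτ => (hd n τ hτ.le).hasDerivAt (Ici_mem_nhds hτ)
  have hL : ∀ n, ∀ s ∈ Set.Ioc 0 T, |r n s| ≤ L := fun n s hs =>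
    (h.flow n).abs_rate_le hδ (h.pos n) (h.le_one n) (h.mix n) hφ (hB n s hs.1.le hs.2)
  have hmeas : ∀ n, AEStronglyMeasurable (r n) (volume.restrict (Set.uIoc 0 T)) := fun n => by
    refine ((measurable_deriv (fun r => ∫ v, φ v ∂ρ n r)).aestronglyMeasurable).congr ?_
    rw [Set.uIoc_of_le hT]
    exact (ae_restrict_iff' measurableSet_Ioc).2
      (Eventually.of_forall fun s hs => (hd' n s hs.1).deriv)
  refine ⟨r, L, hL, hmeas, fun n => ?_, fun s hs => ?_⟩
  · rw [← h.initial n]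
    refine intervalIntegral.integral_eq_sub_of_hasDerivAt_of_le hT
      (fun s hs => ((hd n s hs.1).continuousWithinAt).mono Set.Icc_subset_Ici_self)
      (fun s hs => hd' n s hs.1) ?_
    refine (intervalIntegrable_const (c := L)).mono_fun' (hmeas n) ?_
    rw [Set.uIoc_of_le hT]
    exact (ae_restrict_iff' measurableSet_Ioc).2 (Eventually.of_forall fun s hs => hL n s hs)
  · have hlim : Tendsto (fun n => C * (1 + |lam|) ^ (2 + κ) * weight (δ - κ) (2 + |lam|) *
        q n ^ κ * (B * B)) atTop (𝓝 0) := by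
      have h0 : Tendsto (fun n => q n ^ κ) atTop (𝓝 0) := by
        have := h.tendsto.rpow_const (p := κ) (Or.inr hκ.le)
        rwa [Real.zero_rpow hκ.ne'] at this
      simpa using (h0.const_mul (C * (1 + |lam|) ^ (2 + κ) * weight (δ - κ) (2 + |lam|))).mul_const
        (B * B)
    refine squeeze_zero_norm (fun n => ?_) hlim
    have hn := (h.flow n).abs_rate_sub_generator_le hκ hκδ (h.pos n) (h.le_one n) (h.mix n) hφ hm
      hs.1.le
    have hM0 : 0 ≤ ∫ v, weight (2 + δ) v ∂ρ n s := integral_nonneg fun v => (weight_pos _ v).le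
    have hMB := hB n s hs.1.le hs.2
    have hC := hφ.growth.nonneg
    have hw := weight_pos (δ - κ) (2 + |lam|)
    have hq := (h.pos n).le
    have hB0 := hM0.trans hMB
    refine hn.trans ?_
    gcongr

/-- Compactness of the scaled flows and identification of the limit. -/
theorem exists_limit (h : IsScaledSequence lam δ μ₀ p q ρ) (hδ : 0 < δ) :
    ∃ (k : ℕ → ℕ) (Q : ℝ → ProbabilityMeasure ℝ), StrictMono k ∧
      (∀ τ, Integrable (weight (2 + δ)) (Q τ : Measure ℝ)) ∧
      (∀ C φ, HasGrowth (2 + δ) C φ → ∀ τ, 0 ≤ τ →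
        Tendsto (fun j => ∫ v, φ v ∂ρ (k j) τ) atTop (𝓝 (∫ v, φ v ∂(Q τ : Measure ℝ)))) ∧
      (∀ φ ∈ HolderClass (2 + δ), ∀ τ, 0 < τ →
        HasDerivAt (fun s => ∫ v, φ v ∂(Q s : Measure ℝ))
          (∫ v, generator lam (deriv φ) (iteratedDeriv 2 φ) v ∂(Q τ : Measure ℝ)) τ) ∧
      (∀ C φ, HasGrowth (2 + δ) C φ →
        Tendsto (fun τ => ∫ v, φ v ∂(Q τ : Measure ℝ)) (𝓝[>] 0) (𝓝 (∫ v, φ v ∂μ₀))) := by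
  have hδ0 := hδ.le
  set P : ℕ → ℝ → ProbabilityMeasure ℝ := fun n τ => ⟨ρ n |τ|, (h.flow n).prob _⟩
  have hPρ : ∀ n τ, (P n τ : Measure ℝ) = ρ n |τ| := fun _ _ => rfl
  have hlip : ∀ φ : ℝ → ℝ, ContDiff ℝ ∞ φ → HasCompactSupport φ → ∀ T : ℝ, ∃ L : ℝ, 0 ≤ L ∧
      ∀ n s t, |s| ≤ T → |t| ≤ T →
        |(∫ v, φ v ∂(P n t : Measure ℝ)) - ∫ v, φ v ∂(P n s : Measure ℝ)| ≤ L * |t - s| :=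
    fun φ hφ hc T => by
      obtain ⟨C, hC⟩ := exists_isC2_of_smooth hδ0 hφ hc
      exact h.exists_lipschitz hδ0 hC T
  obtain ⟨k, Q, hk, hQ⟩ := exists_subseq_tendsto (isCompact_closure_second_moment 1) P
    (fun n τ => subset_closure ⟨(hasGrowth_sq.mono (show 2 ≤ 2 + δ by linarith) le_rfl).integrable
      ((h.flow n).moment _), ((h.flow n).energy _ (abs_nonneg τ)).le⟩)
    (fun φ hφ hc T => by
      obtain ⟨L, -, hL⟩ := hlip φ hφ hc T
      exact ⟨L, hL⟩)
  have hQm : ∀ τ, Integrable (weight (2 + δ)) (Q τ : Measure ℝ) := fun τ => by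
    obtain ⟨B, hB⟩ := h.exists_moment_le hδ0 |τ|
    exact integrable_weight_of_tendsto (by linarith) (fun j => (P (k j) τ).2)
      (fun j => (h.flow (k j)).moment _) (fun j => hB (k j) _ (abs_nonneg τ) le_rfl) (hQ τ)
  have hconv : ∀ C φ, HasGrowth (2 + δ) C φ → ∀ τ,
      Tendsto (fun j => ∫ v, φ v ∂(P (k j) τ : Measure ℝ)) atTop
        (𝓝 (∫ v, φ v ∂(Q τ : Measure ℝ))) := fun C φ hφ τ =>
    tendsto_integral_of_tail hδ0 (fun j => (P (k j) τ).2) (fun j => (h.flow (k j)).moment _)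
      (hQm τ) (hQ τ) (tendsto_tailBound hδ0 h.integrable_initial |τ|)
      (fun R hR => Eventually.of_forall fun j => h.tail_le hδ0 (k j) hR (abs_nonneg τ) le_rfl) hφ
  -- The tail function itself has growth `2 + δ`, so the uniform bound passes to the limit curve.
  have hQtail : ∀ T R τ, 0 < R → |τ| ≤ T →
      ∫ v, v ^ 2 * kern δ R v ∂(Q τ : Measure ℝ) ≤ tailBound lam δ μ₀ T R := fun T R τ hR hT =>
    le_of_tendsto' (hconv _ _ (isC2_kernPrim₂ hδ0 hR).growth_sq_mul τ)
      fun j => h.tail_le hδ0 (k j) hR (abs_nonneg τ) hT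
  have hcont : ∀ C φ, HasGrowth (2 + δ) C φ → Continuous fun τ => ∫ v, φ v ∂(Q τ : Measure ℝ) :=
    fun C φ hφ => continuous_iff_continuousAt.2 fun τ => by
      have hball : ∀ᶠ s in 𝓝 τ, |s| ≤ |τ| + 1 := by
        filter_upwards [Metric.ball_mem_nhds τ one_pos] with s hs
        rw [Metric.mem_ball, Real.dist_eq] at hs
        have := abs_sub_abs_le_abs_sub s τ
        linarith
      -- The same extension principle, now along the filter `𝓝 τ`: the limit curve inherits
      -- Lipschitz bounds for smooth functions and the tail bound.
      refine tendsto_integral_of_tail hδ0 (fun s => (Q s).2) hQm (hQm τ) (fun φ hφ hc => ?_)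
        (tendsto_tailBound hδ0 h.integrable_initial (|τ| + 1))
        (fun R hR => hball.mono fun s hs => hQtail _ R s hR hs) hφ
      obtain ⟨L, hL0, hL⟩ := hlip φ hφ hc (|τ| + 1)
      refine continuousAt_of_locally_lipschitz one_pos L fun s hs => ?_
      rw [Real.dist_eq] at hs
      rw [Real.dist_eq, Real.dist_eq]
      have hs' : |s| ≤ |τ| + 1 := by
        have := abs_sub_abs_le_abs_sub s τ
        linarith
      exact le_of_tendsto' ((hQ s φ hφ hc).sub (hQ τ φ hφ hc)).abs
        fun j => hL (k j) τ s (by linarith) hs'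
  have hQ0 : ∀ C φ, HasGrowth (2 + δ) C φ → ∫ v, φ v ∂(Q 0 : Measure ℝ) = ∫ v, φ v ∂μ₀ :=
    fun C φ hφ => by
      refine tendsto_nhds_unique (hconv C φ hφ 0) ?_
      have : ∀ j, (P (k j) 0 : Measure ℝ) = μ₀ := fun j => by
        rw [hPρ, abs_zero, h.initial]
      simp only [this]
      exact tendsto_const_nhds
  refine ⟨k, Q, hk, hQm, fun C φ hφ τ hτ => ?_, fun φ hφ τ hτ => ?_, fun C φ hφ => ?_⟩
  · have := hconv C φ hφ τ
    simp only [hPρ, abs_of_nonneg hτ] at this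
    exact this
  · obtain ⟨C, κ, hκ, hκδ, hφC, hφm⟩ := exists_isC2_of_mem_holderClass hδ hφ
    obtain ⟨D, hD⟩ := hφC.growth_generator hδ0 lam
    have hφg := hφC.growth_self hδ0
    -- The limit is taken in the time-integrated equation. The generator integral is continuous in
    -- time, so the equation can be differentiated afterwards.
    have hint : ∀ t, 0 < t → ∫ v, φ v ∂(Q t : Measure ℝ) =
        (∫ s in (0 : ℝ)..t, ∫ v, generator lam (deriv φ) (iteratedDeriv 2 φ) v ∂(Q s : Measure ℝ))
          + ∫ v, φ v ∂(Q 0 : Measure ℝ) := by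
      intro t ht
      obtain ⟨r, L, hrL, hrm, hri, hrt⟩ := h.exists_rate hδ0 hκ hκδ hφC hφm t ht.le
      have h1 : Tendsto (fun j => ∫ s in (0 : ℝ)..t, r (k j) s) atTop
          (𝓝 (∫ s in (0 : ℝ)..t,
            ∫ v, generator lam (deriv φ) (iteratedDeriv 2 φ) v ∂(Q s : Measure ℝ))) := by
        refine intervalIntegral.tendsto_integral_filter_of_dominated_convergence (fun _ => L)
          (Eventually.of_forall fun j => hrm (k j))
          (Eventually.of_forall fun j => Eventually.of_forall fun s hs => ?_)
          intervalIntegrable_const (Eventually.of_forall fun s hs => ?_)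
        · rw [Set.uIoc_of_le ht.le] at hs
          exact hrL (k j) s hs
        · rw [Set.uIoc_of_le ht.le] at hs
          have h2 := hconv D _ hD s
          simp only [hPρ, abs_of_pos hs.1] at h2
          simpa using ((hrt s hs).comp hk.tendsto_atTop).add h2
      have h3 := hconv _ φ hφg t
      simp only [hPρ, abs_of_pos ht] at h3
      simp only [hri] at h1
      rw [hQ0 _ φ hφg, tendsto_nhds_unique h1 (h3.sub_const _)]
      ring
    have h4 := (((hcont D _ hD).integral_hasStrictDerivAt 0 τ).hasDerivAt.add_const
      (∫ v, φ v ∂(Q 0 : Measure ℝ)))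
    refine h4.congr_of_eventuallyEq ?_
    filter_upwards [Ioi_mem_nhds hτ] with t ht
    exact hint t ht
  · rw [← hQ0 C φ hφ]
    exact ((hcont C φ hφ).tendsto 0).mono_left nhdsWithin_le_nhds

end IsScaledSequence

/-! ### Density bounds and absolute continuity of the limit. -/

/-- Continuous test functions with compact support and values in `[0, 1]`. -/
structure IsCutoff (φ : ℝ → ℝ) : Prop where
  continuous : Continuous φ
  compact : HasCompactSupport φ
  nonneg : ∀ v, 0 ≤ φ v
  le_one : ∀ v, φ v ≤ 1

lemma IsCutoff.comp_affine {φ : ℝ → ℝ} (h : IsCutoff φ) {c : ℝ} (hc : c ≠ 0) (b : ℝ) :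
    IsCutoff fun v => φ (c * v + b) :=
  ⟨by have := h.continuous; fun_prop,
    h.compact.comp_homeomorph ((Homeomorph.mulLeft₀ c hc).trans (Homeomorph.addRight b)),
    fun _ => h.nonneg _, fun _ => h.le_one _⟩

lemma integral_comp_affine (φ : ℝ → ℝ) {c : ℝ} (hc : 0 < c) (b : ℝ) :
    ∫ v, φ (c * v + b) = c⁻¹ * ∫ v, φ v := by
  rw [Measure.integral_comp_mul_left (fun v => φ (v + b)) c, integral_add_right_eq_self,
    abs_of_pos (inv_pos.2 hc), smul_eq_mul]

/-- `∫ φ dμ ≤ ε + K ∫ φ` for all cutoff functions: up to mass `ε`, the measure has a density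
bounded by `K`. -/
def HasDensityBound (ε K : ℝ) (μ : Measure ℝ) : Prop :=
  ∀ φ, IsCutoff φ → ∫ v, φ v ∂μ ≤ ε + K * ∫ v, φ v

lemma IsCutoff.integrable {φ : ℝ → ℝ} (h : IsCutoff φ) (μ : Measure ℝ)
    [IsFiniteMeasureOnCompacts μ] : Integrable φ μ :=
  h.continuous.integrable_of_hasCompactSupport h.compact

namespace IsFlow

variable {p q a : ℝ} {μ : ℝ → Measure ℝ}

/-- For frozen `w`, the function `v ↦ φ(pv + qw)` is again a cutoff, with integral `p⁻¹ ∫ φ`.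
Averaging over the probability measure in `w` leaves `ε` unchanged. -/
lemma gain_le_of_densityBound (h : IsFlow p q a μ) (hp : 0 < p) {ε K t : ℝ}
    (hb : HasDensityBound ε K (μ t)) {φ : ℝ → ℝ} (hφ : IsCutoff φ) :
    gain p q φ (μ t) ≤ ε + K * (p⁻¹ * ∫ v, φ v) := by
  have := h.prob t
  have hi : Integrable (fun z : ℝ × ℝ => φ (p * z.1 + q * z.2)) ((μ t).prod (μ t)) := by
    refine (integrable_const (1 : ℝ)).mono' ?_ (Eventually.of_forall fun z => ?_)
    · have := hφ.continuous
      exact Continuous.aestronglyMeasurable (by fun_prop)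
    · rw [Real.norm_eq_abs, abs_of_nonneg (hφ.nonneg _)]
      exact hφ.le_one _
  unfold gain
  rw [integral_prod_symm _ hi]
  calc ∫ w, ∫ v, φ (p * v + q * w) ∂μ t ∂μ t ≤ ∫ _, (ε + K * (p⁻¹ * ∫ v, φ v)) ∂μ t := by
        refine integral_mono hi.integral_prod_right (integrable_const _) fun w => ?_
        have := hb _ (hφ.comp_affine hp.ne' (q * w))
        rwa [integral_comp_affine φ hp] at this
    _ = _ := by simp

/-- The gain involves other cutoffs than `φ`, so no Grönwall inequality closes for a single `φ`.
Instead an a priori excess error `c` is improved: it is absent at time `0`, and the loss term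
regenerates only the fraction `1 - e^{-t}` of it. -/
lemma densityBound_step (h : IsFlow p q a μ) (ha : 0 ≤ a) (hp : 0 < p) {ε K : ℝ}
    (h0 : HasDensityBound ε K (μ 0)) {c T : ℝ} (hc : 0 ≤ c)
    (hb : ∀ t, 0 ≤ t → t ≤ T → HasDensityBound (ε + c) (K * Real.exp ((p⁻¹ - 1) * t)) (μ t))
    {t : ℝ} (ht : 0 ≤ t) (htT : t ≤ T) :
    HasDensityBound (ε + c * (1 - Real.exp (-T))) (K * Real.exp ((p⁻¹ - 1) * t)) (μ t) := by
  intro φ hφ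
  obtain ⟨C, hC⟩ := HasGrowth.of_hasCompactSupport hφ.continuous hφ.compact ha
  set I := ∫ v, φ v with hI
  set y : ℝ → ℝ := fun s => Real.exp s * (∫ v, φ v ∂μ s) -
    (Real.exp s * (ε + c) + K * Real.exp (p⁻¹ * s) * I) with hy
  have hd : ∀ s, 0 ≤ s → HasDerivWithinAt y (Real.exp s * gain p q φ (μ s) -
      (Real.exp s * (ε + c) + K * (Real.exp (p⁻¹ * s) * p⁻¹) * I)) (Set.Ici 0) s := fun s hs => by
    have h1 := (Real.hasDerivAt_exp s).hasDerivWithinAt (s := Set.Ici 0)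
    have h2 := h1.mul (h.hasDerivWithinAt_integral ha hC hs)
    have h3 : HasDerivAt (fun s => Real.exp (p⁻¹ * s)) (Real.exp (p⁻¹ * s) * p⁻¹) s := by
      simpa using ((hasDerivAt_id s).const_mul p⁻¹).exp
    have h4 := (h1.mul_const (ε + c)).add ((h3.const_mul K).mul_const I).hasDerivWithinAt
    exact (h2.sub h4).congr_deriv (by ring)
  have hanti : AntitoneOn y (Set.Icc 0 T) := by
    refine antitoneOn_of_deriv_nonpos (convex_Icc 0 T)
      (fun s hs => ((hd s hs.1).continuousWithinAt).mono Set.Icc_subset_Ici_self)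
      (fun s hs => ?_) (fun s hs => ?_) <;> rw [interior_Icc] at hs <;>
      have h2 := (hd s hs.1.le).hasDerivAt (Ici_mem_nhds hs.1)
    · exact h2.differentiableAt.differentiableWithinAt
    · rw [h2.deriv]
      have h3 := mul_le_mul_of_nonneg_left
        (h.gain_le_of_densityBound hp (hb s hs.1.le hs.2.le) hφ) (Real.exp_pos s).le
      have h4 : Real.exp s * Real.exp ((p⁻¹ - 1) * s) = Real.exp (p⁻¹ * s) := by
        rw [← Real.exp_add]; congr 1; ring
      rw [← h4]
      linarith
  have h1 := hanti (Set.mem_Icc.2 ⟨le_rfl, ht.trans htT⟩) (Set.mem_Icc.2 ⟨ht, htT⟩) ht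
  have h2 := h0 φ hφ
  simp only [hy, Real.exp_zero, mul_zero, one_mul, mul_one] at h1
  have h3 : Real.exp t * (∫ v, φ v ∂μ t) ≤
      Real.exp t * (ε + c) + K * Real.exp (p⁻¹ * t) * I - c := by linarith
  have h4 := mul_le_mul_of_nonneg_left h3 (Real.exp_pos (-t)).le
  have h5 : Real.exp (-t) * Real.exp t = 1 := by rw [← Real.exp_add]; simp
  have h6 : Real.exp (-t) * Real.exp (p⁻¹ * t) = Real.exp ((p⁻¹ - 1) * t) := by
    rw [← Real.exp_add]; congr 1; ring
  have h7 : Real.exp (-T) ≤ Real.exp (-t) := Real.exp_le_exp.2 (by linarith)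
  rw [← mul_assoc, h5, one_mul] at h4
  have h8 : Real.exp (-t) * (Real.exp t * (ε + c) + K * Real.exp (p⁻¹ * t) * I - c) =
      (Real.exp (-t) * Real.exp t) * (ε + c) + K * (Real.exp (-t) * Real.exp (p⁻¹ * t)) * I -
        c * Real.exp (-t) := by ring
  rw [h8, h5, h6] at h4
  have h9 := mul_le_mul_of_nonneg_left h7 hc
  linarith

/-- Propagation of density bounds along the flow. -/
lemma densityBound (h : IsFlow p q a μ) (ha : 0 ≤ a) (hp : 0 < p) {ε K : ℝ} (hε : 0 ≤ ε)
    (hK : 0 ≤ K) (h0 : HasDensityBound ε K (μ 0)) {t : ℝ} (ht : 0 ≤ t) :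
    HasDensityBound ε (K * Real.exp ((p⁻¹ - 1) * t)) (μ t) := by
  have he : Real.exp (-t) ≤ 1 := Real.exp_le_one_iff.2 (by linarith)
  have he0 := Real.exp_pos (-t)
  -- The iteration starts from the trivial bound `∫ φ dμ ≤ 1`, an excess error of `1`, and contracts
  -- it geometrically.
  have key : ∀ n : ℕ, ∀ s, 0 ≤ s → s ≤ t →
      HasDensityBound (ε + (1 - Real.exp (-t)) ^ n) (K * Real.exp ((p⁻¹ - 1) * s)) (μ s) := by
    intro n
    induction n with
    | zero =>
      intro s _ _ φ hφ
      have := h.prob s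
      have h1 : ∫ v, φ v ∂μ s ≤ ∫ _, (1 : ℝ) ∂μ s :=
        integral_mono (hφ.integrable _) (integrable_const 1) hφ.le_one
      simp only [integral_const, probReal_univ, smul_eq_mul, mul_one] at h1
      have h2 : 0 ≤ K * Real.exp ((p⁻¹ - 1) * s) * ∫ v, φ v :=
        mul_nonneg (by positivity) (integral_nonneg hφ.nonneg)
      rw [pow_zero]
      linarith
    | succ n ih =>
      intro s hs hst
      rw [pow_succ]
      exact h.densityBound_step ha hp h0 (pow_nonneg (by linarith) n) ih hs hst
  intro φ hφ
  have hlim : Tendsto (fun n : ℕ => ε + (1 - Real.exp (-t)) ^ n +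
      K * Real.exp ((p⁻¹ - 1) * t) * ∫ v, φ v) atTop
      (𝓝 (ε + 0 + K * Real.exp ((p⁻¹ - 1) * t) * ∫ v, φ v)) :=
    ((tendsto_pow_atTop_nhds_zero_of_lt_one (by linarith) (by linarith)).const_add ε).add_const _
  rw [add_zero] at hlim
  exact ge_of_tendsto' hlim fun n => key n t ht le_rfl φ hφ

/-- Density bounds for the scaled solutions, uniform in the mixing parameters. -/
lemma densityBound_scaled (h : IsFlow p q a μ) (ha : 0 ≤ a) (hp : 1 / 2 ≤ p) (hq : 0 < q)
    {lam : ℝ} (hpq : (p - 1) ^ 2 = lam ^ 2 * q ^ 2) {ε K : ℝ} (hε : 0 ≤ ε) (hK : 0 ≤ K)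
    (h0 : HasDensityBound ε K (μ 0)) {τ : ℝ} (hτ : 0 ≤ τ) :
    HasDensityBound ε (K * Real.exp ((3 * lam ^ 2 + 1) * τ)) (scaledMeasure p q μ τ) := by
  intro φ hφ
  have hp0 : 0 < p := by linarith
  unfold scaledMeasure
  set α := (p ^ 2 + q ^ 2 - 1) / 2 with hα
  have h1 := h.densityBound ha hp0 hε hK h0 (t := τ / q ^ 2) (by positivity) _
    (hφ.comp_affine (Real.exp_pos (-α * (τ / q ^ 2))).ne' 0)
  rw [integral_comp_affine φ (Real.exp_pos _)] at h1
  simp only [add_zero] at h1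
  rw [integral_map_mul hφ.continuous]
  refine h1.trans ?_
  rw [← Real.exp_neg, ← mul_assoc, mul_assoc K, ← Real.exp_add]
  have hI : 0 ≤ ∫ v, φ v := integral_nonneg hφ.nonneg
  have hexp : (p⁻¹ - 1) * (τ / q ^ 2) + -(-α * (τ / q ^ 2)) ≤ (3 * lam ^ 2 + 1) * τ := by
    have e1 : (p⁻¹ - 1) * (τ / q ^ 2) + -(-α * (τ / q ^ 2)) =
        (lam ^ 2 * p⁻¹ + 1 / 2 * (lam ^ 2 + 1)) * τ := by
      -- The first order parts `-(p - 1)` of `p⁻¹ - 1` and `p - 1` of `α` cancel, so the exponent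
      -- stays bounded in the slow time.
      have e2 : p⁻¹ - 1 + α = (lam ^ 2 * p⁻¹ + 1 / 2 * (lam ^ 2 + 1)) * q ^ 2 := by
        have e3 : (p - 1) ^ 2 * p⁻¹ = lam ^ 2 * q ^ 2 * p⁻¹ := by rw [hpq]
        have e4 : (p - 1) ^ 2 * p⁻¹ = p - 2 + p⁻¹ := by field_simp; ring
        rw [hα]
        linarith
      calc _ = (p⁻¹ - 1 + α) * (τ / q ^ 2) := by ring
        _ = _ := by rw [e2]; field_simp
    rw [e1]
    have e5 : p⁻¹ ≤ 2 := by
      rw [inv_le_comm₀ hp0 (by norm_num)]; linarith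
    have e6 := mul_le_mul_of_nonneg_left e5 (sq_nonneg lam)
    exact mul_le_mul_of_nonneg_right (by nlinarith [sq_nonneg lam]) hτ
  have := Real.exp_le_exp.2 hexp
  gcongr

end IsFlow

/-- The initial density satisfies density bounds with arbitrarily small error. -/
lemma exists_densityBound {f : ℝ → ℝ} (hf0 : ∀ᵐ v, 0 ≤ f v) (hf : Integrable f) {ε : ℝ}
    (hε : 0 < ε) :
    ∃ K, 0 ≤ K ∧ HasDensityBound ε K (volume.withDensity fun v => ENNReal.ofReal (f v)) := by
  -- Split `f ≤ (f - K)⁺ + K`; the excess `(f - K)⁺` has small integral for large `K`.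
  have hlim : Tendsto (fun K : ℝ => ∫ v, max (f v - K) 0) atTop (𝓝 (∫ _ : ℝ, (0 : ℝ))) := by
    refine tendsto_integral_filter_of_dominated_convergence (fun v => |f v|) ?_ ?_ hf.abs ?_
    · exact Eventually.of_forall fun K =>
        (hf.aestronglyMeasurable.sub aestronglyMeasurable_const).sup aestronglyMeasurable_const
    · filter_upwards [eventually_ge_atTop 0] with K hK
      refine Eventually.of_forall fun v => ?_
      rw [Real.norm_eq_abs, abs_of_nonneg (le_max_right _ _)]
      exact max_le (by linarith [le_abs_self (f v)]) (abs_nonneg _)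
    · refine Eventually.of_forall fun v => tendsto_const_nhds.congr' ?_
      filter_upwards [eventually_ge_atTop (f v)] with K hK
      rw [max_eq_right (by linarith)]
  rw [integral_zero] at hlim
  obtain ⟨K, hK, hK0⟩ := ((hlim.eventually_lt_const hε).and (eventually_ge_atTop 0)).exists
  refine ⟨K, hK0, fun φ hφ => ?_⟩
  have hi : Integrable fun v => max (f v - K) 0 := by
    refine hf.abs.mono' ((hf.aestronglyMeasurable.sub aestronglyMeasurable_const).sup
      aestronglyMeasurable_const) (Eventually.of_forall fun v => ?_)
    rw [Real.norm_eq_abs, abs_of_nonneg (le_max_right _ _)]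
    exact max_le (by linarith [le_abs_self (f v)]) (abs_nonneg _)
  rw [integral_withDensity_eq_integral_toReal_smul₀ hf.aemeasurable.ennreal_ofReal
    (Eventually.of_forall fun _ => ENNReal.ofReal_lt_top)]
  have hle : ∫ v, (ENNReal.ofReal (f v)).toReal • φ v ≤ ∫ v, (max (f v - K) 0 + K * φ v) := by
    refine integral_mono_of_nonneg ?_ (hi.add ((hφ.integrable _).const_mul K)) ?_
    · exact Eventually.of_forall fun v => smul_nonneg ENNReal.toReal_nonneg (hφ.nonneg v)
    · filter_upwards [hf0] with v hv
      rw [ENNReal.toReal_ofReal hv, smul_eq_mul]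
      have h1 := hφ.nonneg v
      have h2 := hφ.le_one v
      have h3 : (f v - K) * φ v ≤ max (f v - K) 0 * φ v :=
        mul_le_mul_of_nonneg_right (le_max_left _ _) h1
      have h4 : max (f v - K) 0 * φ v ≤ max (f v - K) 0 :=
        mul_le_of_le_one_right (le_max_right _ _) h2
      linarith
  rw [integral_add hi ((hφ.integrable _).const_mul K), integral_const_mul] at hle
  linarith

/-- A probability measure with density bounds of arbitrarily small error is absolutely
continuous. -/
lemma absolutelyContinuous_of_densityBound {m : Measure ℝ} [IsProbabilityMeasure m]
    (h : ∀ ε, 0 < ε → ∃ K, 0 ≤ K ∧ HasDensityBound ε K m) : m ≪ volume := by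
  refine Measure.AbsolutelyContinuous.mk fun N _ hN => ?_
  by_contra hne
  have hpos : 0 < m.real N := ENNReal.toReal_pos hne (measure_ne_top m N)
  set ε := m.real N / 4 with hε
  obtain ⟨K, hK, hKb⟩ := h ε (by positivity)
  -- A null set of mass `4ε` lies in an open `U` of volume below `ε / (K + 1)`. A compact `L ⊆ U` of
  -- mass above `2ε` and a cutoff between them contradict the bound `ε + K ε / (K + 1) ≤ 2ε`.
  obtain ⟨U, hNU, hU, hUv⟩ := Set.exists_isOpen_lt_of_lt (μ := (volume : Measure ℝ)) N
    (ENNReal.ofReal (ε / (K + 1))) (by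
      rw [hN]; exact ENNReal.ofReal_pos.2 (by positivity))
  have hNU' : m N ≤ m U := measure_mono hNU
  have hlt : ENNReal.ofReal (2 * ε) < m U := by
    refine lt_of_lt_of_le ?_ hNU'
    rw [ENNReal.ofReal_lt_iff_lt_toReal (by positivity) (measure_ne_top m N)]
    change 2 * ε < m.real N
    linarith
  rw [hU.measure_eq_iSup_isCompact] at hlt
  simp only [lt_iSup_iff] at hlt
  obtain ⟨L, hLU, hL, hLm⟩ := hlt
  obtain ⟨φ, hφ1, hφ0, hφc, hφr⟩ := exists_continuous_one_zero_of_isCompact hL hU.isClosed_compl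
    (Set.disjoint_compl_right_iff_subset.2 hLU)
  have hcut : IsCutoff φ := ⟨φ.continuous, hφc, fun v => (hφr v).1, fun v => (hφr v).2⟩
  have h1 := hKb φ hcut
  have h2 : ∫ v, φ v ≤ ε / (K + 1) := by
    have h3 : ∫ v, φ v ≤ ∫ v, U.indicator (fun _ => (1 : ℝ)) v := by
      refine integral_mono (hcut.integrable _)
        ((integrable_indicator_iff hU.measurableSet).2
          (integrableOn_const (hUv.trans ENNReal.ofReal_lt_top).ne)) fun v => ?_
      by_cases hv : v ∈ U
      · rw [Set.indicator_of_mem hv]; exact hcut.le_one v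
      · rw [Set.indicator_of_notMem hv]; exact (hφ0 hv).le
    rw [integral_indicator_const _ hU.measurableSet, smul_eq_mul, mul_one] at h3
    refine h3.trans ?_
    exact ENNReal.toReal_le_of_le_ofReal (by positivity) hUv.le
  have h4 : m.real L ≤ ∫ v, φ v ∂m := by
    have h3 : ∫ v, L.indicator (fun _ => (1 : ℝ)) v ∂m ≤ ∫ v, φ v ∂m := by
      refine integral_mono ((integrable_const (1 : ℝ)).indicator hL.measurableSet)
        (hcut.integrable _) fun v => ?_
      by_cases hv : v ∈ L
      · rw [Set.indicator_of_mem hv]; exact (hφ1 hv).ge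
      · rw [Set.indicator_of_notMem hv]; exact hcut.nonneg v
    rwa [integral_indicator_const _ hL.measurableSet, smul_eq_mul, mul_one] at h3
  have h5 : 2 * ε < m.real L := by
    rwa [ENNReal.ofReal_lt_iff_lt_toReal (by positivity) (measure_ne_top m L)] at hLm
  have h6 : K * ∫ v, φ v ≤ ε := by
    calc K * ∫ v, φ v ≤ K * (ε / (K + 1)) := by gcongr
      _ ≤ (K + 1) * (ε / (K + 1)) := by gcongr; linarith
      _ = ε := by field_simp
  linarith

/-! ### Translation between densities and measures. -/

/-- The measure with density `f`. -/
noncomputable def densityMeasure (f : ℝ → ℝ) : Measure ℝ :=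
  volume.withDensity fun v => ENNReal.ofReal (f v)

namespace IsProbDensity

variable {f : ℝ → ℝ}

lemma integral_densityMeasure (h : IsProbDensity f) (φ : ℝ → ℝ) :
    ∫ v, φ v ∂densityMeasure f = ∫ v, φ v * f v := by
  unfold densityMeasure
  rw [integral_withDensity_eq_integral_toReal_smul₀ h.2.1.aemeasurable.ennreal_ofReal
    (Eventually.of_forall fun _ => ENNReal.ofReal_lt_top)]
  refine integral_congr_ae ?_
  filter_upwards [h.1] with v hv
  rw [ENNReal.toReal_ofReal hv, smul_eq_mul, mul_comm]

lemma integrable_densityMeasure (h : IsProbDensity f) {φ : ℝ → ℝ} :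
    Integrable φ (densityMeasure f) ↔ Integrable fun v => φ v * f v := by
  unfold densityMeasure
  rw [integrable_withDensity_iff_integrable_smul₀' h.2.1.aemeasurable.ennreal_ofReal
    (Eventually.of_forall fun _ => ENNReal.ofReal_lt_top)]
  refine integrable_congr ?_
  filter_upwards [h.1] with v hv
  rw [ENNReal.toReal_ofReal hv, smul_eq_mul, mul_comm]

lemma isProbabilityMeasure (h : IsProbDensity f) : IsProbabilityMeasure (densityMeasure f) := by
  refine ⟨?_⟩
  unfold densityMeasure
  rw [withDensity_apply _ MeasurableSet.univ, Measure.restrict_univ,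
    ← ofReal_integral_eq_lintegral_ofReal h.2.1 h.1, h.2.2, ENNReal.ofReal_one]

lemma gain_densityMeasure (h : IsProbDensity f) (p q : ℝ) (φ : ℝ → ℝ) :
    gain p q φ (densityMeasure f) =
      ∫ z : ℝ × ℝ, f z.1 * f z.2 * φ (p * z.1 + q * z.2) := by
  have hm := h.2.1.aemeasurable.ennreal_ofReal
  unfold gain densityMeasure
  have hm2 : AEMeasurable (fun z : ℝ × ℝ => ENNReal.ofReal (f z.1) * ENNReal.ofReal (f z.2))
      (volume.prod volume) :=
    (hm.comp_quasiMeasurePreserving Measure.quasiMeasurePreserving_fst).mul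
      (hm.comp_quasiMeasurePreserving Measure.quasiMeasurePreserving_snd)
  rw [prod_withDensity₀ hm hm, integral_withDensity_eq_integral_toReal_smul₀ hm2
    (Eventually.of_forall fun _ => ENNReal.mul_lt_top ENNReal.ofReal_lt_top ENNReal.ofReal_lt_top)]
  refine integral_congr_ae ?_
  filter_upwards [Measure.quasiMeasurePreserving_fst.ae h.1,
    Measure.quasiMeasurePreserving_snd.ae h.1] with z h1 h2
  rw [ENNReal.toReal_mul, ENNReal.toReal_ofReal h1, ENNReal.toReal_ofReal h2, smul_eq_mul]

lemma collision_eq (h : IsProbDensity f) (p q : ℝ) {φ : ℝ → ℝ} (hφ : Continuous φ)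
    (hc : HasCompactSupport φ) :
    collision p q f φ = gain p q φ (densityMeasure f) - ∫ v, φ v ∂densityMeasure f := by
  obtain ⟨C, hC⟩ := hc.exists_bound_of_continuous hφ
  have hff : Integrable fun z : ℝ × ℝ => f z.1 * f z.2 := h.2.1.mul_prod h.2.1
  have i1 : Integrable fun z : ℝ × ℝ => f z.1 * f z.2 * φ (p * z.1 + q * z.2) :=
    hff.mul_bdd (c := C) (Continuous.aestronglyMeasurable (by fun_prop))
      (Eventually.of_forall fun z => hC _)
  have i2 : Integrable fun z : ℝ × ℝ => f z.1 * f z.2 * φ z.1 :=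
    hff.mul_bdd (c := C) (Continuous.aestronglyMeasurable (by fun_prop))
      (Eventually.of_forall fun z => hC _)
  have e : ∫ z : ℝ × ℝ, f z.1 * f z.2 * φ z.1 = ∫ v, φ v * f v := by
    have := integral_prod_mul (μ := (volume : Measure ℝ)) (ν := (volume : Measure ℝ))
      (fun v => φ v * f v) f
    rw [h.2.2, mul_one] at this
    rw [← this]
    refine integral_congr_ae (Eventually.of_forall fun z => ?_)
    simp only; ring
  unfold collision
  rw [h.gain_densityMeasure, h.integral_densityMeasure, ← e, ← integral_sub i1 i2]
  refine integral_congr_ae (Eventually.of_forall fun z => ?_)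
  simp only; ring

end IsProbDensity

lemma IsProbDensityWithMoment.integrable_weight {a : ℝ} (ha : 0 ≤ a) {f : ℝ → ℝ}
    (h : IsProbDensityWithMoment a f) : Integrable (weight a) (densityMeasure f) := by
  have := h.1.isProbabilityMeasure
  have h1 : Integrable (fun v : ℝ => |v| ^ a) (densityMeasure f) :=
    h.1.integrable_densityMeasure.2 h.2
  refine (((integrable_const (1 : ℝ)).add h1).const_mul (2 ^ a)).mono'
    (continuous_weight a).aestronglyMeasurable (Eventually.of_forall fun v => ?_)
  rw [Real.norm_eq_abs, abs_of_pos (weight_pos a v)]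
  simp only [Pi.add_apply]
  have h0 : 0 ≤ |v| ^ a := Real.rpow_nonneg (abs_nonneg v) a
  have h2 : (0 : ℝ) ≤ 2 ^ a := by positivity
  rcases le_total |v| 1 with hv | hv
  · have : weight a v ≤ 2 ^ a := Real.rpow_le_rpow (by positivity) (by linarith) ha
    exact this.trans (le_mul_of_one_le_right h2 (by linarith))
  · have : weight a v ≤ 2 ^ a * |v| ^ a := by
      rw [← Real.mul_rpow (by norm_num) (abs_nonneg v)]
      exact Real.rpow_le_rpow (by positivity) (by linarith) ha
    exact this.trans (mul_le_mul_of_nonneg_left (by linarith) h2)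

/-- The family of measures attached to a weak solution, extended by the initial datum. -/
noncomputable def solutionMeasure (f₀ : ℝ → ℝ) (f : ℝ → ℝ → ℝ) (t : ℝ) : Measure ℝ :=
  if t ≤ 0 then densityMeasure f₀ else densityMeasure (f t)

lemma solutionMeasure_of_nonpos {f₀ : ℝ → ℝ} {f : ℝ → ℝ → ℝ} {t : ℝ} (ht : t ≤ 0) :
    solutionMeasure f₀ f t = densityMeasure f₀ := if_pos ht

lemma solutionMeasure_of_pos {f₀ : ℝ → ℝ} {f : ℝ → ℝ → ℝ} {t : ℝ} (ht : 0 < t) :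
    solutionMeasure f₀ f t = densityMeasure (f t) := if_neg ht.not_ge

lemma IsWeakBoltzmannSolution.isFlow {p q a : ℝ} (ha : 0 ≤ a) {f₀ : ℝ → ℝ} {f : ℝ → ℝ → ℝ}
    (hf₀ : IsProbDensityWithMoment a f₀) (h : IsWeakBoltzmannSolution p q a f₀ f) :
    IsFlow p q a (solutionMeasure f₀ f) := by
  refine ⟨fun t => ?_, fun t => ?_, fun φ hφ hc t ht => ?_, fun φ hφ hc => ?_, fun t ht => ?_⟩
  · rcases le_or_gt t 0 with ht | ht
    · rw [solutionMeasure_of_nonpos ht]; exact hf₀.1.isProbabilityMeasure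
    · rw [solutionMeasure_of_pos ht]; exact (h.density t ht).1.isProbabilityMeasure
  · rcases le_or_gt t 0 with ht | ht
    · rw [solutionMeasure_of_nonpos ht]; exact hf₀.integrable_weight ha
    · rw [solutionMeasure_of_pos ht]; exact (h.density t ht).integrable_weight ha
  · have h1 := h.weak_form φ hφ hc t ht
    rw [(h.density t ht).1.collision_eq p q hφ.continuous hc] at h1
    rw [solutionMeasure_of_pos ht]
    refine h1.congr_of_eventuallyEq ?_
    filter_upwards [Ioi_mem_nhds ht] with s hs
    rw [solutionMeasure_of_pos hs, (h.density s hs).1.integral_densityMeasure]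
  · rw [solutionMeasure_of_nonpos le_rfl, hf₀.1.integral_densityMeasure]
    refine (h.initial φ hφ hc).congr' ?_
    filter_upwards [self_mem_nhdsWithin] with s hs
    rw [solutionMeasure_of_pos hs, (h.density s hs).1.integral_densityMeasure]
  · rw [solutionMeasure_of_nonpos ht, solutionMeasure_of_nonpos le_rfl]

/-- Integrals against the scaled density are integrals against the scaled measure. -/
lemma integral_slowScaled {p q δ : ℝ} (hδ : 0 ≤ δ) (hq : 0 < q) {f₀ : ℝ → ℝ} {f : ℝ → ℝ → ℝ}
    (hf₀ : IsProbDensityWithMoment (2 + δ) f₀) (hnorm : IsNormalized f₀)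
    (h : IsWeakBoltzmannSolution p q (2 + δ) f₀ f) {φ : ℝ → ℝ} (hφ : Continuous φ) {τ : ℝ}
    (hτ : 0 < τ) :
    ∫ v, φ v * slowScaled q f τ v =
      ∫ v, φ v ∂scaledMeasure p q (solutionMeasure f₀ f) τ := by
  have hflow := h.isFlow (by linarith) hf₀
  have ht : 0 < τ / q ^ 2 := by positivity
  have h0 : ∫ v, v ∂solutionMeasure f₀ f 0 = 0 := by
    rw [solutionMeasure_of_nonpos le_rfl, hf₀.1.integral_densityMeasure]; exact hnorm.1
  have h1 : ∫ v, v ^ 2 ∂solutionMeasure f₀ f 0 = 1 := by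
    rw [solutionMeasure_of_nonpos le_rfl, hf₀.1.integral_densityMeasure]; exact hnorm.2
  have hE : energy f (τ / q ^ 2) = Real.exp ((p ^ 2 + q ^ 2 - 1) * (τ / q ^ 2)) := by
    rw [← hflow.energy_eq_exp (by linarith) h0 h1 ht.le, solutionMeasure_of_pos ht,
      (h.density _ ht).1.integral_densityMeasure]
    rfl
  set c := Real.exp ((p ^ 2 + q ^ 2 - 1) / 2 * (τ / q ^ 2)) with hc
  have hc0 : 0 < c := Real.exp_pos _
  have hs : √(energy f (τ / q ^ 2)) = c := by
    rw [hE, Real.sqrt_eq_iff_mul_self_eq (Real.exp_pos _).le hc0.le, hc, ← Real.exp_add]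
    congr 1; ring
  have hinv : Real.exp (-((p ^ 2 + q ^ 2 - 1) / 2) * (τ / q ^ 2)) = c⁻¹ := by
    rw [hc, ← Real.exp_neg]; congr 1; ring
  unfold scaledMeasure slowScaled scaled
  rw [integral_map_mul hφ, hinv, solutionMeasure_of_pos ht,
    (h.density _ ht).1.integral_densityMeasure, hs]
  -- Substitution `x = v c`: the Jacobian absorbs the prefactor `√E = c` of the scaled density.
  have := Measure.integral_comp_mul_right (fun x => φ (c⁻¹ * x) * (c * f (τ / q ^ 2) x)) c
  rw [abs_of_pos (inv_pos.2 hc0), smul_eq_mul, ← integral_const_mul] at this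
  calc _ = ∫ v, φ (c⁻¹ * (v * c)) * (c * f (τ / q ^ 2) (v * c)) := by
        refine integral_congr_ae (Eventually.of_forall fun v => ?_)
        simp only
        rw [show c⁻¹ * (v * c) = v by field_simp]
    _ = _ := this
    _ = _ := by
        refine integral_congr_ae (Eventually.of_forall fun v => ?_)
        simp only
        field_simp

end KineticFP

/-! ### Assembly of the theorem. -/

open KineticFP in
theorem mainTheorem2 (δ lam : ℝ) (hδ : 0 < δ)
    (f₀ : ℝ → ℝ) (hf₀ : KineticFP.IsProbDensityWithMoment (2 + δ) f₀)
    (hnorm : KineticFP.IsNormalized f₀)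
    (p q : ℕ → ℝ) (hq : ∀ n, 0 < q n) (hpq : ∀ n, q n < p n)
    (hlam : ∀ n, (p n - 1) ^ 2 / q n ^ 2 = lam ^ 2)
    (hq0 : Tendsto q atTop (𝓝 0))
    (f : ℕ → ℝ → ℝ → ℝ)
    (hf : ∀ n, KineticFP.IsWeakBoltzmannSolution (p n) (q n) (2 + δ) f₀ (f n)) :
    ∃ (k : ℕ → ℕ) (h : ℝ → ℝ → ℝ), StrictMono k ∧
      (∀ τ, 0 < τ → KineticFP.IsProbDensityWithMoment (2 + δ) (h τ)) ∧
      (∀ φ ∈ KineticFP.HolderClass (2 + δ), ∀ τ, 0 < τ →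
        Tendsto (fun j => ∫ v, φ v * KineticFP.slowScaled (q (k j)) (f (k j)) τ v) atTop
          (𝓝 (∫ v, φ v * h τ v))) ∧
      KineticFP.IsWeakFokkerPlanckSolution lam (2 + δ) f₀ h := by
  have ha : 0 ≤ 2 + δ := by linarith
  have hδ0 := hδ.le
  have hmix : ∀ n, (p n - 1) ^ 2 = lam ^ 2 * q n ^ 2 := fun n =>
    (div_eq_iff (pow_pos (hq n) 2).ne').1 (hlam n)
  have hev : ∀ᶠ n in atTop, q n < 1 ∧ |lam| * q n < 1 / 2 :=
    (hq0.eventually_lt_const one_pos).and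
      ((hq0.const_mul |lam|).eventually_lt_const (by rw [mul_zero]; norm_num))
  -- Dropping the first `N` terms ensures `q ≤ 1` for the Taylor estimates and `p ≥ 1/2` for the
  -- density bounds; the final subsequence is shifted by `N`.
  obtain ⟨N, hN⟩ := eventually_atTop.1 hev
  have hphalf : ∀ n, 1 / 2 ≤ p (n + N) := fun n => by
    have h1 := hN (n + N) (Nat.le_add_left _ _)
    have h2 : |p (n + N) - 1| = |lam| * q (n + N) := by
      rw [← abs_of_pos (hq (n + N)), ← abs_mul, ← sq_eq_sq_iff_abs_eq_abs, hmix]; ring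
    have := (abs_le.1 h2.le).1
    linarith [h1.2]
  set μ : ℕ → ℝ → Measure ℝ := fun n => solutionMeasure f₀ (f (n + N)) with hμ
  have hflow : ∀ n, IsFlow (p (n + N)) (q (n + N)) (2 + δ) (μ n) := fun n =>
    (hf (n + N)).isFlow ha hf₀
  have hμ0 : ∀ n, μ n 0 = densityMeasure f₀ := fun n => solutionMeasure_of_nonpos le_rfl
  set ρ : ℕ → ℝ → Measure ℝ := fun n => scaledMeasure (p (n + N)) (q (n + N)) (μ n) with hρ
  have hseq : IsScaledSequence lam δ (densityMeasure f₀) (fun n => p (n + N)) (fun n => q (n + N))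
      ρ :=
    ⟨fun n => (hflow n).isScaledFlow hδ0 (hq _) (hmix _)
      (by rw [hμ0, hf₀.1.integral_densityMeasure]; exact hnorm.1)
      (by rw [hμ0, hf₀.1.integral_densityMeasure]; exact hnorm.2),
    fun n => hq _, fun n => (hN (n + N) (Nat.le_add_left _ _)).1.le, fun n => hmix _,
    (tendsto_add_atTop_iff_nat N).2 hq0, fun n => by simp [hρ, scaledMeasure, hμ0]⟩
  obtain ⟨k, Q, hk, hQm, hQc, hQd, hQ0⟩ := hseq.exists_limit hδ
  have hac : ∀ τ, 0 ≤ τ → (Q τ : Measure ℝ) ≪ volume := fun τ hτ => by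
    refine absolutelyContinuous_of_densityBound fun ε hε => ?_
    obtain ⟨K, hK, hKb⟩ := exists_densityBound hf₀.1.1 hf₀.1.2.1 hε
    refine ⟨K * Real.exp ((3 * lam ^ 2 + 1) * τ), by positivity, fun φ hφ => ?_⟩
    obtain ⟨C, hC⟩ := HasGrowth.of_hasCompactSupport hφ.continuous hφ.compact ha
    refine le_of_tendsto' (hQc C φ hC τ hτ) fun j => ?_
    refine (hflow (k j)).densityBound_scaled ha (hphalf _) (hq _) (hmix _) hε.le hK ?_ hτ φ hφ
    rw [hμ0]
    exact hKb
  -- By absolute continuity the Radon–Nikodym derivative represents `Q τ` in full, so every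
  -- statement on `Q` transfers to `h`.
  set h : ℝ → ℝ → ℝ := fun τ v => ((Q τ : Measure ℝ).rnDeriv volume v).toReal with hh
  have hint : ∀ τ, 0 ≤ τ → ∀ φ : ℝ → ℝ, ∫ v, φ v * h τ v = ∫ v, φ v ∂(Q τ : Measure ℝ) :=
    fun τ hτ φ => by
      rw [← integral_rnDeriv_smul (hac τ hτ)]
      simp only [hh, smul_eq_mul, mul_comm]
  have hdens : ∀ τ, 0 < τ → IsProbDensityWithMoment (2 + δ) (h τ) := fun τ hτ => by
    refine ⟨⟨Eventually.of_forall fun v => ENNReal.toReal_nonneg,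
      Measure.integrable_toReal_rnDeriv, ?_⟩, ?_⟩
    · simp only [hh]
      rw [Measure.integral_toReal_rnDeriv (hac τ hτ.le), probReal_univ]
    · have h1 : Integrable (fun v : ℝ => |v| ^ (2 + δ)) (Q τ : Measure ℝ) := by
        refine (hQm τ).mono' (continuous_abs.rpow_const fun _ => Or.inr ha).aestronglyMeasurable
          (Eventually.of_forall fun v => ?_)
        rw [Real.norm_eq_abs, abs_of_nonneg (Real.rpow_nonneg (abs_nonneg v) _)]
        exact Real.rpow_le_rpow (abs_nonneg v) (by linarith) ha
      have h2 := (integrable_toReal_rnDeriv_mul_iff (hac τ hτ.le)).2 h1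
      simpa only [hh, mul_comm] using h2
  have hgrow : ∀ φ ∈ HolderClass (2 + δ), ∃ C, HasGrowth (2 + δ) C φ := fun φ hφ => by
    obtain ⟨C, κ, -, -, hC, -⟩ := exists_isC2_of_mem_holderClass hδ hφ
    exact ⟨_, hC.growth_self hδ0⟩
  refine ⟨fun j => k j + N, h, fun i j hij => Nat.add_lt_add_right (hk hij) N, hdens,
    fun φ hφ τ hτ => ?_, hdens, fun φ hφ τ hτ => ?_, fun φ hφ => ?_⟩
  · obtain ⟨C, hC⟩ := hgrow φ hφ
    rw [hint τ hτ.le]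
    refine (hQc C φ hC τ hτ.le).congr fun j => ?_
    exact (integral_slowScaled hδ0 (hq _) hf₀ hnorm (hf _) hC.1 hτ).symm
  · obtain ⟨C, κ, -, -, hC, -⟩ := exists_isC2_of_mem_holderClass hδ hφ
    have h1 : ∫ v, generator lam (deriv φ) (iteratedDeriv 2 φ) v ∂(Q τ : Measure ℝ) =
        1 / 2 * (∫ v, (lam ^ 2 * v ^ 2 + 1) * iteratedDeriv 2 φ v * h τ v)
        - 1 / 2 * (lam ^ 2 + 1) * ∫ v, deriv φ v * v * h τ v := by
      rw [hint τ hτ.le fun v => (lam ^ 2 * v ^ 2 + 1) * iteratedDeriv 2 φ v,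
        hint τ hτ.le fun v => deriv φ v * v]
      unfold generator
      rw [integral_sub (((hC.growth_diffusion lam).integrable (hQm τ)).const_mul _)
        (((hC.growth_id_mul hδ0).integrable (hQm τ)).const_mul _), integral_const_mul,
        integral_const_mul]
      simp only [mul_comm (deriv φ _)]
    rw [← h1]
    refine (hQd φ hφ τ hτ).congr_of_eventuallyEq ?_
    filter_upwards [Ioi_mem_nhds hτ] with s hs
    exact hint s (le_of_lt hs) φ
  · obtain ⟨C, hC⟩ := hgrow φ hφ
    rw [← hf₀.1.integral_densityMeasure]
    refine (hQ0 C φ hC).congr' ?_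
    filter_upwards [self_mem_nhdsWithin] with s hs
    exact (hint s (le_of_lt hs) φ).symm
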